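/- Let $T=(\mathbb C^\times)^r$ be a complex torus with Lie algebra $\mathfrak t=\mathbb C^r$ and let $V$ be a finite-dimensional rational representation of $T$ over $\mathbb C$. Conventions. A vector $x\in V$ is semisimple if $T\cdot x$ is closed, and nilpotent if $0\in\overline{T\cdot x}$. The representation is visible if it has only finitely many nilpotent $T$-orbits. A Cartan subspace of $V$ is a subspace of the form $\mathfrak c=\{x\in V\mid \mathfrak t\cdot x\subseteq\mathfrak t\cdot v\}$ with $v$ semisimple and $\dim\mathfrak c=\dim V/\!\!/T$, where $V/\!\!/T=\operatorname{Spec}\mathbb C[V]^T$; the representation is polar if a Cartan subspace exists. A pair of subspaces $\mathfrak c\subseteq V$, $\mathfrak c^\vee\subseteq V^*$ is a pair of dual Cartan subspaces if $\mathfrak c$ is a Cartan subspace of $V$ and there is a Hermitian inner product $h$ on $V$ (antilinear in the first variable), invariant under the maximal compact subgroup of $T$, such that every $x\in\mathfrak c$ is of minimal length in $T\cdot x$ and $\mathfrak c^\vee=\{h(x,\cdot)\mid x\in\mathfrak c\}$. The pairing between $V$ and $V^*$ then identifies $\mathfrak c^\vee$ with $\mathfrak c^*$. The Weyl group is $W=N_T(\mathfrak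 c)/C_T(\mathfrak c)$; it acts on $\mathfrak c$, and contragrediently on $\mathfrak c^\vee\cong\mathfrak c^*$. Let $\mu:V\oplus V^*\to\mathfrak t^*$, $\mu(x,\varphi)(\xi)=\varphi(\xi\cdot x)$, be the moment map, let $I$ be the ideal of $\mathbb C[V\oplus V^*]$ generated by the functions $(x,\varphi)\mapsto\varphi(\xi\cdot x)$, $\xi\in\mathfrak t$, and let $(V\oplus V^*)/\!\!/\!\!/T=\mu^{-1}(0)/\!\!/T=\operatorname{Spec}\,(\mathbb C[V\oplus V^*]/I)^T$ be the symplectic reduction. It carries the Poisson structure induced from $\mathbb C[V\oplus V^*]^T$, while $(\mathfrak c\oplus\mathfrak c^\vee)/W$ carries the Poisson structure induced by the restriction to $\mathfrak c\oplus\mathfrak c^\vee$ of the canonical symplectic form of $V\oplus V^*$. Theorem. Assume that the representation of $T$ on $V$ is visible. Then it is polar, every Cartan subspace $\mathfrak c$ of $V$ belongs to a pair $(\mathfrak c,\mathfrak c^\vee)$ of dual Cartan subspaces, and for every such pair there is an isomorphism of Poisson varieties $$(V\oplus V^*)/\!\!/\!\!/T\;\cong\;(\mathfrak c\oplus\mathfrak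 c^\vee)/W .$$ More precisely, there is an isomorphism of Poisson algebras $(\mathbb C[V\oplus V^*]/I)^T\cong\mathbb C[\mathfrak c\oplus\mathfrak c^\vee]^W$ that sends the class of every $f\in\mathbb C[V\oplus V^*]^T$ to its restriction $f|_{\mathfrak c\oplus\mathfrak c^\vee}$. -/

import Mathlib

noncomputable section

namespace TorusReduction

/-! ### Polynomial functions on a vector space -/

section Polynomial

variable {M N : Type*} [AddCommGroup M] [Module ℂ M] [AddCommGroup N] [Module ℂ N]

variable (M) in
/-- The coordinate ring `ℂ[M]` of a vector space `M`: the algebra of functions on `M` that is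
generated by the linear forms. -/
abbrev Poly : Subalgebra ℂ (M → ℂ) :=
  Algebra.adjoin ℂ (Set.range fun φ : Module.Dual ℂ M => (φ : M → ℂ))

theorem linear_mem_poly (φ : Module.Dual ℂ M) : (φ : M → ℂ) ∈ Poly M :=
  Algebra.subset_adjoin ⟨φ, rfl⟩

theorem comp_mem_poly (A : M →ₗ[ℂ] N) (f : N → ℂ) (hf : f ∈ Poly N) :
    (fun p => f (A p)) ∈ Poly M := by
  induction hf using Algebra.adjoin_induction with
  | mem x hx =>
    obtain ⟨φ, rfl⟩ := hx
    exact linear_mem_poly (φ.comp A)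
  | algebraMap r => exact (Poly M).algebraMap_mem r
  | add x y _ _ h₁ h₂ => exact (Poly M).add_mem h₁ h₂
  | mul x y _ _ h₁ h₂ => exact (Poly M).mul_mem h₁ h₂

/-- Pull-back of polynomial functions along a linear map, `f ↦ f ∘ A`. -/
def pullback (A : M →ₗ[ℂ] N) : Poly N →ₐ[ℂ] Poly M where
  toFun f := ⟨fun p => f.1 (A p), comp_mem_poly A f.1 f.2⟩
  map_one' := rfl
  map_mul' _ _ := rfl
  map_zero' := rfl
  map_add' _ _ := rfl
  commutes' _ := rfl

@[simp] theorem pullback_apply (A : M →ₗ[ℂ] N) (f : Poly N) (p : M) :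
    (pullback A f).1 p = f.1 (A p) := rfl

/-- The Zariski closure of a subset of a vector space. -/
def zariskiClosure (s : Set M) : Set M :=
  {y | ∀ f : Poly M, (∀ p ∈ s, f.1 p = 0) → f.1 y = 0}

/-- Every polynomial function has a differential, also along curves. -/
theorem exists_differential (f : M → ℂ) (hf : f ∈ Poly M) (p : M) :
    ∃ L : Module.Dual ℂ M, ∀ (γ : ℂ → M) (n : M), γ 0 = p →
      (∀ φ : Module.Dual ℂ M, HasDerivAt (fun z => φ (γ z)) (φ n) 0) →
      HasDerivAt (fun z => f (γ z)) (L n) 0 := by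
  induction hf using Algebra.adjoin_induction with
  | mem x hx =>
    obtain ⟨φ, rfl⟩ := hx
    exact ⟨φ, fun γ n _ h => h φ⟩
  | algebraMap r => exact ⟨0, fun γ n _ _ => hasDerivAt_const _ _⟩
  | add x y _ _ h₁ h₂ =>
    obtain ⟨L₁, h₁⟩ := h₁
    obtain ⟨L₂, h₂⟩ := h₂
    exact ⟨L₁ + L₂, fun γ n h0 h => (h₁ γ n h0 h).add (h₂ γ n h0 h)⟩
  | mul x y _ _ h₁ h₂ =>
    obtain ⟨L₁, h₁⟩ := h₁
    obtain ⟨L₂, h₂⟩ := h₂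
    refine ⟨y p • L₁ + x p • L₂, fun γ n h0 h => ?_⟩
    have := (h₁ γ n h0 h).mul (h₂ γ n h0 h)
    rw [h0] at this
    refine this.congr_deriv ?_
    simp [mul_comm]

theorem hasDerivAt_line (p v : M) (φ : Module.Dual ℂ M) :
    HasDerivAt (fun z : ℂ => φ (p + z • v)) (φ v) 0 := by
  have : HasDerivAt (fun z : ℂ => φ p + z * φ v) (1 * φ v) 0 :=
    ((hasDerivAt_id (0 : ℂ)).mul_const (φ v)).const_add (φ p)
  simpa using this

/-- The differential `d_p f ∈ M*` of a polynomial function `f` at a point `p`; its value at `v` is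
the derivative of `z ↦ f (p + z v)` at `z = 0`. -/
def differential (f : Poly M) (p : M) : Module.Dual ℂ M where
  toFun v := deriv (fun z : ℂ => f.1 (p + z • v)) 0
  map_add' u v := by
    obtain ⟨L, hL⟩ := exists_differential f.1 f.2 p
    have h (v : M) : deriv (fun z : ℂ => f.1 (p + z • v)) 0 = L v :=
      (hL _ v (by simp) (hasDerivAt_line p v)).deriv
    simp only [h, map_add]
  map_smul' c v := by
    obtain ⟨L, hL⟩ := exists_differential f.1 f.2 p
    have h (v : M) : deriv (fun z : ℂ => f.1 (p + z • v)) 0 = L v :=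
      (hL _ v (by simp) (hasDerivAt_line p v)).deriv
    simp only [h, map_smul, RingHom.id_apply]

theorem differential_hasDerivAt (f : Poly M) (p : M) (γ : ℂ → M) (n : M) (h0 : γ 0 = p)
    (h : ∀ φ : Module.Dual ℂ M, HasDerivAt (fun z => φ (γ z)) (φ n) 0) :
    HasDerivAt (fun z => f.1 (γ z)) (differential f p n) 0 := by
  obtain ⟨L, hL⟩ := exists_differential f.1 f.2 p
  have : differential f p n = L n := (hL _ n (by simp) (hasDerivAt_line p n)).deriv
  rw [this]
  exact hL γ n h0 h

theorem differential_line (f : Poly M) (p v : M) :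
    HasDerivAt (fun z : ℂ => f.1 (p + z • v)) (differential f p v) 0 :=
  differential_hasDerivAt f p _ v (by simp) (hasDerivAt_line p v)

theorem differential_linear (φ : Module.Dual ℂ M) (p : M) :
    differential ⟨φ, linear_mem_poly φ⟩ p = φ := by
  ext v
  exact (differential_line _ p v).unique (hasDerivAt_line p v φ)

theorem differential_add (f g : Poly M) (p : M) :
    differential (f + g) p = differential f p + differential g p := by
  ext v
  exact (differential_line _ p v).unique ((differential_line f p v).add (differential_line g p v))

theorem differential_mul (f g : Poly M) (p : M) :
    differential (f * g) p = f.1 p • differential g p + g.1 p • differential f p := by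
  ext v
  have h := (differential_line f p v).mul (differential_line g p v)
  refine (differential_line _ p v).unique (h.congr_deriv ?_)
  simp [mul_comm, add_comm]

theorem differential_algebraMap (r : ℂ) (p : M) :
    differential (algebraMap ℂ (Poly M) r) p = 0 := by
  ext v
  exact (differential_line _ p v).unique (hasDerivAt_const _ _)

theorem differential_pullback (A : M →ₗ[ℂ] N) (f : Poly N) (p : M) :
    differential (pullback A f) p = (differential f (A p)).comp A := by
  ext v
  refine (differential_line _ p v).unique ?_
  have := differential_line f (A p) (A v)
  simpa using this

theorem differential_mem (f : Poly M) (v : M) : (fun p => differential f p v) ∈ Poly M := by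
  obtain ⟨f, hf⟩ := f
  induction hf using Algebra.adjoin_induction with
  | mem x hx =>
    obtain ⟨φ, rfl⟩ := hx
    have : (fun p => differential (⟨φ, linear_mem_poly φ⟩ : Poly M) p v) =
        algebraMap ℂ (M → ℂ) (φ v) := by
      ext p
      rw [differential_linear]; rfl
    exact this ▸ (Poly M).algebraMap_mem _
  | algebraMap r =>
    have : (fun p => differential (algebraMap ℂ (Poly M) r) p v) = 0 := by
      ext p
      rw [differential_algebraMap]; rfl
    exact this ▸ (Poly M).zero_mem
  | add x y hx hy h₁ h₂ =>
    have : (fun p => differential ((⟨x, hx⟩ : Poly M) + ⟨y, hy⟩) p v) =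
        (fun p => differential (⟨x, hx⟩ : Poly M) p v) +
        (fun p => differential (⟨y, hy⟩ : Poly M) p v) := by
      ext p
      rw [differential_add]; rfl
    exact this ▸ (Poly M).add_mem h₁ h₂
  | mul x y hx hy h₁ h₂ =>
    have : (fun p => differential ((⟨x, hx⟩ : Poly M) * ⟨y, hy⟩) p v) =
        x * (fun p => differential (⟨y, hy⟩ : Poly M) p v) +
        y * (fun p => differential (⟨x, hx⟩ : Poly M) p v) := by
      ext p
      rw [differential_mul]; rfl
    exact this ▸ (Poly M).add_mem ((Poly M).mul_mem hx h₂) ((Poly M).mul_mem hy h₁)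

end Polynomial

/-! ### The Poisson bracket of a symplectic vector space -/

section Bracket

variable {M : Type*} [AddCommGroup M] [Module ℂ M] [FiniteDimensional ℂ M]
variable (ω : LinearMap.BilinForm ℂ M) (hω : ω.Nondegenerate)

/-- The Hamiltonian vector of `f` at `p`: the vector `X` with `ω(X, ·) = d_p f`. -/
def hamiltonian (f : Poly M) (p : M) : M := (ω.toDual hω).symm (differential f p)

theorem bracket_mem (f g : Poly M) :
    (fun p => ω (hamiltonian ω hω f p) (hamiltonian ω hω g p)) ∈ Poly M := by
  let b := Module.finBasis ℂ M
  have : (fun p => ω (hamiltonian ω hω f p) (hamiltonian ω hω g p)) =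
      ∑ i, ∑ j, (fun p => differential f p (b i)) * (fun p => differential g p (b j)) *
        algebraMap ℂ (M → ℂ) (ω ((ω.toDual hω).symm (b.coord i))
          ((ω.toDual hω).symm (b.coord j))) := by
    ext p
    have h (f : Poly M) : hamiltonian ω hω f p =
        ∑ i, differential f p (b i) • (ω.toDual hω).symm (b.coord i) := by
      rw [hamiltonian]
      conv_lhs => rw [← b.sum_dual_apply_smul_coord (differential f p)]
      rw [map_sum]
      simp only [map_smul]
    rw [h f, h g]
    simp [Finset.sum_apply, Finset.mul_sum, mul_assoc]
    rw [Finset.sum_comm]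
    refine Finset.sum_congr rfl fun i _ => Finset.sum_congr rfl fun j _ => by ring
  rw [this]
  refine (Poly M).sum_mem fun i _ => (Poly M).sum_mem fun j _ => ?_
  exact (Poly M).mul_mem ((Poly M).mul_mem (differential_mem f _) (differential_mem g _))
    ((Poly M).algebraMap_mem _)

/-- The Poisson bracket on the coordinate ring of a symplectic vector space `(M, ω)`:
`{f, g}(p) = ω(X_f(p), X_g(p))` with the Hamiltonian vectors `X_f`, `X_g`. -/
def bracket (f g : Poly M) : Poly M :=
  ⟨fun p => ω (hamiltonian ω hω f p) (hamiltonian ω hω g p), bracket_mem ω hω f g⟩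

end Bracket

/-! ### Invariants of linear actions -/

section Invariants

variable {G : Type*} [Group G] {M : Type*} [AddCommGroup M] [Module ℂ M]

/-- The algebra `ℂ[M]^G` of invariant polynomial functions. -/
def Invariants (τ : Representation ℂ G M) : Subalgebra ℂ (Poly M) where
  carrier := {f | ∀ g p, f.1 (τ g p) = f.1 p}
  mul_mem' {a b} ha hb g p := by
    change a.1 _ * b.1 _ = a.1 _ * b.1 _
    rw [ha g p, hb g p]
  add_mem' {a b} ha hb g p := by
    change a.1 _ + b.1 _ = a.1 _ + b.1 _
    rw [ha g p, hb g p]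
  algebraMap_mem' _ _ _ := rfl

variable [FiniteDimensional ℂ M]

/-- The Poisson bracket of functions that are invariant under symplectic linear maps is
invariant. -/
theorem bracket_mem_invariants (τ : Representation ℂ G M) (ω : LinearMap.BilinForm ℂ M)
    (hω : ω.Nondegenerate) (hτ : ∀ g p q, ω (τ g p) (τ g q) = ω p q) (f g : Poly M)
    (hf : f ∈ Invariants τ) (hg : g ∈ Invariants τ) : bracket ω hω f g ∈ Invariants τ := by
  have key (f : Poly M) (hf : f ∈ Invariants τ) (t : G) (p : M) :
      hamiltonian ω hω f (τ t p) = τ t (hamiltonian ω hω f p) := by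
    apply (ω.toDual hω).injective
    ext v
    have hpb : pullback (τ t) f = f := by
      ext q
      exact hf t q
    have h1 : differential f p = (differential f (τ t p)).comp (τ t) := by
      rw [← differential_pullback, hpb]
    have hv : τ t (τ t⁻¹ v) = v := by
      rw [← Module.End.mul_apply, ← map_mul]; simp
    rw [LinearMap.BilinForm.toDual_def, LinearMap.BilinForm.toDual_def, hamiltonian,
      LinearMap.BilinForm.apply_toDual_symm_apply]
    conv_rhs => rw [← hv]
    rw [hτ, hamiltonian, LinearMap.BilinForm.apply_toDual_symm_apply, h1, LinearMap.comp_apply, hv]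
  intro t p
  change ω _ _ = ω _ _
  rw [key f hf, key g hg, hτ]

/-- The Poisson bracket on the invariants of a group of symplectic linear maps, i.e. the Poisson
structure of the quotient of a symplectic vector space by this group. -/
def invBracket (τ : Representation ℂ G M) (ω : LinearMap.BilinForm ℂ M)
    (hω : ω.Nondegenerate) (hτ : ∀ g p q, ω (τ g p) (τ g q) = ω p q) (f g : Invariants τ) : Invariants τ :=
  ⟨bracket ω hω f.1 g.1, bracket_mem_invariants τ ω hω hτ f.1 g.1 f.2 g.2⟩

end Invariants

/-! ### Rational representations of the torus `(ℂˣ)^r` -/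

variable {r : ℕ} {V : Type*} [AddCommGroup V] [Module ℂ V]

/-- The character `t ↦ ∏ⱼ tⱼ ^ mⱼ` of the torus. -/
def character (m : Fin r → ℤ) : (Fin r → ℂˣ) →* ℂ where
  toFun t := ∏ j, ((t j ^ m j : ℂˣ) : ℂ)
  map_one' := by simp
  map_mul' s t := by simp [mul_zpow, Finset.prod_mul_distrib]

/-- A representation of the torus is rational (algebraic) if its matrix coefficients are Laurent
polynomials, i.e. if `ρ t = ∑ₘ t^m Aₘ` with finitely many endomorphisms `Aₘ`. -/
def IsRational (ρ : Representation ℂ (Fin r → ℂˣ) V) : Prop :=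
  ∃ A : (Fin r → ℤ) →₀ Module.End ℂ V, ∀ t, ρ t = A.sum fun m a => character m t • a

/-- The exponential map `ℂ^r → (ℂˣ)^r` of the torus. -/
def torusExp (ξ : Fin r → ℂ) : Fin r → ℂˣ :=
  fun j => Units.mk0 (Complex.exp (ξ j)) (Complex.exp_ne_zero _)

/-- The moment map `μ(x, φ)(ξ) = φ(ξ · x)`, where `ξ · x` is the derivative of
`z ↦ ρ(exp(z ξ)) x` at `z = 0`. -/
def moment (ρ : Representation ℂ (Fin r → ℂˣ) V) (ξ : Fin r → ℂ) (p : V × Module.Dual ℂ V) : ℂ :=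
  deriv (fun z : ℂ => p.2 (ρ (torusExp (z • ξ)) p.1)) 0

/-- The set `𝔱 · x` of all `ξ · x`; the vector `y = ξ · x` is described by
`φ(y) = φ(ξ · x) = μ(x, φ)(ξ)` for all `φ ∈ V*`. -/
def tangent (ρ : Representation ℂ (Fin r → ℂˣ) V) (x : V) : Set V :=
  {y | ∃ ξ : Fin r → ℂ, ∀ φ : Module.Dual ℂ V, φ y = moment ρ ξ (x, φ)}

/-- The orbit of a vector. -/
def orbit (ρ : Representation ℂ (Fin r → ℂˣ) V) (x : V) : Set V := Set.range fun t => ρ t x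

/-- A vector is semisimple if its orbit is Zariski closed. -/
def IsSemisimpleVec (ρ : Representation ℂ (Fin r → ℂˣ) V) (x : V) : Prop :=
  zariskiClosure (orbit ρ x) = orbit ρ x

/-- A vector is nilpotent if the Zariski closure of its orbit contains `0`. -/
def IsNilpotentVec (ρ : Representation ℂ (Fin r → ℂˣ) V) (x : V) : Prop :=
  (0 : V) ∈ zariskiClosure (orbit ρ x)

/-- A representation is visible if it has finitely many nilpotent orbits. -/
def IsVisibleRep (ρ : Representation ℂ (Fin r → ℂˣ) V) : Prop :=
  {O : Set V | ∃ x, IsNilpotentVec ρ x ∧ O = orbit ρ x}.Finite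

/-- A Cartan subspace: `𝔠 = {x | 𝔱 · x ⊆ 𝔱 · v}` for a semisimple vector `v`, with
`dim 𝔠 = dim V // T`. -/
def IsCartanSubspace (ρ : Representation ℂ (Fin r → ℂˣ) V) (c : Submodule ℂ V) : Prop :=
  ∃ v, IsSemisimpleVec ρ v ∧ (c : Set V) = {x | tangent ρ x ⊆ tangent ρ v} ∧
    ((Module.finrank ℂ c : ℕ) : WithBot ℕ∞) = ringKrullDim (Invariants ρ)

/-- A representation is polar if it has a Cartan subspace. -/
def IsPolar (ρ : Representation ℂ (Fin r → ℂˣ) V) : Prop := ∃ c, IsCartanSubspace ρ c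

/-- A Hermitian inner product on `V` (antilinear in the first variable) that is invariant under the
maximal compact subgroup of the torus. -/
structure IsCompactInvariantHermitian (ρ : Representation ℂ (Fin r → ℂˣ) V)
    (h : V →ₗ⋆[ℂ] Module.Dual ℂ V) : Prop where
  conj_symm : ∀ x y, starRingEnd ℂ (h x y) = h y x
  pos : ∀ x, x ≠ 0 → 0 < (h x x).re
  invariant : ∀ t : Fin r → ℂˣ, (∀ j, ‖(t j : ℂ)‖ = 1) → ∀ x y, h (ρ t x) (ρ t y) = h x y

/-- `c` and `cd` are dual Cartan subspaces of `V` and `V*`: for some Hermitian inner product `h`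
on `V` that is invariant under the maximal compact subgroup, the Cartan subspace `c` consists of
vectors that are of minimal length in their orbits, and `cd` is the image of `c` under
the antilinear isomorphism `V → V*`, `x ↦ h(x, ·)`. -/
structure IsDualCartanPair (ρ : Representation ℂ (Fin r → ℂˣ) V) (c : Submodule ℂ V)
    (cd : Submodule ℂ (Module.Dual ℂ V)) : Prop where
  cartan : IsCartanSubspace ρ c
  exists_hermitian : ∃ h : V →ₗ⋆[ℂ] Module.Dual ℂ V, IsCompactInvariantHermitian ρ h ∧
    (∀ x ∈ c, ∀ t, (h x x).re ≤ (h (ρ t x) (ρ t x)).re) ∧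
    (cd : Set (Module.Dual ℂ V)) = h '' (c : Set V)

/-! ### The cotangent representation and its symplectic form -/

/-- The representation of the torus on `V ⊕ V*`. -/
abbrev cotangent (ρ : Representation ℂ (Fin r → ℂˣ) V) :
    Representation ℂ (Fin r → ℂˣ) (V × Module.Dual ℂ V) := ρ.prod ρ.dual

variable (V) in
/-- The canonical symplectic form `ω((x, φ), (y, ψ)) = ψ(x) - φ(y)` on `V ⊕ V*`. -/
def sympForm : LinearMap.BilinForm ℂ (V × Module.Dual ℂ V) :=
  LinearMap.mk₂ ℂ (fun p q => q.2 p.1 - p.2 q.1)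
    (fun p p' q => by simp; ring) (fun a p q => by simp; ring)
    (fun p q q' => by simp; ring) (fun a p q => by simp; ring)

@[simp] theorem sympForm_apply (p q : V × Module.Dual ℂ V) :
    sympForm V p q = q.2 p.1 - p.2 q.1 := rfl

theorem sympForm_skew (p q : V × Module.Dual ℂ V) : sympForm V p q = - sympForm V q p := by
  simp

theorem sympForm_nondegenerate : (sympForm V).Nondegenerate := by
  have hl : (sympForm V).SeparatingLeft := by
    intro p hp
    have h1 : p.1 = 0 := by
      rw [← Module.forall_dual_apply_eq_zero_iff ℂ]
      intro φ
      simpa using hp (0, φ)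
    have h2 : p.2 = 0 := by
      ext y
      simpa using hp (y, 0)
    exact Prod.ext h1 h2
  refine ⟨hl, fun q hq => hl q fun p => ?_⟩
  rw [sympForm_skew, hq p, neg_zero]

theorem sympForm_cotangent (ρ : Representation ℂ (Fin r → ℂˣ) V) (t : Fin r → ℂˣ)
    (p q : V × Module.Dual ℂ V) :
    sympForm V (cotangent ρ t p) (cotangent ρ t q) = sympForm V p q := by
  have h (x : V) : ρ t⁻¹ (ρ t x) = x := by
    rw [← Module.End.mul_apply, ← map_mul]; simp
  simp [Representation.dual_apply, Module.Dual.transpose_apply, h]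

/-! ### The symplectic reduction -/

/-- The ideal of the null-fibre `μ⁻¹(0)` (as a scheme): it is generated by the functions
`(x, φ) ↦ φ(ξ · x)`. -/
def momentIdeal (ρ : Representation ℂ (Fin r → ℂˣ) V) : Ideal (Poly (V × Module.Dual ℂ V)) :=
  Ideal.span {f | ∃ ξ : Fin r → ℂ, ∀ p, f.1 p = moment ρ ξ p}

theorem moment_invariant (ρ : Representation ℂ (Fin r → ℂˣ) V) (ξ : Fin r → ℂ) (t : Fin r → ℂˣ)
    (p : V × Module.Dual ℂ V) : moment ρ ξ (cotangent ρ t p) = moment ρ ξ p := by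
  have h (z : ℂ) : ρ t⁻¹ (ρ (torusExp (z • ξ)) (ρ t p.1)) = ρ (torusExp (z • ξ)) p.1 := by
    rw [← Module.End.mul_apply, ← Module.End.mul_apply, ← map_mul, ← map_mul]
    congr 2
    rw [mul_assoc, mul_comm (torusExp _) t, inv_mul_cancel_left]
  simp [moment, Representation.dual_apply, Module.Dual.transpose_apply, h]

theorem momentIdeal_le (ρ : Representation ℂ (Fin r → ℂˣ) V) (t : Fin r → ℂˣ) :
    momentIdeal ρ ≤ (momentIdeal ρ).comap (pullback (cotangent ρ t)) := by
  refine Ideal.span_le.2 ?_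
  rintro f ⟨ξ, hξ⟩
  refine Ideal.subset_span ⟨ξ, fun p => ?_⟩
  change f.1 (cotangent ρ t p) = _
  rw [hξ, moment_invariant]

/-- The coordinate ring `ℂ[μ⁻¹(0)]` of the null-fibre of the moment map. -/
abbrev NullFibreRing (ρ : Representation ℂ (Fin r → ℂˣ) V) : Type _ :=
  Poly (V × Module.Dual ℂ V) ⧸ momentIdeal ρ

/-- The action of the torus on `ℂ[μ⁻¹(0)]`, induced by `f ↦ f ∘ t`. -/
def nullFibreAct (ρ : Representation ℂ (Fin r → ℂˣ) V) (t : Fin r → ℂˣ) :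
    NullFibreRing ρ →ₐ[ℂ] NullFibreRing ρ :=
  Ideal.quotientMapₐ (momentIdeal ρ) (pullback (cotangent ρ t)) (momentIdeal_le ρ t)

/-- The coordinate ring `ℂ[μ⁻¹(0)]^T` of the symplectic reduction
`(V ⊕ V*) /// T = μ⁻¹(0) // T`. -/
def Reduction (ρ : Representation ℂ (Fin r → ℂˣ) V) : Subalgebra ℂ (NullFibreRing ρ) :=
  ⨅ t, AlgHom.equalizer (nullFibreAct ρ t) (AlgHom.id ℂ _)

theorem mem_reduction (ρ : Representation ℂ (Fin r → ℂˣ) V) (a : NullFibreRing ρ) :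
    a ∈ Reduction ρ ↔ ∀ t, nullFibreAct ρ t a = a := by
  simp [Reduction, Algebra.mem_iInf, AlgHom.mem_equalizer]

theorem mk_mem_reduction (ρ : Representation ℂ (Fin r → ℂˣ) V) (f : Invariants (cotangent ρ)) :
    Ideal.Quotient.mkₐ ℂ (momentIdeal ρ) f.1 ∈ Reduction ρ := by
  rw [mem_reduction]
  intro t
  have : pullback (cotangent ρ t) f.1 = f.1 := by
    ext p
    exact f.2 t p
  change Ideal.Quotient.mkₐ ℂ (momentIdeal ρ) (pullback (cotangent ρ t) f.1) = _
  rw [this]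

/-- The class in `ℂ[μ⁻¹(0)]^T` of an invariant function on `V ⊕ V*`. -/
def toReduction (ρ : Representation ℂ (Fin r → ℂˣ) V) : Invariants (cotangent ρ) →ₐ[ℂ] Reduction ρ :=
  ((Ideal.Quotient.mkₐ ℂ (momentIdeal ρ)).comp (Invariants (cotangent ρ)).val).codRestrict
    (Reduction ρ) (mk_mem_reduction ρ)

/-! ### The Poisson bracket of the symplectic reduction -/

theorem character_add (m m' : Fin r → ℤ) (t : Fin r → ℂˣ) :
    character (m + m') t = character m t * character m' t := by
  simp [character, zpow_add, Finset.prod_mul_distrib]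

theorem character_neg (m : Fin r → ℤ) (t : Fin r → ℂˣ) :
    character (-m) t = character m t⁻¹ := by
  simp [character]

theorem character_injective : Function.Injective (character : (Fin r → ℤ) → _) := by
  intro m m' h
  ext j
  have h2 : (2 : ℂ) ≠ 0 := two_ne_zero
  have hev (n : Fin r → ℤ) : character n (Pi.mulSingle j (Units.mk0 2 h2)) = (2 : ℂ) ^ n j := by
    change ∏ k : Fin r, _ = _
    rw [Finset.prod_eq_single j]
    · simp
    · intro k _ hk
      simp [Pi.mulSingle_eq_of_ne hk]
    · simp
  have h3 : (2 : ℂ) ^ m j = (2 : ℂ) ^ m' j := by rw [← hev, ← hev, h]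
  have h4 : (2 : ℝ) ^ m j = (2 : ℝ) ^ m' j := by
    have := congrArg norm h3
    simpa using this
  exact zpow_right_injective₀ (by norm_num) (by norm_num) h4

/-- Distinct characters are linearly independent, also with vector coefficients. -/
theorem character_indep {E : Type*} [AddCommGroup E] [Module ℂ E] (F : (Fin r → ℤ) →₀ E)
    (h : ∀ t, (F.sum fun m a => character m t • a) = 0) : F = 0 := by
  ext m
  rw [Finsupp.zero_apply, ← Module.forall_dual_apply_eq_zero_iff ℂ]
  intro φ
  have hli : LinearIndependent ℂ (fun m : Fin r → ℤ => (character m : (Fin r → ℂˣ) → ℂ)) :=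
    (linearIndependent_monoidHom (Fin r → ℂˣ) ℂ).comp _ character_injective
  rw [linearIndependent_iff] at hli
  have := hli (F.mapRange φ (map_zero φ)) (by
    ext t
    have ht := congrArg φ (h t)
    rw [Finsupp.sum, map_sum] at ht
    rw [Finsupp.linearCombination_apply, Finsupp.sum_mapRange_index (by simp), Finsupp.sum]
    simpa [Finset.sum_apply, mul_comm] using ht)
  simpa using DFunLike.congr_fun this m

/-- The functions `(t, p) ↦ ∑ₘ t^m gₘ(p)` with polynomial functions `gₘ`. -/
def laurentSpan (r : ℕ) (M : Type*) [AddCommGroup M] [Module ℂ M] :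
    Submodule ℂ ((Fin r → ℂˣ) → M → ℂ) :=
  Submodule.span ℂ {Φ | ∃ m, ∃ g ∈ Poly M, Φ = fun t p => character m t * g p}

theorem laurentSpan_mul {M : Type*} [AddCommGroup M] [Module ℂ M]
    {Φ Ψ : (Fin r → ℂˣ) → M → ℂ} (hΦ : Φ ∈ laurentSpan r M) (hΨ : Ψ ∈ laurentSpan r M) :
    Φ * Ψ ∈ laurentSpan r M := by
  induction hΦ using Submodule.span_induction with
  | mem x hx =>
    obtain ⟨m, g, hg, rfl⟩ := hx
    induction hΨ using Submodule.span_induction with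
    | mem y hy =>
      obtain ⟨m', g', hg', rfl⟩ := hy
      refine Submodule.subset_span ⟨m + m', g * g', (Poly M).mul_mem hg hg', ?_⟩
      ext t p
      simp only [Pi.mul_apply, character_add]
      ring
    | zero => simp
    | add x y _ _ h₁ h₂ => rw [mul_add]; exact add_mem h₁ h₂
    | smul a x _ h => rw [mul_smul_comm]; exact Submodule.smul_mem _ _ h
  | zero => simp
  | add x y _ _ h₁ h₂ => rw [add_mul]; exact add_mem h₁ h₂
  | smul a x _ h => rw [smul_mul_assoc]; exact Submodule.smul_mem _ _ h

theorem laurentSpan_expand {M : Type*} [AddCommGroup M] [Module ℂ M]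
    {Φ : (Fin r → ℂˣ) → M → ℂ} (hΦ : Φ ∈ laurentSpan r M) :
    ∃ F : (Fin r → ℤ) →₀ Poly M, ∀ t, Φ t = (F.sum fun m a => character m t • a).1 := by
  induction hΦ using Submodule.span_induction with
  | mem x hx =>
    obtain ⟨m, g, hg, rfl⟩ := hx
    refine ⟨Finsupp.single m ⟨g, hg⟩, fun t => ?_⟩
    rw [Finsupp.sum_single_index (by simp)]
    rfl
  | zero => exact ⟨0, fun t => by simp⟩
  | add x y _ _ h₁ h₂ =>
    obtain ⟨F, hF⟩ := h₁
    obtain ⟨F', hF'⟩ := h₂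
    refine ⟨F + F', fun t => ?_⟩
    rw [Finsupp.sum_add_index' (by simp) (by intros; rw [smul_add])]
    rw [Pi.add_apply, hF, hF']
    rfl
  | smul a x _ h =>
    obtain ⟨F, hF⟩ := h
    refine ⟨a • F, fun t => ?_⟩
    rw [Finsupp.sum_smul_index' (by simp)]
    simp only [smul_comm _ a]
    rw [← Finsupp.smul_sum, Pi.smul_apply, hF]
    rfl

theorem translate_mem_laurentSpan {ρ : Representation ℂ (Fin r → ℂˣ) V} (hρ : IsRational ρ)
    (f : V × Module.Dual ℂ V → ℂ) (hf : f ∈ Poly (V × Module.Dual ℂ V)) :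
    (fun t p => f (cotangent ρ t p)) ∈ laurentSpan r (V × Module.Dual ℂ V) := by
  induction hf using Algebra.adjoin_induction with
  | mem x hx =>
    obtain ⟨L, rfl⟩ := hx
    obtain ⟨A, hA⟩ := hρ
    have h : (fun t p => L (cotangent ρ t p)) =
        (∑ m ∈ A.support, fun t p => character m t * L (A m p.1, 0)) +
        ∑ m ∈ A.support, fun t p => character (-m) t * L (0, p.2.comp (A m)) := by
      ext t p
      have h1 : cotangent ρ t p = (ρ t p.1, 0) + (0, p.2.comp (ρ t⁻¹)) := by
        simp [Representation.dual_apply, Module.Dual.transpose_apply]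
      have h2 : ((ρ t p.1, 0) : V × Module.Dual ℂ V) =
          ∑ m ∈ A.support, character m t • ((A m p.1, 0) : V × Module.Dual ℂ V) := by
        rw [hA, Finsupp.sum]
        ext <;> simp [Prod.fst_sum, Prod.snd_sum]
      have h3 : ((0, p.2.comp (ρ t⁻¹)) : V × Module.Dual ℂ V) =
          ∑ m ∈ A.support, character (-m) t •
            ((0, p.2.comp (A m)) : V × Module.Dual ℂ V) := by
        rw [hA, Finsupp.sum]
        ext <;> simp [Prod.fst_sum, Prod.snd_sum, character_neg]
      rw [h1, map_add, h2, h3, map_sum, map_sum]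
      simp only [map_smul, Pi.add_apply, Finset.sum_apply, smul_eq_mul]
    rw [h]
    refine add_mem (sum_mem fun m _ => ?_) (sum_mem fun m _ => ?_)
    · refine Submodule.subset_span ⟨m, _, linear_mem_poly
        (L.comp ((LinearMap.inl ℂ V (Module.Dual ℂ V)).comp
          ((A m).comp (LinearMap.fst ℂ V (Module.Dual ℂ V))))), ?_⟩
      ext t p
      simp
    · refine Submodule.subset_span ⟨-m, _, linear_mem_poly
        (L.comp ((LinearMap.inr ℂ V (Module.Dual ℂ V)).comp
          ((Module.Dual.transpose (R := ℂ) (A m)).comp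
            (LinearMap.snd ℂ V (Module.Dual ℂ V))))), ?_⟩
      ext t p
      simp [Module.Dual.transpose_apply]
  | algebraMap a =>
    refine Submodule.subset_span ⟨0, _, (Poly _).algebraMap_mem a, ?_⟩
    ext t p
    simp [character]
  | add x y _ _ h₁ h₂ => exact add_mem h₁ h₂
  | mul x y _ _ h₁ h₂ => exact laurentSpan_mul h₁ h₂

/-- As the torus is linearly reductive, every element of `ℂ[μ⁻¹(0)]^T` is the class of an invariant
function on `V ⊕ V*`. -/
theorem toReduction_surjective {ρ : Representation ℂ (Fin r → ℂˣ) V} (hρ : IsRational ρ) :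
    Function.Surjective (toReduction ρ) := by
  rintro ⟨a, ha⟩
  obtain ⟨f, rfl⟩ := Ideal.Quotient.mk_surjective a
  rw [mem_reduction] at ha
  obtain ⟨F, hF⟩ := laurentSpan_expand (translate_mem_laurentSpan hρ f.1 f.2)
  have hF' (t : Fin r → ℂˣ) :
      pullback (cotangent ρ t) f = F.sum fun m a => character m t • a := Subtype.ext (hF t)
  have hinv : F 0 ∈ Invariants (cotangent ρ) := by
    intro s p
    have hchar (t : Fin r → ℂˣ) (q) : f.1 (cotangent ρ t q) =
        ∑ m ∈ F.support, character m t * (F m).1 q := by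
      have := congrFun (hF t) q
      rw [this, Finsupp.sum]
      simp [Finset.sum_apply]
    let G : (Fin r → ℤ) →₀ ℂ := Finsupp.onFinset F.support
      (fun m => (F m).1 (cotangent ρ s p) - character m s * (F m).1 p) (by
        intro m hm
        rw [Finsupp.mem_support_iff]
        rintro h0
        simp [h0] at hm)
    have hG : G = 0 := by
      refine character_indep G fun t => ?_
      rw [Finsupp.onFinset_sum _ (by simp)]
      have h1 := hchar t (cotangent ρ s p)
      have h2 := hchar (t * s) p
      rw [map_mul, Module.End.mul_apply, h1] at h2
      simp only [smul_eq_mul, mul_sub, Finset.sum_sub_distrib]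
      rw [h2, sub_eq_zero]
      refine Finset.sum_congr rfl fun m _ => ?_
      rw [map_mul]; ring
    have := DFunLike.congr_fun hG 0
    simp only [G, Finsupp.onFinset_apply, Finsupp.zero_apply] at this
    rw [sub_eq_zero] at this
    rw [this]
    simp [character]
  refine ⟨⟨F 0, hinv⟩, Subtype.ext ?_⟩
  let π := Ideal.Quotient.mkₐ ℂ (momentIdeal ρ)
  change π (F 0) = π f
  let H : (Fin r → ℤ) →₀ NullFibreRing ρ :=
    F.mapRange π (map_zero π) - Finsupp.single 0 (π f)
  have hH : H = 0 := by
    refine character_indep H fun t => ?_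
    rw [Finsupp.sum_sub_index (by intros; rw [smul_sub]),
      Finsupp.sum_mapRange_index (by simp), Finsupp.sum_single_index (by simp)]
    have h1 : π (pullback (cotangent ρ t) f) = π f := ha t
    rw [hF', Finsupp.sum, map_sum] at h1
    simp only [map_smul] at h1
    rw [Finsupp.sum, h1]
    simp [character]
  have := DFunLike.congr_fun hH 0
  simpa [H, sub_eq_zero] using this

/-- The operator `x ↦ ξ · x` of a rational representation. -/
theorem exists_generator {ρ : Representation ℂ (Fin r → ℂˣ) V} (hρ : IsRational ρ)
    (ξ : Fin r → ℂ) : ∃ N : Module.End ℂ V, ∀ (x : V) (φ : Module.Dual ℂ V),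
      HasDerivAt (fun z : ℂ => φ (ρ (torusExp (z • ξ)) x)) (φ (N x)) 0 := by
  obtain ⟨A, hA⟩ := hρ
  refine ⟨∑ m ∈ A.support, (∑ j, (m j : ℂ) * ξ j) • A m, fun x φ => ?_⟩
  have hch (m : Fin r → ℤ) (z : ℂ) :
      character m (torusExp (z • ξ)) = Complex.exp (z * ∑ j, (m j : ℂ) * ξ j) := by
    simp only [character, torusExp, MonoidHom.coe_mk, OneHom.coe_mk, Units.val_zpow_eq_zpow_val,
      Units.val_mk0, Pi.smul_apply, smul_eq_mul, Finset.mul_sum, Complex.exp_sum]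
    refine Finset.prod_congr rfl fun j _ => ?_
    rw [← Complex.exp_int_mul]
    congr 1; ring
  have h1 (z : ℂ) : φ (ρ (torusExp (z • ξ)) x) =
      ∑ m ∈ A.support, Complex.exp (z * ∑ j, (m j : ℂ) * ξ j) * φ (A m x) := by
    rw [hA, Finsupp.sum]
    simp [LinearMap.sum_apply, hch]
  simp only [h1]
  have h2 : φ ((∑ m ∈ A.support, (∑ j, (m j : ℂ) * ξ j) • A m) x) =
      ∑ m ∈ A.support, (∑ j, (m j : ℂ) * ξ j) * φ (A m x) := by
    simp [LinearMap.sum_apply]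
  rw [h2]
  refine HasDerivAt.fun_sum fun m _ => ?_
  have h3 := (((hasDerivAt_id (0 : ℂ)).mul_const (∑ j, (m j : ℂ) * ξ j)).cexp).mul_const
    (φ (A m x))
  simpa using h3

section ReductionBracket

variable [FiniteDimensional ℂ V]

/-- The Poisson bracket of a component of the moment map with an invariant function vanishes. -/
theorem bracket_moment {ρ : Representation ℂ (Fin r → ℂˣ) V} (hρ : IsRational ρ)
    (ξ : Fin r → ℂ) (f g : Poly (V × Module.Dual ℂ V)) (hf : ∀ p, f.1 p = moment ρ ξ p)
    (hg : g ∈ Invariants (cotangent ρ)) : bracket (sympForm V) sympForm_nondegenerate f g = 0 := by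
  obtain ⟨N, hN⟩ := exists_generator hρ ξ
  have hm (p : V × Module.Dual ℂ V) : f.1 p = p.2 (N p.1) := by
    rw [hf]; exact (hN p.1 p.2).deriv
  ext p
  have hX : hamiltonian (sympForm V) sympForm_nondegenerate f p = (N p.1, - p.2.comp N) := by
    apply ((sympForm V).toDual sympForm_nondegenerate).injective
    refine LinearMap.ext fun v => ?_
    rw [hamiltonian, LinearEquiv.apply_symm_apply, LinearMap.BilinForm.toDual_def]
    refine (differential_line f p v).unique ?_
    simp only [hm]
    have h1 := ((hasDerivAt_id (0 : ℂ)).mul_const (p.2 (N v.1) + v.2 (N p.1))).const_add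
      (p.2 (N p.1))
    have h2 := ((hasDerivAt_pow 2 (0 : ℂ)).mul_const (v.2 (N v.1)))
    refine (h1.add h2).congr_deriv ?_ |>.congr_of_eventuallyEq (Filter.Eventually.of_forall ?_)
    · simp; ring
    · intro z
      simp
      ring
  have h0 : torusExp (0 : Fin r → ℂ) = 1 := by
    ext j
    simp [torusExp]
  have hneg (z : ℂ) : (torusExp (z • ξ))⁻¹ = torusExp ((-z) • ξ) := by
    ext j
    simp [torusExp, Complex.exp_neg]
  have hcurve := differential_hasDerivAt g p (fun z : ℂ => cotangent ρ (torusExp (z • ξ)) p)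
    (N p.1, - p.2.comp N) (by simp only [zero_smul, h0, map_one, Module.End.one_apply]) (by
      intro L
      obtain ⟨y, hy⟩ := (Module.evalEquiv ℂ V).surjective
        (L.comp (LinearMap.inr ℂ V (Module.Dual ℂ V)))
      have hy' (ψ : Module.Dual ℂ V) : L (0, ψ) = ψ y := by
        have := LinearMap.congr_fun hy ψ
        simpa using this.symm
      have hL (q : V × Module.Dual ℂ V) :
          L q = L.comp (LinearMap.inl ℂ V (Module.Dual ℂ V)) q.1 + q.2 y := by
        rw [← hy', LinearMap.comp_apply, ← map_add]
        simp
      simp only [hL]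
      refine HasDerivAt.add (hN p.1 _) ?_
      have h3 := (hN y p.2).scomp_of_eq (0 : ℂ) (hasDerivAt_neg (0 : ℂ)) (by simp)
      refine (h3.congr_deriv (by simp)).congr_of_eventuallyEq (Filter.Eventually.of_forall ?_)
      intro z
      simp [Representation.dual_apply, Module.Dual.transpose_apply, hneg])
  have hconst : differential g p (N p.1, - p.2.comp N) = 0 := by
    refine hcurve.unique ?_
    have : (fun z : ℂ => g.1 (cotangent ρ (torusExp (z • ξ)) p)) = fun _ => g.1 p := by
      ext z
      exact hg _ p
    rw [this]
    exact hasDerivAt_const _ _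
  change sympForm V _ _ = 0
  rw [sympForm_skew, hX, hamiltonian, LinearMap.BilinForm.apply_toDual_symm_apply, hconst, neg_zero]

theorem bracket_add_left (f f' g : Poly (V × Module.Dual ℂ V)) :
    bracket (sympForm V) sympForm_nondegenerate (f + f') g =
      bracket (sympForm V) sympForm_nondegenerate f g +
      bracket (sympForm V) sympForm_nondegenerate f' g := by
  ext p
  change sympForm V _ _ = sympForm V _ _ + sympForm V _ _
  simp only [hamiltonian, differential_add, map_add, LinearMap.add_apply]

theorem bracket_mul_left (f f' g : Poly (V × Module.Dual ℂ V)) :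
    bracket (sympForm V) sympForm_nondegenerate (f * f') g =
      f * bracket (sympForm V) sympForm_nondegenerate f' g +
      f' * bracket (sympForm V) sympForm_nondegenerate f g := by
  ext p
  change sympForm V _ _ = f.1 p * sympForm V _ _ + f'.1 p * sympForm V _ _
  simp only [hamiltonian, differential_mul, map_add, map_smul, LinearMap.add_apply,
    LinearMap.smul_apply, smul_eq_mul]

theorem bracket_skew (f g : Poly (V × Module.Dual ℂ V)) :
    bracket (sympForm V) sympForm_nondegenerate f g =
      - bracket (sympForm V) sympForm_nondegenerate g f := by
  ext p
  exact sympForm_skew _ _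

theorem bracket_mem_momentIdeal {ρ : Representation ℂ (Fin r → ℂˣ) V} (hρ : IsRational ρ)
    (f g : Poly (V × Module.Dual ℂ V)) (hf : f ∈ momentIdeal ρ) (hg : g ∈ Invariants (cotangent ρ)) :
    bracket (sympForm V) sympForm_nondegenerate f g ∈ momentIdeal ρ := by
  induction hf using Submodule.span_induction with
  | mem x hx =>
    obtain ⟨ξ, hξ⟩ := hx
    rw [bracket_moment hρ ξ x g hξ hg]
    exact zero_mem _
  | zero =>
    have := bracket_add_left (V := V) 0 0 g
    rw [add_zero, left_eq_add] at this
    rw [this]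
    exact zero_mem _
  | add x y _ _ h₁ h₂ => rw [bracket_add_left]; exact add_mem h₁ h₂
  | smul a x hx h =>
    rw [smul_eq_mul, bracket_mul_left]
    exact add_mem (Ideal.mul_mem_left _ _ h) (Ideal.mul_mem_right _ _ hx)

/-- The Poisson bracket on `ℂ[V ⊕ V*]^T`. -/
def cotangentBracket (ρ : Representation ℂ (Fin r → ℂˣ) V) (f g : Invariants (cotangent ρ)) :
    Invariants (cotangent ρ) :=
  invBracket (cotangent ρ) (sympForm V) sympForm_nondegenerate (sympForm_cotangent ρ) f g

/-- The Poisson bracket on the coordinate ring `ℂ[μ⁻¹(0)]^T` of the symplectic reduction: lift to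
invariant functions on `V ⊕ V*` and take the class of their bracket. It does not depend on the
lifts, by `reductionBracket_apply`. -/
def reductionBracket {ρ : Representation ℂ (Fin r → ℂˣ) V} (hρ : IsRational ρ)
    (a b : Reduction ρ) : Reduction ρ :=
  toReduction ρ (cotangentBracket ρ (Function.surjInv (toReduction_surjective hρ) a)
    (Function.surjInv (toReduction_surjective hρ) b))

theorem toReduction_bracket_congr {ρ : Representation ℂ (Fin r → ℂˣ) V} (hρ : IsRational ρ)
    (f f' g : Invariants (cotangent ρ)) (h : toReduction ρ f = toReduction ρ f') :
    toReduction ρ (cotangentBracket ρ f g) = toReduction ρ (cotangentBracket ρ f' g) := by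
  have h1 : f.1 - f'.1 ∈ momentIdeal ρ := Ideal.Quotient.eq.1 (congrArg Subtype.val h)
  have h2 := bracket_mem_momentIdeal hρ _ g.1 h1 g.2
  refine Subtype.ext (Ideal.Quotient.eq.2 ?_)
  have h3 := bracket_add_left (V := V) (f.1 - f'.1) f'.1 g.1
  rw [sub_add_cancel] at h3
  change bracket _ _ _ _ - bracket _ _ _ _ ∈ _
  rw [h3, add_sub_cancel_right]
  exact h2

theorem toReduction_bracket_congr_right {ρ : Representation ℂ (Fin r → ℂˣ) V}
    (hρ : IsRational ρ) (f f' g : Invariants (cotangent ρ)) (h : toReduction ρ f = toReduction ρ f') :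
    toReduction ρ (cotangentBracket ρ g f) = toReduction ρ (cotangentBracket ρ g f') := by
  have h1 := Ideal.Quotient.eq.1 (congrArg Subtype.val (toReduction_bracket_congr hρ f f' g h))
  refine Subtype.ext (Ideal.Quotient.eq.2 ?_)
  change bracket _ _ _ _ - bracket _ _ _ _ ∈ _ at h1
  change bracket _ _ _ _ - bracket _ _ _ _ ∈ _
  rw [bracket_skew g.1 f.1, bracket_skew g.1 f'.1, ← neg_sub', neg_mem_iff]
  exact h1

theorem reductionBracket_apply {ρ : Representation ℂ (Fin r → ℂˣ) V} (hρ : IsRational ρ)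
    (f g : Invariants (cotangent ρ)) :
    reductionBracket hρ (toReduction ρ f) (toReduction ρ g) =
      toReduction ρ (cotangentBracket ρ f g) := by
  have hs := Function.surjInv_eq (toReduction_surjective hρ)
  rw [reductionBracket, toReduction_bracket_congr hρ _ f _ (hs _),
    toReduction_bracket_congr_right hρ _ g _ (hs _)]

end ReductionBracket

/-! ### The Weyl group and the orbifold `(𝔠 ⊕ 𝔠^∨) / W` -/

/-- The normaliser `N_T(𝔠) = {t | t · 𝔠 = 𝔠}`. -/
def normalizer (ρ : Representation ℂ (Fin r → ℂˣ) V) (c : Submodule ℂ V) :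
    Subgroup (Fin r → ℂˣ) where
  carrier := {t | c.map (ρ t) = c}
  one_mem' := by
    change c.map (ρ 1) = c
    rw [map_one, Module.End.one_eq_id, Submodule.map_id]
  mul_mem' {s t} hs ht := by
    change c.map (ρ (s * t)) = c
    rw [map_mul, Module.End.mul_eq_comp, Submodule.map_comp, ht, hs]
  inv_mem' {t} ht := by
    change c.map (ρ t⁻¹) = c
    have ht' : c.map (ρ t) = c := ht
    conv_lhs => rw [← ht']
    rw [← Submodule.map_comp, ← Module.End.mul_eq_comp, ← map_mul, inv_mul_cancel, map_one,
      Module.End.one_eq_id, Submodule.map_id]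

/-- The centraliser `C_T(𝔠)`, the pointwise stabiliser of `𝔠`. -/
def centralizer (ρ : Representation ℂ (Fin r → ℂˣ) V) (c : Submodule ℂ V) :
    Subgroup (Fin r → ℂˣ) where
  carrier := {t | ∀ x ∈ c, ρ t x = x}
  one_mem' := by simp
  mul_mem' {s t} hs ht x hx := by rw [map_mul, Module.End.mul_apply, ht x hx, hs x hx]
  inv_mem' {t} ht x hx := by
    conv_lhs => rw [← ht x hx]
    rw [← Module.End.mul_apply, ← map_mul]; simp

/-- The Weyl group `W = N_T(𝔠) / C_T(𝔠)`. -/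
abbrev Weyl (ρ : Representation ℂ (Fin r → ℂˣ) V) (c : Submodule ℂ V) : Type :=
  normalizer ρ c ⧸ (centralizer ρ c).subgroupOf (normalizer ρ c)

theorem normalizer_apply_mem (ρ : Representation ℂ (Fin r → ℂˣ) V) (c : Submodule ℂ V)
    (t : normalizer ρ c) (x : V) (hx : x ∈ c) : ρ t.1 x ∈ c := by
  have h : c.map (ρ t.1) = c := t.2
  have h' : ρ t.1 x ∈ c.map (ρ t.1) := Submodule.mem_map_of_mem hx
  rwa [h] at h'

/-- The action of `N_T(𝔠)` on `𝔠`. -/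
def normalizerRep (ρ : Representation ℂ (Fin r → ℂˣ) V) (c : Submodule ℂ V) :
    Representation ℂ (normalizer ρ c) c where
  toFun t := (ρ t.1).restrict (normalizer_apply_mem ρ c t)
  map_one' := by ext x; simp
  map_mul' s t := by ext x; simp

/-- The action of `W` on `𝔠`. -/
def weylRep (ρ : Representation ℂ (Fin r → ℂˣ) V) (c : Submodule ℂ V) :
    Representation ℂ (Weyl ρ c) c :=
  QuotientGroup.lift ((centralizer ρ c).subgroupOf (normalizer ρ c)) (normalizerRep ρ c)
    (fun t ht => by
      ext x
      exact ht x.1 x.2)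

section Dual

variable [FiniteDimensional ℂ V]
variable {ρ : Representation ℂ (Fin r → ℂˣ) V} {c : Submodule ℂ V}
  {cd : Submodule ℂ (Module.Dual ℂ V)}

theorem dualRestrict_bijective (hd : IsDualCartanPair ρ c cd) :
    Function.Bijective (c.dualRestrict.comp cd.subtype) := by
  obtain ⟨h, hh, -, hcd⟩ := hd.exists_hermitian
  constructor
  · rw [← LinearMap.ker_eq_bot, LinearMap.ker_eq_bot']
    rintro ⟨φ, hφ⟩ h0
    obtain ⟨x, hx, rfl⟩ : φ ∈ h '' (c : Set V) := hcd ▸ hφ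
    have h1 : h x x = 0 := LinearMap.congr_fun h0 ⟨x, hx⟩
    have hx0 : x = 0 := by
      by_contra hne
      have := hh.pos x hne
      simp [h1] at this
    subst hx0
    ext1
    simp
  · rw [← LinearMap.range_eq_top]
    set R := LinearMap.range (c.dualRestrict.comp cd.subtype)
    have hR : R.dualCoannihilator = ⊥ := by
      rw [eq_bot_iff]
      intro x hx
      rw [Submodule.mem_dualCoannihilator] at hx
      have hmem : h x.1 ∈ cd := by
        have : h x.1 ∈ (cd : Set _) := hcd ▸ ⟨x.1, x.2, rfl⟩
        exact this
      have h1 : h x.1 x.1 = 0 := hx _ ⟨⟨h x.1, hmem⟩, rfl⟩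
      by_contra hne
      have := hh.pos x.1 (fun h0 => hne (Subtype.ext h0))
      simp [h1] at this
    rw [← Subspace.dualCoannihilator_dualAnnihilator_eq (W := R), hR,
      Submodule.dualAnnihilator_bot]

/-- The pairing of `V` and `V*` restricts to a duality `𝔠^∨ ≅ 𝔠*` of dual Cartan subspaces. -/
def dualEquiv (hd : IsDualCartanPair ρ c cd) : cd ≃ₗ[ℂ] Module.Dual ℂ c :=
  LinearEquiv.ofBijective (c.dualRestrict.comp cd.subtype) (dualRestrict_bijective hd)

@[simp] theorem dualEquiv_apply (hd : IsDualCartanPair ρ c cd) (y : cd) (x : c) :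
    dualEquiv hd y x = y.1 x.1 := rfl

/-- The action of `W` on `𝔠^∨`, contragredient to the action on `𝔠`:
`(w · y)(x) = y(w⁻¹ · x)` for `x ∈ 𝔠`. -/
def weylDualRep (hd : IsDualCartanPair ρ c cd) : Representation ℂ (Weyl ρ c) cd where
  toFun w := (dualEquiv hd).symm.toLinearMap ∘ₗ (weylRep ρ c).dual w ∘ₗ (dualEquiv hd).toLinearMap
  map_one' := by
    rw [map_one]
    exact LinearMap.ext fun y => (dualEquiv hd).symm_apply_apply y
  map_mul' s t := by
    rw [map_mul]
    refine LinearMap.ext fun y => ?_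
    simp only [LinearMap.comp_apply, Module.End.mul_apply, LinearEquiv.coe_coe,
      LinearEquiv.apply_symm_apply]

/-- The action of `W` on `𝔠 ⊕ 𝔠^∨`. -/
abbrev orbifoldRep (hd : IsDualCartanPair ρ c cd) : Representation ℂ (Weyl ρ c) (c × cd) :=
  (weylRep ρ c).prod (weylDualRep hd)

variable (c cd) in
/-- The inclusion `𝔠 ⊕ 𝔠^∨ ⊆ V ⊕ V*`. -/
def cartanIncl : c × cd →ₗ[ℂ] V × Module.Dual ℂ V := c.subtype.prodMap cd.subtype

variable (c cd) in
/-- The restriction to `𝔠 ⊕ 𝔠^∨` of the symplectic form of `V ⊕ V*`. -/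
def cartanForm : LinearMap.BilinForm ℂ (c × cd) :=
  (sympForm V).compl₁₂ (cartanIncl c cd) (cartanIncl c cd)

theorem cartanForm_apply (p q : c × cd) :
    cartanForm c cd p q = q.2.1 p.1.1 - p.2.1 q.1.1 := rfl

theorem cartanForm_nondegenerate (hd : IsDualCartanPair ρ c cd) :
    (cartanForm c cd).Nondegenerate := by
  have hl : (cartanForm c cd).SeparatingLeft := by
    intro p hp
    have h1 : p.1 = 0 := by
      rw [← Module.forall_dual_apply_eq_zero_iff ℂ]
      intro φ
      obtain ⟨y, rfl⟩ := (dualEquiv hd).surjective φ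
      simpa [cartanForm_apply] using hp (0, y)
    have h2 : p.2 = 0 := by
      apply (dualEquiv hd).injective
      ext y
      simpa [cartanForm_apply] using hp (y, 0)
    exact Prod.ext h1 h2
  refine ⟨hl, fun q hq => hl q fun p => ?_⟩
  have := hq p
  rw [cartanForm_apply] at this ⊢
  rw [← neg_sub, this, neg_zero]

theorem cartanForm_orbifoldRep (hd : IsDualCartanPair ρ c cd) (w : Weyl ρ c) (p q : c × cd) :
    cartanForm c cd (orbifoldRep hd w p) (orbifoldRep hd w q) = cartanForm c cd p q := by
  have h1 (x : c) : weylRep ρ c w⁻¹ (weylRep ρ c w x) = x := by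
    rw [← Module.End.mul_apply, ← map_mul]; simp
  have h2 (x : c) (y : cd) : (weylDualRep hd w y).1 (weylRep ρ c w x).1 = y.1 x.1 := by
    rw [← dualEquiv_apply hd, ← dualEquiv_apply hd]
    simp [weylDualRep, Representation.dual_apply, Module.Dual.transpose_apply, h1]
  simp only [cartanForm_apply, Representation.prod_apply_apply]
  rw [h2, h2]

/-- The coordinate ring `ℂ[𝔠 ⊕ 𝔠^∨]^W` of the orbifold `(𝔠 ⊕ 𝔠^∨) / W`. -/
abbrev Orbifold (hd : IsDualCartanPair ρ c cd) : Subalgebra ℂ (Poly (c × cd)) :=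
  Invariants (orbifoldRep hd)

/-- The Poisson bracket on `ℂ[𝔠 ⊕ 𝔠^∨]^W`. -/
def orbifoldBracket (hd : IsDualCartanPair ρ c cd) (f g : Orbifold hd) : Orbifold hd :=
  invBracket (orbifoldRep hd) (cartanForm c cd) (cartanForm_nondegenerate hd)
    (cartanForm_orbifoldRep hd) f g

end Dual

end TorusReduction

end

open TorusReduction

noncomputable section

namespace TorusReduction

/-! ### Circuits of a weight system -/

/-! A weight basis turns everything into combinatorics of the weights `m i`. If a nonzero real
relation `c` among the weights were supported in an open half space, the vectors with coordinates
`exp (s * c i)` on the support of `c` would be nilpotent and lie in pairwise different orbits, so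
visibility excludes this (`IsWeightBasis.not_halfSpace`). Gordan's alternative then puts a
nontrivial non-negative relation inside the support of every nonzero relation, and an induction on
the support shows that the positive part of a relation is a relation (`posPart_relation`). Hence the
monoid of non-negative integral relations is closed under truncated subtraction and under minima.
Its minimal nonzero elements, the circuits, have disjoint supports and generate it
(`exists_isCircuitSystem`).

All else is expressed by circuits. They span the integral and the complex relations, and their
entries are coprime. Therefore the tuples `(m i (ξ))ᵢ` are exactly those orthogonal to the circuits
(`IsCircuitSystem.exists_weight_eq`), and the image of the torus in the diagonal torus is cut out
exactly by the circuit monomials (`IsCircuitSystem.exists_character_eq`). The circuit monomials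
freely generate `ℂ[V]^T`; after rescaling the weight basis, a Cartan subspace is spanned by the sums
`e_j` of the basis vectors of each circuit. Minimality of length makes the squared lengths of the
basis vectors in `e_j` a relation, so for every admissible Hermitian form the dual Cartan subspace
is spanned by the forms `f_j = ∑ a j i xᵢ` (`IsDualCartanPair.eq_span`).

Let `p_j`, `q_j` be the coordinates on `𝔠 ⊕ 𝔠^∨` and `N_j` the size of the circuit. Modulo the
moment ideal, `xᵢ yᵢ` is zero off the circuits and a multiple of a single quadric `s_j` on the
`j`-th circuit. So every invariant is a combination of products of powers of `s_j`, `u_j = ∏ xᵢ ^ a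
j i` and `u_j^∨ = ∏ (yᵢ / a j i) ^ a j i`, with `u_j` and `u_j^∨` never occurring together
(`mem_span_sup_momentIdeal`). These three restrict to `p_j q_j`, `p_j ^ N_j`, `q_j ^ N_j`, so the
products restrict to distinct monomials. This gives injectivity. The Weyl group contains the
`N_j`-th roots of unity acting on the `j`-th coordinates, so these monomials exhaust the invariants
on `𝔠 ⊕ 𝔠^∨`.

For the brackets, the chosen lifts have Hamiltonian vectors tangent to `𝔠 ⊕ 𝔠^∨` along this subspace
(`liftMono_mem_tangentialFunctions`), and for such functions restriction commutes with the brackets.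
-/

theorem character_torusExp {r : ℕ} (n : Fin r → ℤ) (ξ : Fin r → ℂ) :
    character n (torusExp ξ) = Complex.exp (∑ l, n l * ξ l) := by
  simp only [character, torusExp, MonoidHom.coe_mk, OneHom.coe_mk, Units.val_zpow_eq_zpow_val,
    Units.val_mk0, Complex.exp_sum]
  exact Finset.prod_congr rfl fun j _ => (Complex.exp_int_mul _ _).symm

section Circuits

variable {r : ℕ} {ι κ : Type*} [Fintype ι] [Fintype κ]

/-- The vectors `a j` are the circuits of the weights `m i`: they are non-negative relations with
disjoint supports, they generate the monoid of all non-negative relations, and the positive part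
of every relation is a relation. -/
structure IsCircuitSystem (m : ι → Fin r → ℤ) (a : κ → ι → ℕ) : Prop where
  nonzero : ∀ j, ∃ i, a j i ≠ 0
  disjoint : ∀ j j' i, a j i ≠ 0 → a j' i ≠ 0 → j = j'
  relation : ∀ j l, ∑ i, (a j i : ℤ) * m i l = 0
  span : ∀ b : ι → ℕ, (∀ l, ∑ i, (b i : ℤ) * m i l = 0) →
    ∃ z : κ → ℕ, ∀ i, b i = ∑ j, z j * a j i
  posPart : ∀ b c : ι → ℕ, (∀ l, ∑ i, (b i : ℤ) * m i l = ∑ i, (c i : ℤ) * m i l) →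
    ∀ l, ∑ i, ((b i - c i : ℕ) : ℤ) * m i l = 0

/-- The circuits are the minimal nonzero elements of the monoid `K` of non-negative relations. By
`hpos`, `K` is closed under truncated subtraction, hence under minima, which makes minimal elements
disjoint; subtracting one from a larger relation stays in `K`, which makes them generate. -/
theorem exists_isCircuitSystem {n : ℕ} (m : Fin n → Fin r → ℤ)
    (hpos : ∀ b c : Fin n → ℕ, (∀ l, ∑ i, (b i : ℤ) * m i l = ∑ i, (c i : ℤ) * m i l) →
      ∀ l, ∑ i, ((b i - c i : ℕ) : ℤ) * m i l = 0) :
    ∃ (κ : Type) (_ : Fintype κ) (a : κ → Fin n → ℕ), IsCircuitSystem m a := by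
  classical
  let K : Set (Fin n → ℕ) := {b | ∀ l, ∑ i, (b i : ℤ) * m i l = 0}
  let At : Set (Fin n → ℕ) := {a | a ∈ K ∧ a ≠ 0 ∧ ∀ b ∈ K, b ≠ 0 → b ≤ a → b = a}
  have hsub (b c : Fin n → ℕ) (hb : b ∈ K) (hc : c ∈ K) : b - c ∈ K := fun l =>
    hpos b c (fun l => (hb l).trans (hc l).symm) l
  -- With truncated subtraction, `b - (b - c)` is the minimum of `b` and `c`.
  have hinf (b c : Fin n → ℕ) (hb : b ∈ K) (hc : c ∈ K) : b - (b - c) ∈ K :=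
    hsub _ _ hb (hsub _ _ hb hc)
  have hdisj (a a' : Fin n → ℕ) (ha : a ∈ At) (ha' : a' ∈ At) (i : Fin n) (hi : a i ≠ 0)
      (hi' : a' i ≠ 0) : a = a' := by
    have h1 := hinf a a' ha.1 ha'.1
    have h0 : a - (a - a') ≠ 0 := by
      intro h
      have := congrFun h i
      simp only [Pi.sub_apply, Pi.zero_apply] at this
      omega
    have h2 := ha.2.2 _ h1 h0 (fun k => by simp)
    have h3 : a ≤ a' := fun k => by
      have := congrFun h2 k
      simp only [Pi.sub_apply] at this
      change a k ≤ a' k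
      omega
    exact ha'.2.2 a ha.1 ha.2.1 h3
  have hne (a : At) : ∃ i, a.1 i ≠ 0 := by
    by_contra! h
    exact a.2.2.1 (funext h)
  choose f hf using hne
  -- Supports are disjoint, so picking an index in each support embeds `At` into `Fin n`.
  have hfin : Finite At := Finite.of_injective f fun a a' h =>
    Subtype.ext (hdisj _ _ a.2 a'.2 (f a) (hf a) (h ▸ hf a'))
  let _ := Fintype.ofFinite At
  refine ⟨At, inferInstance, fun j => j.1, fun j => ⟨f j, hf j⟩,
    fun j j' i h h' => Subtype.ext (hdisj _ _ j.2 j'.2 i h h'), fun j => j.2.1, ?_, hpos⟩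
  suffices H : ∀ (N : ℕ) (b : Fin n → ℕ), b ∈ K → ∑ i, b i = N →
      ∃ z : At → ℕ, ∀ i, b i = ∑ j, z j * j.1 i from fun b hb => H _ b hb rfl
  intro N
  induction N using Nat.strong_induction_on with
  | _ N ih =>
  intro b hb hN
  by_cases hb0 : b = 0
  · exact ⟨0, by simp [hb0]⟩
  obtain ⟨a, ha, hab⟩ : ∃ a ∈ At, a ≤ b := by
    let S : Set (Fin n → ℕ) := {c | c ∈ K ∧ c ≠ 0 ∧ c ≤ b}
    obtain ⟨a, ha, hmin⟩ := WellFounded.has_min (wellFounded_lt (α := Fin n → ℕ)) S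
      ⟨b, hb, hb0, le_rfl⟩
    refine ⟨a, ⟨ha.1, ha.2.1, fun c hc hc0 hca => ?_⟩, ha.2.2⟩
    by_contra hne
    exact hmin c ⟨hc, hc0, hca.trans ha.2.2⟩ (lt_of_le_of_ne hca hne)
  have hlt : ∑ i, (b - a) i < N := by
    rw [← hN]
    refine Finset.sum_lt_sum (fun i _ => by simp) ⟨f ⟨a, ha⟩, Finset.mem_univ _, ?_⟩
    have h1 := hf ⟨a, ha⟩
    have h2 := hab (f ⟨a, ha⟩)
    simp at h1 h2 ⊢
    omega
  obtain ⟨z, hz⟩ := ih _ hlt (b - a) (hsub _ _ hb ha.1) rfl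
  refine ⟨z + Pi.single ⟨a, ha⟩ 1, fun i => ?_⟩
  have h1 := hz i
  have h2 : a i ≤ b i := hab i
  rw [Pi.sub_apply] at h1
  simp only [Pi.add_apply, add_mul, Finset.sum_add_distrib, ← h1, Pi.single_apply,
    ite_mul, one_mul, zero_mul, Finset.sum_ite_eq', Finset.mem_univ, if_true]
  omega

/-! ### Linear algebra of relations over `ℤ`, `ℚ` and `ℂ`. -/

namespace IsCircuitSystem

variable {m : ι → Fin r → ℤ} {a : κ → ι → ℕ} (ha : IsCircuitSystem m a)

include ha

theorem eq_zero_of_ne {j j' : κ} {i : ι} (h : a j i ≠ 0) (hne : j' ≠ j) : a j' i = 0 := by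
  by_contra h'
  exact hne (ha.disjoint _ _ _ h' h)

/-- A sum over all circuits at an element of the `j`-th circuit. -/
theorem sum_eq {R : Type*} [AddCommMonoid R] {j : κ} {i : ι} (h : a j i ≠ 0) (F : κ → R)
    (hF : ∀ j', a j' i = 0 → F j' = 0) : ∑ j', F j' = F j :=
  Fintype.sum_eq_single j fun j' hne => hF j' (ha.eq_zero_of_ne h hne)

/-- The entries of a circuit are coprime. -/
theorem exists_bezout (j : κ) : ∃ n : ι → ℤ, ∑ i, n i * a j i = 1 := by
  classical
  rw [← Ideal.mem_span_range_iff_exists_fun, ← Ideal.eq_top_iff_one]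
  obtain ⟨d, hd⟩ : ∃ d : ℕ, Ideal.span (Set.range fun i => (a j i : ℤ)) = Ideal.span {(d : ℤ)} := by
    obtain ⟨d, hd⟩ := IsPrincipalIdealRing.principal (Ideal.span (Set.range fun i => (a j i : ℤ)))
    exact ⟨d.natAbs, by rw [Int.span_natAbs]; exact hd⟩
  have hdvd (i : ι) : d ∣ a j i := by
    have : (a j i : ℤ) ∈ Ideal.span {(d : ℤ)} := hd ▸ Ideal.subset_span ⟨i, rfl⟩
    exact_mod_cast Ideal.mem_span_singleton.1 this
  choose b hb using hdvd
  obtain ⟨i, hi⟩ := ha.nonzero j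
  have hd0 : d ≠ 0 := by
    rintro rfl
    exact hi (by simpa using hb i)
  -- Dividing the circuit by the gcd `d` of its entries leaves a relation `b`, hence a combination
  -- of circuits; at `i` this reads `b i = z j * a j i` with `a j i = d * b i`, so `z j * d = 1`.
  obtain ⟨z, hz⟩ := ha.span b fun l => by
    have := ha.relation j l
    simp only [hb, Nat.cast_mul, mul_assoc, ← Finset.mul_sum] at this
    exact (mul_eq_zero.1 this).resolve_left (by exact_mod_cast hd0)
  have h1 := hz i
  rw [ha.sum_eq hi _ (fun j' h => by simp [h])] at h1
  have h2 : z j * d = 1 := by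
    have h3 := hb i
    rw [h1] at h3
    have h4 : a j i * (z j * d) = a j i * 1 := by
      rw [mul_one]
      conv_rhs => rw [h3]
      ring
    exact Nat.eq_of_mul_eq_mul_left (Nat.pos_of_ne_zero hi) h4
  rw [hd, Nat.eq_one_of_mul_eq_one_left h2]
  simp

/-- The integral relations are the integral combinations of the circuits. -/
theorem int_span (b : ι → ℤ) (hb : ∀ l, ∑ i, b i * m i l = 0) :
    ∃ z : κ → ℤ, ∀ i, b i = ∑ j, z j * a j i := by
  have hp (i : ι) : b i = ((b i).toNat : ℤ) - ((-b i).toNat : ℤ) := by omega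
  have h1 (l : Fin r) : ∑ i, ((b i).toNat : ℤ) * m i l = ∑ i, ((-b i).toNat : ℤ) * m i l := by
    rw [← sub_eq_zero, ← Finset.sum_sub_distrib, ← hb l]
    refine Finset.sum_congr rfl fun i _ => ?_
    rw [← sub_mul, ← hp i]
  -- The positive and negative parts of `b` are disjoint, so truncated subtraction leaves each
  -- unchanged and `posPart` makes each a relation by itself.
  have e1 (i : ι) : (b i).toNat - (-b i).toNat = (b i).toNat := by omega
  have e2 (i : ι) : (-b i).toNat - (b i).toNat = (-b i).toNat := by omega
  obtain ⟨z, hz⟩ := ha.span _ fun l => by simpa only [e1] using ha.posPart _ _ h1 l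
  obtain ⟨z', hz'⟩ := ha.span _ fun l => by
    simpa only [e2] using ha.posPart _ _ (fun l => (h1 l).symm) l
  refine ⟨fun j => z j - z' j, fun i => ?_⟩
  rw [hp i, hz, hz']
  push_cast
  simp only [sub_mul, Finset.sum_sub_distrib]

/-- The rational relations are proportional to the circuits. -/
theorem rat_proportional (b : ι → ℚ) (hb : ∀ l, ∑ i, b i * m i l = 0) :
    (∀ i, (∀ j, a j i = 0) → b i = 0) ∧
      ∀ j i i', a j i ≠ 0 → a j i' ≠ 0 → a j i' * b i = a j i * b i' := by
  obtain ⟨⟨d, hd⟩, hd'⟩ := IsLocalization.exist_integer_multiples_of_finite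
    (nonZeroDivisors ℤ) b
  choose B hB using hd'
  have hd0 : (d : ℚ) ≠ 0 := by exact_mod_cast nonZeroDivisors.ne_zero hd
  have hB' (i : ι) : (B i : ℚ) = d * b i := by
    have := hB i
    simpa [Algebra.smul_def] using this
  obtain ⟨z, hz⟩ := ha.int_span B fun l => by
    have : (d : ℚ) * ∑ i, b i * m i l = 0 := by rw [hb, mul_zero]
    rw [Finset.mul_sum] at this
    simp only [← mul_assoc, ← hB'] at this
    exact_mod_cast this
  refine ⟨fun i hi => ?_, fun j i i' h h' => ?_⟩
  · have := hz i
    simp only [hi] at this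
    have h2 := hB' i
    rw [this] at h2
    simpa [hd0] using h2.symm
  · have e := hz i
    have e' := hz i'
    rw [ha.sum_eq h _ (fun j' h => by simp [h])] at e
    rw [ha.sum_eq h' _ (fun j' h => by simp [h])] at e'
    have f := hB' i
    have f' := hB' i'
    rw [e] at f
    rw [e'] at f'
    push_cast at f f'
    apply mul_left_cancel₀ hd0
    linear_combination (a j i' : ℚ) * (-f) + (a j i : ℚ) * f'

/-- The complex relations are the complex combinations of the circuits. -/
theorem complex_span (c : ι → ℂ) (hc : ∀ l, ∑ i, c i * m i l = 0) :
    ∃ z : κ → ℂ, ∀ i, c i = ∑ j, z j * a j i := by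
  -- The weights are integral, so a `ℚ`-linear form `ℂ → ℚ` sends a complex relation to a rational
  -- one. Such forms separate the points of `ℂ`, so the proportionality of rational relations
  -- carries over.
  have key (φ : Module.Dual ℚ ℂ) := ha.rat_proportional (fun i => φ (c i)) fun l => by
    have := congrArg φ (hc l)
    rw [map_sum, map_zero] at this
    rw [← this]
    refine Finset.sum_congr rfl fun i _ => ?_
    rw [mul_comm (c i), ← zsmul_eq_mul, map_zsmul, zsmul_eq_mul, mul_comm]
  have h1 (i : ι) (hi : ∀ j, a j i = 0) : c i = 0 := by
    rw [← Module.forall_dual_apply_eq_zero_iff ℚ]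
    exact fun φ => (key φ).1 i hi
  have h2 (j : κ) (i i' : ι) (h : a j i ≠ 0) (h' : a j i' ≠ 0) : a j i' * c i = a j i * c i' := by
    rw [← sub_eq_zero, ← Module.forall_dual_apply_eq_zero_iff ℚ]
    intro φ
    rw [map_sub, sub_eq_zero, ← nsmul_eq_mul, ← nsmul_eq_mul, map_nsmul, map_nsmul, nsmul_eq_mul,
      nsmul_eq_mul]
    exact (key φ).2 j i i' h h'
  choose f hf using ha.nonzero
  refine ⟨fun j => c (f j) / a j (f j), fun i => ?_⟩
  by_cases hi : ∀ j, a j i = 0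
  · rw [h1 i hi]
    simp [hi]
  · push Not at hi
    obtain ⟨j, hj⟩ := hi
    rw [ha.sum_eq hj _ (fun j' h => by simp [h])]
    have := h2 j i (f j) hj (hf j)
    have h3 : (a j (f j) : ℂ) ≠ 0 := by exact_mod_cast hf j
    field_simp
    linear_combination this

/-- The image of `ξ ↦ (m i (ξ))ᵢ` is the orthogonal complement of the circuits. -/
theorem exists_weight_eq (η : ι → ℂ) (hη : ∀ j, ∑ i, a j i * η i = 0) :
    ∃ ξ : Fin r → ℂ, ∀ i, ∑ l, m i l * ξ l = η i := by
  classical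
  let M : (Fin r → ℂ) →ₗ[ℂ] (ι → ℂ) :=
    LinearMap.pi fun i => ∑ l, (m i l : ℂ) • LinearMap.proj l
  suffices h : η ∈ LinearMap.range M by
    obtain ⟨ξ, hξ⟩ := h
    refine ⟨ξ, fun i => ?_⟩
    rw [← hξ]
    simp [M]
  by_contra hn
  -- A functional that kills the range but not `η` has a complex relation as its coefficients; being
  -- a combination of circuits, it also kills `η`.
  obtain ⟨f, hf, hf'⟩ := Submodule.exists_dual_map_eq_bot_of_notMem hn inferInstance
  have hfs (y : ι → ℂ) : f y = ∑ i, f (Pi.single i 1) * y i := by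
    conv_lhs => rw [← Finset.univ_sum_single y]
    rw [map_sum]
    refine Finset.sum_congr rfl fun i _ => ?_
    have : Pi.single i (y i) = y i • (Pi.single i 1 : ι → ℂ) := by
      rw [← Pi.single_smul, smul_eq_mul, mul_one]
    rw [this, map_smul, smul_eq_mul, mul_comm]
  obtain ⟨z, hz⟩ := ha.complex_span (fun i => f (Pi.single i 1)) fun l => by
    have h0 : f (M (Pi.single l 1)) = 0 := by
      rw [← Submodule.mem_bot ℂ, ← hf']
      exact ⟨_, ⟨_, rfl⟩, rfl⟩
    rw [hfs] at h0
    rw [← h0]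
    refine Finset.sum_congr rfl fun i _ => ?_
    simp [M, Pi.single_apply]
  apply hf
  rw [hfs]
  simp only [hz, Finset.sum_mul]
  rw [Finset.sum_comm]
  simp only [mul_assoc, ← Finset.mul_sum, hη, mul_zero, Finset.sum_const_zero]

/-- The image of the torus in `(ℂˣ)^ι` is cut out by the circuits. -/
theorem exists_character_eq (y : ι → ℂ) (hy : ∀ i, y i ≠ 0) (hy' : ∀ j, ∏ i, y i ^ a j i = 1) :
    ∃ t, ∀ i, character (m i) t = y i := by
  classical
  have h1 (j : κ) : ∃ k : ℤ, ∑ i, a j i * Complex.log (y i) = k * (2 * Real.pi * Complex.I) := by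
    rw [← Complex.exp_eq_one_iff, Complex.exp_sum, ← hy' j]
    refine Finset.prod_congr rfl fun i _ => ?_
    rw [Complex.exp_nat_mul, Complex.exp_log (hy i)]
  choose k hk using h1
  choose n hn using ha.exists_bezout
  -- The logarithms of `y` are orthogonal to the `j`-th circuit only up to `2πi * k j`. The Bezout
  -- coefficients `n j` distribute this defect over the entries of the circuit as integral multiples
  -- of `2πi`, which the exponential does not see.
  let N : ι → ℤ := fun i => ∑ j, if a j i = 0 then 0 else k j * n j i
  obtain ⟨ξ, hξ⟩ := ha.exists_weight_eq
    (fun i => Complex.log (y i) - N i * (2 * Real.pi * Complex.I)) fun j => by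
      simp only [mul_sub, Finset.sum_sub_distrib]
      rw [hk, sub_eq_zero]
      have h2 : ∑ i, (a j i : ℤ) * N i = k j := by
        have : ∀ i, (a j i : ℤ) * N i = k j * (n j i * a j i) := by
          intro i
          by_cases hi : a j i = 0
          · simp [hi]
          · have hNi : N i = k j * n j i := by
              simp only [N]
              rw [ha.sum_eq hi _ (fun j' h => by simp [h])]
              simp [hi]
            rw [hNi]; ring
        simp only [this, ← Finset.mul_sum, hn, mul_one]
      have h3 : ∑ i, (a j i : ℂ) * N i = k j := by exact_mod_cast h2
      rw [← h3, Finset.sum_mul]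
      exact Finset.sum_congr rfl fun i _ => by ring
  refine ⟨torusExp ξ, fun i => ?_⟩
  rw [character_torusExp, hξ, Complex.exp_sub, Complex.exp_log (hy i),
    Complex.exp_int_mul_two_pi_mul_I, div_one]

end IsCircuitSystem

end Circuits

/-! ### Positive parts of relations -/

section PositivePart

variable {r : ℕ} {ι : Type*} [Fintype ι]

/-- Gordan's alternative: if no linear form is positive on the vectors `m i`, `i ∈ S`, then these
satisfy a non-trivial non-negative relation. -/
theorem exists_nonneg_relation (m : ι → Fin r → ℝ) (S : Set ι)
    (h : ¬ ∃ u : Fin r → ℝ, ∀ i ∈ S, 0 < ∑ l, m i l * u l) :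
    ∃ b : ι → ℝ, (∀ i, 0 ≤ b i) ∧ b ≠ 0 ∧ (∀ i ∉ S, b i = 0) ∧ ∀ l, ∑ i, b i * m i l = 0 := by
  classical
  let Φ : (ι → ℝ) →L[ℝ] (Fin r → ℝ) :=
    ContinuousLinearMap.pi fun l => ∑ i, (m i l) • ContinuousLinearMap.proj i
  have hΦ (w : ι → ℝ) (l : Fin r) : Φ w l = ∑ i, w i * m i l := by
    simp [Φ, mul_comm]
  -- A face of the simplex. Either `0` lies in its image, giving the relation, or Hahn–Banach
  -- separates `0` from this compact convex image, giving the positive linear form.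
  let Δ : Set (ι → ℝ) := stdSimplex ℝ ι ∩ {w | ∀ i ∉ S, w i = 0}
  have hcl : IsClosed {w : ι → ℝ | ∀ i ∉ S, w i = 0} := by
    simp only [Set.ofPred_forall]
    exact isClosed_iInter fun i => isClosed_iInter fun _ =>
      isClosed_eq (continuous_apply i) continuous_const
  have hcv : Convex ℝ {w : ι → ℝ | ∀ i ∉ S, w i = 0} := by
    intro x hx y hy s t _ _ _ i hi
    simp [hx i hi, hy i hi]
  by_cases h0 : (0 : Fin r → ℝ) ∈ Φ '' Δ
  · obtain ⟨w, ⟨hw, hw'⟩, hw0⟩ := h0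
    refine ⟨w, hw.1, ?_, hw', fun l => by rw [← hΦ, hw0]; rfl⟩
    rintro rfl
    simpa using hw.2
  · exfalso
    apply h
    obtain ⟨f, u, hu, hf⟩ := geometric_hahn_banach_point_closed
      (((convex_stdSimplex ℝ ι).inter hcv).linear_image Φ.toLinearMap)
      (((isCompact_stdSimplex ℝ ι).inter_right hcl).image Φ.continuous).isClosed h0
    refine ⟨fun l => f (Pi.single l 1), fun i hi => ?_⟩
    have h1 := hf (Φ (Pi.single i 1)) ⟨Pi.single i 1, ⟨single_mem_stdSimplex ℝ i, fun k hk => ?_⟩, rfl⟩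
    · rw [map_zero] at hu
      refine (hu.trans h1).trans_eq ?_
      have h2 : Φ (Pi.single i 1) = m i := by
        ext l
        simp [hΦ, Pi.single_apply]
      rw [h2]
      conv_lhs => rw [← Finset.univ_sum_single (m i)]
      rw [map_sum]
      refine Finset.sum_congr rfl fun l _ => ?_
      have : (Pi.single l (m i l) : Fin r → ℝ) = m i l • Pi.single l 1 := by
        rw [← Pi.single_smul, smul_eq_mul, mul_one]
      rw [this, map_smul, smul_eq_mul]
    · rw [Pi.single_apply, if_neg]
      rintro rfl
      exact hk hi

/-- If no relation is supported in an open half space then the positive part of a relation is a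
relation. -/
theorem posPart_relation (m : ι → Fin r → ℝ)
    (h : ∀ c : ι → ℝ, (∀ l, ∑ i, c i * m i l = 0) → c ≠ 0 →
      ¬ ∃ u : Fin r → ℝ, ∀ i, c i ≠ 0 → 0 < ∑ l, m i l * u l)
    (c : ι → ℝ) (hc : ∀ l, ∑ i, c i * m i l = 0) : ∀ l, ∑ i, max (c i) 0 * m i l = 0 := by
  classical
  let L : Submodule ℝ (ι → ℝ) :=
    { carrier := {c | ∀ l, ∑ i, c i * m i l = 0}
      add_mem' := fun {x y} hx hy l => by simp [add_mul, Finset.sum_add_distrib, hx l, hy l]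
      zero_mem' := fun l => by simp
      smul_mem' := fun s x hx l => by simp [mul_assoc, ← Finset.mul_sum, hx l] }
  suffices H : ∀ (N : ℕ) (c : ι → ℝ), c ∈ L → (Finset.univ.filter fun i => c i ≠ 0).card = N →
      (fun i => max (c i) 0) ∈ L from H _ c hc rfl
  clear c hc
  intro N
  induction N using Nat.strong_induction_on with
  | _ N ih =>
  intro c hc hN
  by_cases hc0 : c = 0
  · subst hc0
    simp only [Pi.zero_apply, max_self]
    exact L.zero_mem
  obtain ⟨b, hb, hb0, hbS, hbL⟩ := exists_nonneg_relation m {i | c i ≠ 0} (h c hc hc0)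
  have hbL : b ∈ L := hbL
  have hbS (i : ι) (hi : c i = 0) : b i = 0 := hbS i (by simpa using hi)
  -- moving along `b` until a coordinate of sign `ε` vanishes
  have step (ε : ℝ) (hε : ε = 1 ∨ ε = -1) (hex : ∃ i, b i ≠ 0 ∧ 0 < ε * c i) :
      ∃ t > 0, (∀ i, 0 < ε * c i → 0 ≤ ε * c i - t * b i) ∧ (fun i => max (c i - ε * t * b i) 0) ∈ L := by
    have hε2 : ε * ε = 1 := by rcases hε with rfl | rfl <;> norm_num
    let F := Finset.univ.filter fun i => b i ≠ 0 ∧ 0 < ε * c i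
    have hF : F.Nonempty := by
      obtain ⟨i, hi⟩ := hex
      exact ⟨i, by simpa [F] using hi⟩
    -- The smallest quotient: coordinate `k` vanishes first, while the other coordinates of sign `ε`
    -- do not yet change sign. So the support shrinks and the induction applies.
    obtain ⟨k, hk, hmin⟩ := F.exists_min_image (fun i => ε * c i / b i) hF
    have hk' : b k ≠ 0 ∧ 0 < ε * c k := by simpa [F] using hk
    have hbk : 0 < b k := lt_of_le_of_ne (hb k) hk'.1.symm
    refine ⟨ε * c k / b k, div_pos hk'.2 hbk, fun i hi => ?_, ?_⟩
    · by_cases hbi : b i = 0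
      · simp [hbi, hi.le]
      · have hbi' : 0 < b i := lt_of_le_of_ne (hb i) (Ne.symm hbi)
        have := hmin i (by simp [F, hbi, hi])
        rw [le_div_iff₀ hbi'] at this
        linarith
    · refine ih _ ?_ (fun i => c i - ε * (ε * c k / b k) * b i)
        (L.sub_mem hc (L.smul_mem (ε * (ε * c k / b k)) hbL)) rfl
      rw [← hN]
      refine Finset.card_lt_card ⟨fun i hi => ?_, fun hsub => ?_⟩
      · simp only [Finset.mem_filter, Finset.mem_univ, true_and] at hi ⊢
        intro h0
        rw [h0, hbS i h0] at hi
        simp at hi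
      · have hck : c k ≠ 0 := fun h0 => by simp [h0] at hk'
        have := hsub (show k ∈ _ by simpa using hck)
        simp only [Finset.mem_filter, Finset.mem_univ, true_and] at this
        apply this
        field_simp
        linear_combination (-(c k)) * hε2
  -- The part of `b` over the positive coordinates of `c`. Moving in the direction `ε = 1` changes
  -- the positive part of `c` by `-t • bP`, moving in the direction `ε = -1` changes it by `t • bP`.
  let bP : ι → ℝ := fun i => if 0 < c i then b i else 0
  have ePos (t : ℝ) (ht : 0 < t) (h1 : ∀ i, 0 < 1 * c i → 0 ≤ 1 * c i - t * b i) :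
      (fun i => max (c i - 1 * t * b i) 0) = (fun i => max (c i) 0) - t • bP := by
    ext i
    simp only [Pi.sub_apply, Pi.smul_apply, smul_eq_mul, bP]
    split_ifs with hi
    · have := h1 i (by linarith)
      rw [max_eq_left (by linarith), max_eq_left hi.le]
      ring
    · have := mul_nonneg ht.le (hb i)
      rw [max_eq_right (by linarith), max_eq_right (by linarith)]
      ring
  have eNeg (t : ℝ) (ht : 0 < t) (h1 : ∀ i, 0 < (-1) * c i → 0 ≤ (-1) * c i - t * b i) :
      (fun i => max (c i - (-1) * t * b i) 0) = (fun i => max (c i) 0) + t • bP := by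
    ext i
    simp only [Pi.add_apply, Pi.smul_apply, smul_eq_mul, bP]
    have := mul_nonneg ht.le (hb i)
    split_ifs with hi
    · rw [max_eq_left (by linarith), max_eq_left hi.le]
      ring
    · rcases eq_or_lt_of_le (not_lt.1 hi) with h0 | h0
      · simp [h0, hbS i h0]
      · have := h1 i (by linarith)
        rw [max_eq_right (by linarith), max_eq_right (by linarith)]
        ring
  have hbPN (hP : ∀ i, b i ≠ 0 → ¬ 0 < c i) : bP = 0 := by
    ext i
    simp only [bP, Pi.zero_apply, ite_eq_right_iff]
    intro hi
    by_contra hne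
    exact hP i hne hi
  by_cases hP : ∃ i, b i ≠ 0 ∧ 0 < c i
  · obtain ⟨t, ht, h1, h2⟩ := step 1 (Or.inl rfl) (by simpa using hP)
    rw [ePos t ht h1] at h2
    by_cases hQ : ∃ i, b i ≠ 0 ∧ c i < 0
    · obtain ⟨t', ht', h1', h2'⟩ := step (-1) (Or.inr rfl) (by simpa using hQ)
      rw [eNeg t' ht' h1'] at h2'
      -- In this weighted mean of the two relations the multiples of `bP` cancel and only the
      -- positive part of `c` is left.
      have h3 := L.smul_mem (t + t')⁻¹ (L.add_mem (L.smul_mem t' h2) (L.smul_mem t h2'))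
      convert h3 using 1
      ext i
      simp only [Pi.smul_apply, Pi.add_apply, Pi.sub_apply, smul_eq_mul]
      field_simp
      ring
    -- If `b` only meets positive coordinates, then `bP = b` is itself a relation and can be added
    -- back.
    · have hbP : bP = b := by
        ext i
        simp only [bP]
        split_ifs with hi
        · rfl
        · by_contra hne
          refine hQ ⟨i, Ne.symm hne, lt_of_le_of_ne (not_lt.1 hi) fun h0 => hne (hbS i h0).symm⟩
      rw [hbP] at h2
      simpa using L.add_mem h2 (L.smul_mem t hbL)
  · obtain ⟨i, hi⟩ : ∃ i, b i ≠ 0 := by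
      by_contra! h0
      exact hb0 (funext h0)
    have hci : c i < 0 := by
      rcases lt_trichotomy (c i) 0 with h0 | h0 | h0
      · exact h0
      · exact absurd (hbS i h0) hi
      · exact absurd ⟨i, hi, h0⟩ hP
    -- If `b` only meets negative coordinates, then `bP = 0` and the move does not change the
    -- positive part of `c`.
    obtain ⟨t', ht', h1', h2'⟩ := step (-1) (Or.inr rfl) ⟨i, hi, by linarith⟩
    rw [eNeg t' ht' h1', hbPN fun i h0 h1 => hP ⟨i, h0, h1⟩] at h2'
    simpa using h2'

end PositivePart

/-! ### Weight bases -/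

section WeightBasis

variable {r : ℕ} {V : Type*} [AddCommGroup V] [Module ℂ V] {ι : Type*}

/-- A basis of vectors on which the torus acts through the characters `m i`. -/
def IsWeightBasis (ρ : Representation ℂ (Fin r → ℂˣ) V) (m : ι → Fin r → ℤ)
    (b : Module.Basis ι ℂ V) : Prop := ∀ t i, ρ t (b i) = character (m i) t • b i

/-- Write `ρ t = ∑ t^m Aₘ`. Comparing coefficients of `t^m` in `ρ (s * t) = ρ s ∘ ρ t` shows that
the image of `Aₘ` consists of vectors of weight `m`; these span `V` because the `Aₘ` add up to `ρ 1
= id`. -/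
theorem exists_isWeightBasis [FiniteDimensional ℂ V] {ρ : Representation ℂ (Fin r → ℂˣ) V}
    (hρ : IsRational ρ) : ∃ (n : ℕ) (m : Fin n → Fin r → ℤ) (b : Module.Basis (Fin n) ℂ V),
      IsWeightBasis ρ m b := by
  obtain ⟨A, hA⟩ := hρ
  have hwt (s : Fin r → ℂˣ) (m : Fin r → ℤ) : ρ s ∘ₗ A m = character m s • A m := by
    let F : (Fin r → ℤ) →₀ Module.End ℂ V := Finsupp.onFinset A.support
      (fun m => ρ s ∘ₗ A m - character m s • A m) (by
        intro m hm
        rw [Finsupp.mem_support_iff]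
        rintro h0
        simp [h0] at hm)
    have hF : F = 0 := by
      refine character_indep F fun t => ?_
      rw [Finsupp.onFinset_sum _ (by simp)]
      have h1 : ρ (s * t) = ρ s ∘ₗ ρ t := map_mul ρ s t
      rw [hA (s * t), hA t] at h1
      simp only [Finsupp.sum, map_mul] at h1
      simp only [smul_sub, Finset.sum_sub_distrib]
      rw [sub_eq_zero]
      ext x
      have := LinearMap.congr_fun h1 x
      simp only [LinearMap.sum_apply, LinearMap.comp_apply, map_sum, LinearMap.smul_apply,
        map_smul] at this ⊢
      rw [← this]
      exact Finset.sum_congr rfl fun m _ => by rw [smul_smul, mul_comm]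
    have := DFunLike.congr_fun hF m
    simpa [F, sub_eq_zero] using this
  let S : Set V := {x | ∃ m : Fin r → ℤ, ∀ t, ρ t x = character m t • x}
  have hS : ⊤ ≤ Submodule.span ℂ S := by
    intro x _
    have hx : x = ∑ m ∈ A.support, A m x := by
      have := LinearMap.congr_fun (hA 1) x
      rw [map_one] at this
      simpa [Finsupp.sum, LinearMap.sum_apply] using this
    rw [hx]
    exact Submodule.sum_mem _ fun m _ => Submodule.subset_span
      ⟨m, fun t => LinearMap.congr_fun (hwt t m) x⟩
  let B := Module.Basis.ofSpan hS
  have : Finite _ := Module.Finite.finite_basis B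
  let _ := Fintype.ofFinite ((linearIndepOn_empty ℂ id).extend (Set.empty_subset S))
  have hB (i) : B i ∈ S := Module.Basis.ofSpan_subset hS ⟨i, rfl⟩
  choose m hm using hB
  let e := Fintype.equivFin ((linearIndepOn_empty ℂ id).extend (Set.empty_subset S))
  exact ⟨_, fun i => m (e.symm i), B.reindex e, fun t i => by simp [hm]⟩

variable [Fintype ι] {ρ : Representation ℂ (Fin r → ℂˣ) V} {m : ι → Fin r → ℤ}
  {b : Module.Basis ι ℂ V}

theorem IsWeightBasis.repr_apply (hb : IsWeightBasis ρ m b) (t : Fin r → ℂˣ) (x : V) (i : ι) :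
    b.repr (ρ t x) i = character (m i) t * b.repr x i := by
  classical
  conv_lhs => rw [← b.sum_repr x]
  simp only [map_sum, map_smul, hb t, Finsupp.coe_finsetSum, Finset.sum_apply, Finsupp.smul_apply,
    Module.Basis.repr_self, Finsupp.single_apply, smul_eq_mul]
  simp [mul_comm]

/-- In weight coordinates the torus acts by exponentials, so the moment map is a combination of the
products `xᵢ yᵢ` alone. All later uses of the moment map and of tangent spaces go through this
formula. -/
theorem IsWeightBasis.moment_eq (hb : IsWeightBasis ρ m b) (ξ : Fin r → ℂ)
    (p : V × Module.Dual ℂ V) :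
    moment ρ ξ p = ∑ i, (∑ l, m i l * ξ l) * (b.repr p.1 i * p.2 (b i)) := by
  have h1 (z : ℂ) : p.2 (ρ (torusExp (z • ξ)) p.1) =
      ∑ i, Complex.exp (z * ∑ l, m i l * ξ l) * (b.repr p.1 i * p.2 (b i)) := by
    conv_lhs => rw [← b.sum_repr (ρ (torusExp (z • ξ)) p.1)]
    rw [map_sum]
    refine Finset.sum_congr rfl fun i _ => ?_
    rw [map_smul, hb.repr_apply, character_torusExp, smul_eq_mul, mul_assoc]
    congr 2
    rw [Finset.mul_sum]
    exact Finset.sum_congr rfl fun l _ => by simp; ring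
  simp only [moment, h1]
  refine HasDerivAt.deriv (HasDerivAt.fun_sum fun i _ => ?_)
  have h3 := (((hasDerivAt_id (0 : ℂ)).mul_const (∑ l, (m i l : ℂ) * ξ l)).cexp).mul_const
    (b.repr p.1 i * p.2 (b i))
  simpa using h3

theorem IsWeightBasis.mem_tangent (hb : IsWeightBasis ρ m b) (x y : V) :
    y ∈ tangent ρ x ↔ ∃ ξ : Fin r → ℂ, ∀ i, b.repr y i = (∑ l, m i l * ξ l) * b.repr x i := by
  classical
  refine exists_congr fun ξ => ⟨fun h i => ?_, fun h φ => ?_⟩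
  · have := h (b.coord i)
    rw [hb.moment_eq] at this
    simpa [Finsupp.single_apply] using this
  · rw [hb.moment_eq]
    conv_lhs => rw [← b.sum_repr y]
    rw [map_sum]
    refine Finset.sum_congr rfl fun i _ => ?_
    rw [map_smul, h, smul_eq_mul, mul_assoc]

/-- A coordinate `l` in which `m i` is nonzero gives an element of the Lie algebra that multiplies
the `i`-th coordinate of `x` by `m i l`, whereas all of `𝔱 · v` has vanishing `i`-th coordinate. -/
theorem IsWeightBasis.repr_eq_zero_of_tangent_subset (hb : IsWeightBasis ρ m b) {v x : V}
    (hx : tangent ρ x ⊆ tangent ρ v) {i : ι} (hi : m i ≠ 0) (hv : b.repr v i = 0) :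
    b.repr x i = 0 := by
  classical
  obtain ⟨l, hl⟩ := Function.ne_iff.1 hi
  have h1 : ∑ i, ((m i l : ℂ) * b.repr x i) • b i ∈ tangent ρ x := by
    refine (hb.mem_tangent _ _).2 ⟨Pi.single l 1, fun i => ?_⟩
    rw [b.repr_sum_self]
    congr 1
    rw [Fintype.sum_eq_single l fun k hk => by simp [Pi.single_eq_of_ne hk]]
    simp
  obtain ⟨ξ, hξ⟩ := (hb.mem_tangent _ _).1 (hx h1)
  have h2 := hξ i
  rw [b.repr_sum_self, hv, mul_zero] at h2
  refine (mul_eq_zero.1 h2).resolve_left ?_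
  exact_mod_cast hl

/-- Convergence is tested on linear forms only, so that `M` needs no topology. -/
theorem poly_tendsto {M : Type*} [AddCommGroup M] [Module ℂ M] (γ : ℝ → M) (y : M)
    (h : ∀ φ : Module.Dual ℂ M, Filter.Tendsto (fun s => φ (γ s)) Filter.atTop (nhds (φ y)))
    (f : M → ℂ) (hf : f ∈ Poly M) :
    Filter.Tendsto (fun s => f (γ s)) Filter.atTop (nhds (f y)) := by
  induction hf using Algebra.adjoin_induction with
  | mem x hx =>
    obtain ⟨φ, rfl⟩ := hx
    exact h φ
  | algebraMap c => exact tendsto_const_nhds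
  | add f g _ _ h₁ h₂ => exact h₁.add h₂
  | mul f g _ _ h₁ h₂ => exact h₁.mul h₂

/-- The limit of `exp(-s u) · x` for `s → ∞` belongs to the closure of the orbit of `x`. -/
theorem IsWeightBasis.mem_zariskiClosure (hb : IsWeightBasis ρ m b) (x y : V) (u : Fin r → ℝ)
    (h : ∀ i, (∑ l, m i l * u l = 0 ∧ b.repr y i = b.repr x i) ∨
      (0 < ∑ l, m i l * u l ∧ b.repr y i = 0) ∨ (b.repr x i = 0 ∧ b.repr y i = 0)) :
    y ∈ zariskiClosure (orbit ρ x) := by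
  intro f hf
  let γ : ℝ → V := fun s => ρ (torusExp fun l => ((-(s * u l) : ℝ) : ℂ)) x
  have hγ (s : ℝ) (i : ι) : b.repr (γ s) i =
      ((Real.exp (-(s * ∑ l, m i l * u l)) : ℝ) : ℂ) * b.repr x i := by
    rw [hb.repr_apply, character_torusExp]
    congr 1
    push_cast
    congr 1
    rw [Finset.mul_sum, ← Finset.sum_neg_distrib]
    exact Finset.sum_congr rfl fun l _ => by ring
  have hlim (i : ι) : Filter.Tendsto (fun s => b.repr (γ s) i) Filter.atTop
      (nhds (b.repr y i)) := by
    simp only [hγ]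
    rcases h i with ⟨h0, h1⟩ | ⟨h0, h1⟩ | ⟨h0, h1⟩
    · simp [h0, h1]
    · rw [h1]
      have h2 : Filter.Tendsto (fun s : ℝ => Real.exp (-(s * ∑ l, m i l * u l))) Filter.atTop
          (nhds 0) := by
        refine Real.tendsto_exp_atBot.comp ?_
        exact Filter.tendsto_neg_atTop_atBot.comp
          (Filter.tendsto_id.atTop_mul_const h0)
      have h3 := ((Complex.continuous_ofReal.tendsto 0).comp h2).mul_const (b.repr x i)
      simpa using h3
    · simp [h0, h1]
  have hφ (φ : Module.Dual ℂ V) :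
      Filter.Tendsto (fun s => φ (γ s)) Filter.atTop (nhds (φ y)) := by
    have e (v : V) : φ v = ∑ i, b.repr v i * φ (b i) := by
      conv_lhs => rw [← b.sum_repr v]
      rw [map_sum]
      exact Finset.sum_congr rfl fun i _ => by rw [map_smul, smul_eq_mul]
    have h1 : Filter.Tendsto (fun s => ∑ i, b.repr (γ s) i * φ (b i)) Filter.atTop
        (nhds (∑ i, b.repr y i * φ (b i))) :=
      tendsto_finsetSum _ fun i _ => (hlim i).mul_const _
    simpa only [← e] using h1
  refine tendsto_nhds_unique (poly_tendsto γ y hφ f.1 f.2) ?_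
  have : (fun s => f.1 (γ s)) = fun _ => 0 := by
    ext s
    exact hf _ ⟨_, rfl⟩
  rw [this]
  exact tendsto_const_nhds

theorem log_norm_character (n : Fin r → ℤ) (t : Fin r → ℂˣ) :
    Real.log ‖character n t‖ = ∑ l, n l * Real.log ‖(t l : ℂ)‖ := by
  simp only [character, MonoidHom.coe_mk, OneHom.coe_mk, Units.val_zpow_eq_zpow_val, norm_prod,
    norm_zpow]
  rw [Real.log_prod fun l _ => zpow_ne_zero _ (norm_ne_zero_iff.2 (t l).ne_zero)]
  simp [Real.log_zpow]

theorem character_ne_zero (n : Fin r → ℤ) (t : Fin r → ℂˣ) : character n t ≠ 0 := by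
  simp only [character, MonoidHom.coe_mk, OneHom.coe_mk]
  exact Finset.prod_ne_zero_iff.2 fun l _ => Units.ne_zero _

/-- The weights of the support of a relation of a visible representation do not belong to an
open half space. -/
theorem IsWeightBasis.not_halfSpace (hb : IsWeightBasis ρ m b) (hvis : IsVisibleRep ρ)
    (c : ι → ℝ) (hc : ∀ l, ∑ i, c i * (m i l : ℝ) = 0) (hc0 : c ≠ 0) :
    ¬ ∃ u : Fin r → ℝ, ∀ i, c i ≠ 0 → 0 < ∑ l, (m i l : ℝ) * u l := by
  classical
  rintro ⟨u, hu⟩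
  let x : ℝ → V := fun s => ∑ i, (if c i = 0 then 0 else (Real.exp (s * c i) : ℂ)) • b i
  have hx (s : ℝ) (i : ι) : b.repr (x s) i = if c i = 0 then 0 else (Real.exp (s * c i) : ℂ) := by
    simp only [x]
    rw [b.repr_sum_self]
  have hnil (s : ℝ) : IsNilpotentVec ρ (x s) := by
    refine hb.mem_zariskiClosure _ _ u fun i => ?_
    by_cases hi : c i = 0
    · right; right
      simp [hx, hi]
    · right; left
      exact ⟨hu i hi, by simp⟩
  -- Since `c` is a relation, `∑ c i * log ‖xᵢ‖` is constant on orbits. On `x s` it equals `s * ∑ c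
  -- i * c i`, so the orbit determines `s`.
  have hinj : Function.Injective fun s => orbit ρ (x s) := by
    intro s s' h
    have h1 : x s' ∈ orbit ρ (x s) := by
      change orbit ρ (x s) = orbit ρ (x s') at h
      rw [h]
      exact ⟨1, by simp⟩
    obtain ⟨t, ht⟩ := h1
    have h2 (i : ι) : s' * (c i * c i) =
        c i * ∑ l, m i l * Real.log ‖(t l : ℂ)‖ + s * (c i * c i) := by
      by_cases hi : c i = 0
      · simp [hi]
      have h3 := congrArg (fun v => Real.log ‖b.repr v i‖) ht
      simp only [hb.repr_apply, hx, if_neg hi] at h3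
      rw [norm_mul, Real.log_mul (norm_ne_zero_iff.2 (character_ne_zero _ _)) (by simp),
        Complex.norm_real, Complex.norm_real, Real.norm_of_nonneg (Real.exp_pos _).le,
        Real.norm_of_nonneg (Real.exp_pos _).le, Real.log_exp, Real.log_exp,
        log_norm_character] at h3
      linear_combination (-(c i)) * h3
    have h4 : ∑ i, c i * ∑ l, m i l * Real.log ‖(t l : ℂ)‖ = 0 := by
      simp only [Finset.mul_sum]
      rw [Finset.sum_comm]
      refine Finset.sum_eq_zero fun l _ => ?_
      simp only [← mul_assoc]
      rw [← Finset.sum_mul, hc, zero_mul]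
    have h5 : s' * ∑ i, c i * c i = s * ∑ i, c i * c i := by
      rw [Finset.mul_sum, Finset.mul_sum, Finset.sum_congr rfl fun i _ => h2 i,
        Finset.sum_add_distrib, h4, zero_add]
    have h6 : ∑ i, c i * c i ≠ 0 := by
      intro h0
      rw [Finset.sum_eq_zero_iff_of_nonneg fun i _ => mul_self_nonneg _] at h0
      exact hc0 (funext fun i => by simpa using h0 i (Finset.mem_univ i))
    exact (mul_right_cancel₀ h6 h5).symm
  have hfin : (Set.range fun s => orbit ρ (x s)).Finite := by
    refine Set.Finite.subset hvis ?_
    rintro _ ⟨s, rfl⟩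
    exact ⟨x s, hnil s, rfl⟩
  exact Set.infinite_range_of_injective hinj hfin

/-- The positive part of the real relation `c - d` has the truncated differences `c i - d i` as its
entries, so `posPart_relation` supplies the combinatorial hypothesis for circuits. -/
theorem IsWeightBasis.exists_isCircuitSystem {n : ℕ} {m : Fin n → Fin r → ℤ}
    {b : Module.Basis (Fin n) ℂ V} (hb : IsWeightBasis ρ m b) (hvis : IsVisibleRep ρ) :
    ∃ (κ : Type) (_ : Fintype κ) (a : κ → Fin n → ℕ), IsCircuitSystem m a := by
  refine TorusReduction.exists_isCircuitSystem m fun c d hcd l => ?_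
  have h := posPart_relation (fun i l => (m i l : ℝ)) (hb.not_halfSpace hvis)
    (fun i => (c i : ℝ) - d i) (fun l => by
      have := hcd l
      rw [← sub_eq_zero, ← Finset.sum_sub_distrib] at this
      simp only [← sub_mul] at this
      exact_mod_cast this) l
  have e (i : Fin n) : max ((c i : ℝ) - d i) 0 = ((c i - d i : ℕ) : ℝ) := by
    rcases le_total (d i) (c i) with h | h
    · rw [Nat.cast_sub h, max_eq_left (sub_nonneg.2 (by exact_mod_cast h))]
    · rw [Nat.sub_eq_zero_of_le h, max_eq_right (sub_nonpos.2 (by exact_mod_cast h))]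
      simp
  simp only [e] at h
  exact_mod_cast h

end WeightBasis

/-! ### Monomials -/

section Monomials

variable {M : Type*} [AddCommGroup M] [Module ℂ M]

/-- Evaluation of polynomial functions at a point. -/
def evalAt (p : M) : Poly M →ₐ[ℂ] ℂ := (Pi.evalAlgHom ℂ (fun _ : M => ℂ) p).comp (Poly M).val

theorem poly_ext {f g : Poly M} (h : ∀ p, evalAt p f = evalAt p g) : f = g :=
  Subtype.ext (funext h)

/-- A linear form as a polynomial function. -/
def linPoly (φ : Module.Dual ℂ M) : Poly M := ⟨φ, linear_mem_poly φ⟩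

@[simp] theorem evalAt_linPoly (p : M) (φ : Module.Dual ℂ M) : evalAt p (linPoly φ) = φ p := rfl

variable {σ : Type*} [Fintype σ] (B : Module.Basis σ ℂ M)

/-- The monomials in the coordinates of a basis. -/
def mono (e : σ → ℕ) : Poly M := ∏ s, linPoly (B.coord s) ^ e s

theorem evalAt_mono (e : σ → ℕ) (p : M) : evalAt p (mono B e) = ∏ s, B.repr p s ^ e s := by
  simp [mono]

theorem mono_add (e e' : σ → ℕ) : mono B (e + e') = mono B e * mono B e' := by
  simp [mono, pow_add, Finset.prod_mul_distrib]

theorem span_mono : Submodule.span ℂ (Set.range (mono B)) = ⊤ := by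
  classical
  rw [eq_top_iff]
  rintro ⟨f, hf⟩ -
  induction hf using Algebra.adjoin_induction with
  | mem x hx =>
    obtain ⟨φ, rfl⟩ := hx
    have : (⟨φ, linear_mem_poly φ⟩ : Poly M) = ∑ s, φ (B s) • mono B (Pi.single s 1) := by
      refine poly_ext fun p => ?_
      simp only [map_sum, map_smul, evalAt_mono, smul_eq_mul]
      change φ p = _
      conv_lhs => rw [← B.sum_repr p]
      rw [map_sum]
      refine Finset.sum_congr rfl fun s _ => ?_
      rw [Fintype.prod_eq_single s fun s' hs' => by simp [Pi.single_eq_of_ne hs']]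
      simp [mul_comm]
    exact this ▸ Submodule.sum_mem _ fun s _ =>
      Submodule.smul_mem _ _ (Submodule.subset_span ⟨_, rfl⟩)
  | algebraMap c =>
    have : (algebraMap ℂ (Poly M) c) = c • mono B 0 := by
      simp [mono, Algebra.algebraMap_eq_smul_one]
    change algebraMap ℂ (Poly M) c ∈ _
    exact this ▸ Submodule.smul_mem _ _ (Submodule.subset_span ⟨_, rfl⟩)
  | add x y hx hy h₁ h₂ => exact add_mem h₁ h₂
  | mul x y hx hy h₁ h₂ =>
    have key (f g : Poly M) (hf : f ∈ Submodule.span ℂ (Set.range (mono B)))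
        (hg : g ∈ Submodule.span ℂ (Set.range (mono B))) :
        f * g ∈ Submodule.span ℂ (Set.range (mono B)) := by
      have h := Submodule.mul_mem_mul hf hg
      rw [Submodule.span_mul_span] at h
      refine Submodule.span_mono ?_ h
      rintro _ ⟨_, ⟨e, rfl⟩, _, ⟨e', rfl⟩, rfl⟩
      exact ⟨e + e', mono_add B e e'⟩
    exact key _ _ h₁ h₂

/-- A linear relation between monomial functions is a polynomial that vanishes at every point of an
infinite field. -/
theorem linearIndependent_mono : LinearIndependent ℂ (mono B) := by
  classical
  rw [linearIndependent_iff]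
  intro l hl
  let P : MvPolynomial σ ℂ :=
    ∑ e ∈ l.support, MvPolynomial.monomial (Finsupp.equivFunOnFinite.symm e) (l e)
  have hP : P = 0 := by
    refine MvPolynomial.funext fun y => ?_
    have h := congrArg (evalAt (B.equivFun.symm y)) hl
    rw [Finsupp.linearCombination_apply, Finsupp.sum, map_sum, map_zero] at h
    rw [map_zero, ← h, map_sum]
    refine Finset.sum_congr rfl fun e _ => ?_
    rw [map_smul, evalAt_mono, MvPolynomial.eval_monomial, Finsupp.prod_fintype _ _ (by simp),
      smul_eq_mul]
    simp only [← B.equivFun_apply, LinearEquiv.apply_symm_apply]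
    rfl
  ext e
  have h := congrArg (MvPolynomial.coeff (Finsupp.equivFunOnFinite.symm e)) hP
  simp only [P, MvPolynomial.coeff_sum, MvPolynomial.coeff_monomial, MvPolynomial.coeff_zero,
    EmbeddingLike.apply_eq_iff_eq, Finset.sum_ite_eq', Finsupp.mem_support_iff] at h
  by_contra hne
  exact hne (by simpa using h)

/-- An invariant combination of eigenfunctions is a combination of invariant eigenfunctions. -/
theorem mem_span_of_invariant {G E : Type*} [Monoid G] (τ : G → M → M) (g : E → Poly M)
    (χ : E → G →* ℂ) (hg : ∀ e t p, evalAt (τ t p) (g e) = χ e t * evalAt p (g e)) (f : Poly M)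
    (hf : f ∈ Submodule.span ℂ (Set.range g)) (hinv : ∀ t p, evalAt (τ t p) f = evalAt p f) :
    f ∈ Submodule.span ℂ (g '' {e | χ e = 1}) := by
  classical
  obtain ⟨l, rfl⟩ := Finsupp.mem_span_range_iff_exists_finsupp.1 hf
  have key : (l.sum fun e c => c • g e) = ∑ e ∈ l.support with χ e = 1, l e • g e := by
    refine poly_ext fun p => ?_
    -- At a fixed point `p`, invariance is a linear relation between characters of `G`. By Dedekind
    -- independence the coefficient of the trivial character gives the value of `f` at `p`.
    let L : (G →* ℂ) →₀ ℂ := (∑ e ∈ l.support, Finsupp.single (χ e) (l e * evalAt p (g e))) -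
      Finsupp.single 1 (evalAt p (l.sum fun e c => c • g e))
    have hL : L = 0 := by
      refine linearIndependent_iff.1 (linearIndependent_monoidHom G ℂ) L ?_
      ext t
      have := hinv t p
      simp only [L, map_sub, map_sum, Finsupp.linearCombination_single, Pi.sub_apply,
        Finset.sum_apply, Pi.smul_apply, smul_eq_mul, MonoidHom.one_apply, mul_one, Pi.zero_apply]
      rw [sub_eq_zero, ← this, Finsupp.sum, map_sum]
      refine Finset.sum_congr rfl fun e _ => ?_
      rw [map_smul, hg, smul_eq_mul]
      ring
    have h1 := DFunLike.congr_fun hL 1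
    simp only [L, Finsupp.sub_apply, Finsupp.coe_finsetSum, Finset.sum_apply,
      Finsupp.single_apply, if_true, Finsupp.zero_apply] at h1
    rw [sub_eq_zero] at h1
    rw [← h1, map_sum, Finset.sum_filter]
    exact Finset.sum_congr rfl fun e _ => by simp
  rw [key]
  refine Submodule.sum_mem _ fun e he => Submodule.smul_mem _ _ (Submodule.subset_span ⟨e, ?_, rfl⟩)
  exact (Finset.mem_filter.1 he).2

end Monomials

/-! ### Invariant functions on `V` -/

section InvariantsV

variable {r : ℕ} {V : Type*} [AddCommGroup V] [Module ℂ V] {ι κ : Type*} [Fintype ι] [Fintype κ]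
  {ρ : Representation ℂ (Fin r → ℂˣ) V} {m : ι → Fin r → ℤ} {b : Module.Basis ι ℂ V}
  {a : κ → ι → ℕ}

theorem character_zero : (character (0 : Fin r → ℤ)) = 1 := by
  ext t
  simp [character]

theorem character_sum {σ : Type*} (s : Finset σ) (n : σ → Fin r → ℤ) (t : Fin r → ℂˣ) :
    character (∑ i ∈ s, n i) t = ∏ i ∈ s, character (n i) t := by
  classical
  induction s using Finset.induction_on with
  | empty => simp [character_zero]
  | insert i s hi ih => rw [Finset.sum_insert hi, Finset.prod_insert hi, character_add, ih]

theorem character_nsmul (k : ℕ) (n : Fin r → ℤ) (t : Fin r → ℂˣ) :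
    character (k • n) t = character n t ^ k := by
  simp [character, zpow_mul', Finset.prod_pow]

theorem evalAt_mono_apply (hb : IsWeightBasis ρ m b) (e : ι → ℕ) (t : Fin r → ℂˣ) (x : V) :
    evalAt (ρ t x) (mono b e) = character (∑ i, e i • m i) t * evalAt x (mono b e) := by
  rw [evalAt_mono, evalAt_mono, character_sum, ← Finset.prod_mul_distrib]
  refine Finset.prod_congr rfl fun i _ => ?_
  rw [hb.repr_apply, mul_pow, character_nsmul]

theorem sum_nsmul_eq_zero (e : ι → ℕ) :
    ∑ i, e i • m i = 0 ↔ ∀ l, ∑ i, (e i : ℤ) * m i l = 0 := by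
  rw [funext_iff]
  simp [Finset.sum_apply]

variable (ha : IsCircuitSystem m a) (hb : IsWeightBasis ρ m b)

include ha hb in
theorem mono_circuit_mem (j : κ) : mono b (a j) ∈ Invariants ρ := by
  intro t x
  change evalAt _ _ = evalAt _ _
  rw [evalAt_mono_apply hb, (sum_nsmul_eq_zero _).2 (ha.relation j), character_zero]
  simp

theorem mono_sum (z : κ → ℕ) (e : ι → ℕ) (he : ∀ i, e i = ∑ j, z j * a j i) :
    mono b e = ∏ j, mono b (a j) ^ z j := by
  simp only [mono, he, ← Finset.prod_pow, ← pow_mul]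
  rw [Finset.prod_comm]
  refine Finset.prod_congr rfl fun i _ => ?_
  rw [← Finset.prod_pow_eq_pow_sum]
  exact Finset.prod_congr rfl fun j _ => by rw [mul_comm]

/-- The algebra of invariants of `V` is a polynomial ring, generated by the circuit monomials. -/
def invariantsMap : MvPolynomial κ ℂ →ₐ[ℂ] Invariants ρ :=
  MvPolynomial.aeval fun j => ⟨mono b (a j), mono_circuit_mem ha hb j⟩

/-- The exponent of an invariant monomial is a non-negative relation of the weights, hence a sum of
circuits. -/
theorem invariantsMap_surjective : Function.Surjective (invariantsMap ha hb) := by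
  rintro ⟨f, hf⟩
  have h1 := mem_span_of_invariant (fun t x => ρ t x) (mono b)
    (fun e => character (∑ i, e i • m i)) (fun e t p => evalAt_mono_apply hb e t p) f
    (span_mono b ▸ Submodule.mem_top) hf
  suffices H : f ∈ ((invariantsMap ha hb).range.map (Invariants ρ).val).toSubmodule by
    obtain ⟨g, ⟨P, rfl⟩, hP⟩ := H
    exact ⟨P, Subtype.ext hP⟩
  refine Submodule.span_le.2 ?_ h1
  rintro _ ⟨e, he, rfl⟩
  have he0 : ∑ i, e i • m i = 0 := character_injective <| by
    have : character (∑ i, e i • m i) = 1 := he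
    rw [this, character_zero]
  obtain ⟨z, hz⟩ := ha.span e ((sum_nsmul_eq_zero _).1 he0)
  rw [mono_sum z e hz]
  refine Subalgebra.prod_mem _ fun j _ => Subalgebra.pow_mem _ ?_ _
  exact ⟨_, ⟨MvPolynomial.X j, rfl⟩, by simp [invariantsMap]⟩

/-- Disjointness of the circuits lets the circuit monomials take arbitrary values simultaneously:
put an `N_j`-th root of the prescribed value in every coordinate of the `j`-th circuit, with `N_j`
the sum of its entries. -/
theorem invariantsMap_injective : Function.Injective (invariantsMap ha hb) := by
  classical
  rw [injective_iff_map_eq_zero]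
  intro P hP
  refine MvPolynomial.funext fun y => ?_
  have hroot (j : κ) : ∃ w : ℂ, w ^ (∑ i, a j i) = y j := by
    obtain ⟨i, hi⟩ := ha.nonzero j
    refine IsAlgClosed.exists_pow_nat_eq _ (Nat.pos_of_ne_zero fun h => hi ?_)
    exact (Finset.sum_eq_zero_iff.1 h) i (Finset.mem_univ i)
  choose w hw using hroot
  let x : V := b.equivFun.symm fun i => ∑ j, if a j i = 0 then 0 else w j
  have hx (j : κ) (i : ι) (hi : a j i ≠ 0) : b.repr x i = w j := by
    have : b.repr x i = ∑ j, if a j i = 0 then 0 else w j := by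
      rw [← b.equivFun_apply, LinearEquiv.apply_symm_apply]
    rw [this, ha.sum_eq hi _ (fun j' h => by simp [h]), if_neg hi]
  have h1 : ((evalAt x).comp ((Invariants ρ).val.comp (invariantsMap ha hb))) P =
      MvPolynomial.eval y P := by
    rw [← MvPolynomial.coe_aeval_eq_eval]
    change _ = MvPolynomial.aeval y P
    congr 1
    refine MvPolynomial.algHom_ext fun j => ?_
    simp only [AlgHom.comp_apply, invariantsMap, MvPolynomial.aeval_X]
    change evalAt x (mono b (a j)) = y j
    rw [evalAt_mono, ← hw, ← Finset.prod_pow_eq_pow_sum]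
    refine Finset.prod_congr rfl fun i _ => ?_
    by_cases hi : a j i = 0
    · simp [hi]
    · rw [hx j i hi]
  rw [← h1, AlgHom.comp_apply, AlgHom.comp_apply, hP, map_zero, map_zero, map_zero]

include ha hb in
theorem ringKrullDim_invariants : ringKrullDim (Invariants ρ) = Fintype.card κ := by
  rw [← ringKrullDim_eq_of_ringEquiv (RingEquiv.ofBijective (invariantsMap ha hb)
    ⟨invariantsMap_injective ha hb, invariantsMap_surjective ha hb⟩),
    MvPolynomial.ringKrullDim_of_isNoetherianRing, ringKrullDim_eq_zero_of_field, zero_add,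
    Nat.card_eq_fintype_card]

end InvariantsV

/-! ### Cartan subspaces -/

section Cartan

variable {r : ℕ} {V : Type*} [AddCommGroup V] [Module ℂ V] {ι κ : Type*} [Fintype ι] [Fintype κ]
  {ρ : Representation ℂ (Fin r → ℂˣ) V} {m : ι → Fin r → ℤ} {a : κ → ι → ℕ}

/-- The sum of the basis vectors in the `j`-th circuit. -/
def circuitVec (a : κ → ι → ℕ) (b : Module.Basis ι ℂ V) (j : κ) : V :=
  ∑ i, (if a j i = 0 then (0 : ℂ) else 1) • b i

theorem repr_circuitVec {κ : Type*} {a : κ → ι → ℕ} (b : Module.Basis ι ℂ V) (j : κ) (i : ι) :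
    b.repr (circuitVec a b j) i = if a j i = 0 then 0 else 1 := by
  rw [circuitVec, b.repr_sum_self]

theorem repr_sum_circuitVec (b : Module.Basis ι ℂ V) (p : κ → ℂ) (i : ι) :
    b.repr (∑ j, p j • circuitVec a b j) i = ∑ j, if a j i = 0 then 0 else p j := by
  simp only [map_sum, map_smul, Finsupp.coe_finsetSum, Finset.sum_apply, Finsupp.smul_apply,
    repr_circuitVec, smul_eq_mul, mul_ite, mul_zero, mul_one]

theorem mem_span_circuitVec (b : Module.Basis ι ℂ V) (x : V) :
    x ∈ Submodule.span ℂ (Set.range (circuitVec a b)) ↔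
      ∃ p : κ → ℂ, ∀ i, b.repr x i = ∑ j, if a j i = 0 then 0 else p j := by
  rw [Submodule.mem_span_range_iff_exists_fun]
  refine exists_congr fun p => ⟨fun h i => ?_, fun h => ?_⟩
  · rw [← h, repr_sum_circuitVec]
  · refine b.repr.injective (Finsupp.ext fun i => ?_)
    rw [repr_sum_circuitVec, h]

/-! ### Circuit vectors, zero weights and repeated weights. -/

namespace IsCircuitSystem

variable (ha : IsCircuitSystem m a)

include ha

theorem repr_sum_circuitVec_of_ne (b : Module.Basis ι ℂ V) (p : κ → ℂ) {j : κ} {i : ι}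
    (hi : a j i ≠ 0) : b.repr (∑ j, p j • circuitVec a b j) i = p j := by
  rw [repr_sum_circuitVec, ha.sum_eq hi _ (fun j' h => by simp [h]), if_neg hi]

theorem linearIndependent_circuitVec (b : Module.Basis ι ℂ V) :
    LinearIndependent ℂ (circuitVec a b) := by
  rw [Fintype.linearIndependent_iff]
  intro p hp j
  obtain ⟨i, hi⟩ := ha.nonzero j
  rw [← ha.repr_sum_circuitVec_of_ne b p hi, hp]
  simp

/-- A zero weight is a circuit. -/
theorem exists_of_weight_eq_zero {i : ι} (hi : m i = 0) :
    ∃ j, a j i ≠ 0 ∧ ∀ i', i' ≠ i → a j i' = 0 := by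
  classical
  obtain ⟨z, hz⟩ := ha.span (Pi.single i 1) fun l => by
    rw [Fintype.sum_eq_single i fun i' hi' => by simp [Pi.single_eq_of_ne hi']]
    simp [hi]
  have h1 := hz i
  rw [Pi.single_eq_same] at h1
  obtain ⟨j, -, hj⟩ := Finset.exists_ne_zero_of_sum_ne_zero (h1 ▸ one_ne_zero)
  refine ⟨j, right_ne_zero_of_mul hj, fun i' hi' => ?_⟩
  have h2 := hz i'
  rw [Pi.single_eq_of_ne hi'] at h2
  have h3 := (Finset.sum_eq_zero_iff.1 h2.symm) j (Finset.mem_univ j)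
  exact (mul_eq_zero.1 h3).resolve_left (left_ne_zero_of_mul hj)

/-- A basis vector of weight zero forms a circuit by itself, and circuits are disjoint. Thus a
circuit with at least two elements only contains nonzero weights. -/
theorem eq_of_weight_eq_zero {i i' : ι} {j : κ} (hm : m i = 0) (hi : a j i ≠ 0)
    (hi' : a j i' ≠ 0) : i' = i := by
  obtain ⟨j', h1, h2⟩ := ha.exists_of_weight_eq_zero hm
  obtain rfl := ha.disjoint _ _ _ hi h1
  by_contra hne
  exact hi' (h2 i' hne)

/-- Different basis vectors have different weights, unless these are zero. -/
theorem weight_eq_zero_of_eq {i i' : ι} (hne : i ≠ i') (h : m i = m i') : m i = 0 := by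
  classical
  ext l
  have := ha.posPart (Pi.single i 1) (Pi.single i' 1) (fun l => by
    rw [Fintype.sum_eq_single i fun k hk => by simp [Pi.single_eq_of_ne hk],
      Fintype.sum_eq_single i' fun k hk => by simp [Pi.single_eq_of_ne hk]]
    simp [h]) l
  rw [Fintype.sum_eq_single i fun k hk => by simp [Pi.single_eq_of_ne hk]] at this
  simpa [Pi.single_eq_of_ne hne] using this

/-- The weights are integral, so the real part of a complex solution is a solution. -/
theorem exists_weight_eq_real (η : ι → ℝ) (hη : ∀ j, ∑ i, a j i * η i = 0) :
    ∃ u : Fin r → ℝ, ∀ i, ∑ l, m i l * u l = η i := by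
  obtain ⟨ξ, hξ⟩ := ha.exists_weight_eq (fun i => (η i : ℂ)) fun j => by exact_mod_cast hη j
  refine ⟨fun l => (ξ l).re, fun i => ?_⟩
  have := congrArg Complex.re (hξ i)
  rw [Complex.re_sum, Complex.ofReal_re] at this
  rw [← this]
  exact Finset.sum_congr rfl fun l _ => by
    rw [← Complex.ofReal_intCast, Complex.re_ofReal_mul]

end IsCircuitSystem

/-- The flow along `-u` contracts the coordinate `i₀` and fixes the other nonzero ones. Its limit
lies in the closed orbit, but the torus cannot annihilate a nonzero coordinate. -/
theorem IsWeightBasis.repr_eq_zero_of_semisimple {b : Module.Basis ι ℂ V}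
    (hb : IsWeightBasis ρ m b) {v : V} (hv : IsSemisimpleVec ρ v) (i₀ : ι) (u : Fin r → ℝ)
    (h0 : 0 < ∑ l, m i₀ l * u l)
    (h1 : ∀ i ≠ i₀, b.repr v i ≠ 0 → ∑ l, m i l * u l = 0) : b.repr v i₀ = 0 := by
  classical
  have hy : v - b.repr v i₀ • b i₀ ∈ orbit ρ v := by
    rw [← hv]
    refine hb.mem_zariskiClosure _ _ u fun i => ?_
    by_cases hi : i = i₀
    · subst hi
      right; left
      exact ⟨h0, by simp⟩
    · by_cases hvi : b.repr v i = 0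
      · right; right
        simp [hvi, Ne.symm hi]
      · left
        exact ⟨h1 i hi hvi, by simp [Ne.symm hi]⟩
  obtain ⟨t, ht⟩ := hy
  have h2 : b.repr (ρ t v) i₀ = 0 := by
    simp only [ht]
    simp
  rw [hb.repr_apply] at h2
  exact (mul_eq_zero.1 h2).resolve_left (character_ne_zero _ _)

variable (ha : IsCircuitSystem m a)

include ha

/-- An index outside all circuits has a coordinate vector orthogonal to the circuits, so some `u`
contracts this coordinate alone. -/
theorem IsSemisimpleVec.repr_eq_zero {b : Module.Basis ι ℂ V} (hb : IsWeightBasis ρ m b) {v : V}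
    (hv : IsSemisimpleVec ρ v) (i : ι) (hi : ∀ j, a j i = 0) : b.repr v i = 0 := by
  classical
  obtain ⟨u, hu⟩ := ha.exists_weight_eq_real (Pi.single i 1) fun j => by
    rw [Fintype.sum_eq_single i fun k hk => by simp [Pi.single_eq_of_ne hk]]
    simp [hi]
  refine hb.repr_eq_zero_of_semisimple hv i u ?_ fun k hk _ => ?_
  · rw [hu]; simp
  · rw [hu, Pi.single_eq_of_ne hk]

/-- The support of a semisimple vector is a union of circuits. -/
theorem IsSemisimpleVec.repr_eq_zero_of {b : Module.Basis ι ℂ V} (hb : IsWeightBasis ρ m b) {v : V}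
    (hv : IsSemisimpleVec ρ v) {i i' : ι} {j : κ} (hi : a j i ≠ 0) (hi' : a j i' ≠ 0)
    (h : b.repr v i = 0) : b.repr v i' = 0 := by
  classical
  by_cases hne : i = i'
  · exact hne ▸ h
  -- The vector `a j i * e_{i'} - a j i' * e_i` is orthogonal to all circuits. It is positive at
  -- `i'`, and its only other nonzero entry is at `i`, where `v` vanishes.
  obtain ⟨u, hu⟩ := ha.exists_weight_eq_real
    (Pi.single i' (a j i : ℝ) - Pi.single i (a j i' : ℝ)) fun j' => by
      simp only [Pi.sub_apply, mul_sub, Finset.sum_sub_distrib]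
      rw [Fintype.sum_eq_single i' fun k hk => by simp [Pi.single_eq_of_ne hk],
        Fintype.sum_eq_single i fun k hk => by simp [Pi.single_eq_of_ne hk],
        Pi.single_eq_same, Pi.single_eq_same]
      by_cases hj : j' = j
      · subst hj; ring
      · simp [ha.eq_zero_of_ne hi hj, ha.eq_zero_of_ne hi' hj]
  refine hb.repr_eq_zero_of_semisimple hv i' u ?_ fun k hk hvk => ?_
  · rw [hu]
    simpa [Pi.single_eq_of_ne (Ne.symm hne)] using Nat.pos_of_ne_zero hi
  · have hki : k ≠ i := by
      rintro rfl
      exact hvk h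
    rw [hu]
    simp [Pi.single_eq_of_ne hk, Pi.single_eq_of_ne hki]

/-- Each coordinate direction `l` of the Lie algebra gives some `ξ` with `m i l * (xᵢ / vᵢ) = m i
(ξ)` on the circuit. Weighted by `a j i` the right side sums to zero, so `a j i * xᵢ / vᵢ` is a
complex relation supported in the `j`-th circuit and hence a multiple of it. -/
theorem repr_mul_eq_of_tangent_subset {b : Module.Basis ι ℂ V} (hb : IsWeightBasis ρ m b) {v x : V}
    (hx : tangent ρ x ⊆ tangent ρ v) {j : κ} (hv : ∀ i, a j i ≠ 0 → b.repr v i ≠ 0) :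
    ∃ z : ℂ, ∀ i, a j i ≠ 0 → b.repr x i = z * b.repr v i := by
  classical
  obtain ⟨z, hz⟩ := ha.complex_span (fun i => a j i * (b.repr x i / b.repr v i)) fun l => by
    have h1 : ∑ i, ((m i l : ℂ) * b.repr x i) • b i ∈ tangent ρ x := by
      refine (hb.mem_tangent _ _).2 ⟨Pi.single l 1, fun i => ?_⟩
      rw [b.repr_sum_self]
      congr 1
      rw [Fintype.sum_eq_single l fun k hk => by simp [Pi.single_eq_of_ne hk]]
      simp
    obtain ⟨ξ, hξ⟩ := (hb.mem_tangent _ _).1 (hx h1)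
    simp only [b.repr_sum_self] at hξ
    have h2 (i : ι) : (a j i : ℂ) * (b.repr x i / b.repr v i) * m i l =
        a j i * ∑ l, m i l * ξ l := by
      by_cases hi : a j i = 0
      · simp [hi]
      · have := hv i hi
        have h3 := hξ i
        field_simp
        linear_combination h3
    simp only [h2, Finset.mul_sum]
    rw [Finset.sum_comm]
    refine Finset.sum_eq_zero fun l _ => ?_
    simp only [← mul_assoc, ← Finset.sum_mul]
    have h3 : ∑ i, (a j i : ℂ) * m i l = 0 := by exact_mod_cast ha.relation j l
    rw [h3, zero_mul]
  refine ⟨z j, fun i hi => ?_⟩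
  have h1 := hz i
  rw [ha.sum_eq hi _ (fun j' h => by simp [h])] at h1
  have h2 : (a j i : ℂ) ≠ 0 := by exact_mod_cast hi
  have h3 := hv i hi
  field_simp at h1
  linear_combination h1

/-- Every Cartan subspace is spanned by the circuit vectors of a weight basis. -/
theorem IsCartanSubspace.exists_isWeightBasis [FiniteDimensional ℂ V] {b : Module.Basis ι ℂ V}
    (hb : IsWeightBasis ρ m b) {c : Submodule ℂ V} (hc : IsCartanSubspace ρ c) :
    ∃ b' : Module.Basis ι ℂ V, IsWeightBasis ρ m b' ∧
      c = Submodule.span ℂ (Set.range (circuitVec a b')) := by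
  obtain ⟨v, hv, hcv, hdim⟩ := hc
  -- Rescaling makes every coordinate of `v` equal to `0` or `1`; the factor `1` keeps the basis
  -- vectors on which `v` vanishes.
  let w : ι → ℂ := fun i => if b.repr v i = 0 then 1 else b.repr v i
  have hw (i : ι) : w i ≠ 0 := by
    simp only [w]
    split_ifs with h
    · exact one_ne_zero
    · exact h
  let b' := b.isUnitSMul fun i => isUnit_iff_ne_zero.2 (hw i)
  have hb'i (i : ι) : b' i = w i • b i := b.isUnitSMul_apply _ i
  have hrepr (x : V) (i : ι) : b.repr x i = w i * b'.repr x i := by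
    classical
    conv_lhs => rw [← b'.sum_repr x]
    simp only [hb'i, map_sum, map_smul, Finsupp.coe_finsetSum, Finset.sum_apply,
      Finsupp.smul_apply, Module.Basis.repr_self, Finsupp.single_apply, smul_eq_mul]
    simp [mul_comm]
  refine ⟨b', fun t i => ?_, Submodule.eq_of_le_of_finrank_le (fun x hx => ?_) ?_⟩
  · rw [hb'i, map_smul, hb t, smul_comm]
  · have hx : tangent ρ x ⊆ tangent ρ v := by
      have : x ∈ (c : Set V) := hx
      rwa [hcv] at this
    have key (j : κ) : ∃ z : ℂ, ∀ i, a j i ≠ 0 → b'.repr x i = z := by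
      by_cases hj : ∀ i, a j i ≠ 0 → b.repr v i ≠ 0
      · obtain ⟨z, hz⟩ := repr_mul_eq_of_tangent_subset ha hb hx hj
        refine ⟨z, fun i hi => ?_⟩
        have h1 := hz i hi
        have h2 : w i = b.repr v i := if_neg (hj i hi)
        rw [hrepr, mul_comm, h2] at h1
        exact mul_right_cancel₀ (hj i hi) h1
      -- If `v` vanishes somewhere on the circuit, it vanishes on all of it. Two different elements
      -- of the circuit have nonzero weights, so `x` vanishes there as well; a circuit with one
      -- element imposes no condition.
      · push Not at hj
        obtain ⟨i₀, hi₀, hv₀⟩ := hj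
        refine ⟨b'.repr x i₀, fun i hi => ?_⟩
        by_cases hne : i = i₀
        · rw [hne]
        have hm : m i ≠ 0 := fun h0 => hne (ha.eq_of_weight_eq_zero h0 hi hi₀).symm
        have hm₀ : m i₀ ≠ 0 := fun h0 => hne (ha.eq_of_weight_eq_zero h0 hi₀ hi)
        have h1 := hb.repr_eq_zero_of_tangent_subset hx hm
          (IsSemisimpleVec.repr_eq_zero_of ha hb hv hi₀ hi hv₀)
        have h2 := hb.repr_eq_zero_of_tangent_subset hx hm₀ hv₀
        rw [hrepr] at h1 h2
        rw [(mul_eq_zero.1 h1).resolve_left (hw i), (mul_eq_zero.1 h2).resolve_left (hw i₀)]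
    choose z hz using key
    refine (mem_span_circuitVec b' x).2 ⟨z, fun i => ?_⟩
    by_cases hi : ∀ j, a j i = 0
    · simp only [hi, if_true, Finset.sum_const_zero]
      have hm : m i ≠ 0 := fun h0 => by
        obtain ⟨j, hj, -⟩ := ha.exists_of_weight_eq_zero h0
        exact hj (hi j)
      have h1 := hb.repr_eq_zero_of_tangent_subset hx hm
        (IsSemisimpleVec.repr_eq_zero ha hb hv i hi)
      rw [hrepr] at h1
      exact (mul_eq_zero.1 h1).resolve_left (hw i)
    · push Not at hi
      obtain ⟨j, hj⟩ := hi
      rw [ha.sum_eq hj _ (fun j' h => by simp [h]), if_neg hj, hz j i hj]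
  -- The dimension required of a Cartan subspace is the number of circuits, so the inclusion in the
  -- span of the circuit vectors is an equality.
  · rw [ringKrullDim_invariants ha hb] at hdim
    have : Module.finrank ℂ c = Fintype.card κ := by exact_mod_cast hdim
    rw [this]
    exact finrank_range_le_card _

/-- The span of the circuit vectors of a weight basis is a Cartan subspace. -/
theorem isCartanSubspace_span {b : Module.Basis ι ℂ V} (hb : IsWeightBasis ρ m b) :
    IsCartanSubspace ρ (Submodule.span ℂ (Set.range (circuitVec a b))) := by
  classical
  let v : V := ∑ j, (1 : ℂ) • circuitVec a b j
  have hv1 {j : κ} {i : ι} (hi : a j i ≠ 0) : b.repr v i = 1 :=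
    ha.repr_sum_circuitVec_of_ne b _ hi
  have hv0 {i : ι} (hi : ∀ j, a j i = 0) : b.repr v i = 0 := by
    simp only [v]
    rw [repr_sum_circuitVec]
    simp [hi]
  -- On the closure of the orbit the coordinates off the circuits are `0` and the circuit monomials
  -- are `1`. The second condition is precisely the one for the remaining coordinates to be the
  -- values of the characters at a torus element.
  have hss : IsSemisimpleVec ρ v := by
    refine Set.Subset.antisymm (fun x hx => ?_) fun x hx f hf => hf x hx
    have hx0 (i : ι) (hi : ∀ j, a j i = 0) : b.repr x i = 0 := by
      refine hx (linPoly (b.coord i)) ?_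
      rintro _ ⟨t, rfl⟩
      change b.repr _ i = 0
      rw [hb.repr_apply, hv0 hi, mul_zero]
    have hx1 (j : κ) : ∏ i, b.repr x i ^ a j i = 1 := by
      have h1 : evalAt x (mono b (a j) - 1) = 0 := by
        refine hx (mono b (a j) - 1) ?_
        rintro _ ⟨t, rfl⟩
        have h2 := mono_circuit_mem ha hb j t v
        change evalAt (ρ t v) (mono b (a j) - 1) = 0
        rw [map_sub, map_one, sub_eq_zero]
        refine h2.trans ?_
        change evalAt v (mono b (a j)) = 1
        rw [evalAt_mono]
        refine Finset.prod_eq_one fun i _ => ?_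
        by_cases hi : a j i = 0
        · simp [hi]
        · rw [hv1 hi, one_pow]
      rwa [map_sub, map_one, sub_eq_zero, evalAt_mono] at h1
    -- Off the circuits the prescribed value `1` is an arbitrary nonzero choice, since `v` and `x`
    -- both vanish there.
    obtain ⟨t, ht⟩ := ha.exists_character_eq
      (fun i => if ∀ j, a j i = 0 then 1 else b.repr x i) (fun i => by
        split_ifs with hi
        · exact one_ne_zero
        · push Not at hi
          obtain ⟨j, hj⟩ := hi
          intro h0
          have := hx1 j
          rw [Finset.prod_eq_zero (Finset.mem_univ i) (by rw [h0, zero_pow hj])] at this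
          exact zero_ne_one this) (fun j => by
        rw [← hx1 j]
        refine Finset.prod_congr rfl fun i _ => ?_
        by_cases hi : a j i = 0
        · simp [hi]
        · rw [if_neg fun h => hi (h j)])
    refine ⟨t, b.repr.injective (Finsupp.ext fun i => ?_)⟩
    rw [hb.repr_apply, ht]
    by_cases hi : ∀ j, a j i = 0
    · rw [hv0 hi, hx0 i hi, mul_zero]
    · rw [if_neg hi]
      push Not at hi
      obtain ⟨j, hj⟩ := hi
      rw [hv1 hj, mul_one]
  refine ⟨v, hss, ?_, ?_⟩
  · ext x
    constructor
    · intro hx y hy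
      obtain ⟨p, hp⟩ := (mem_span_circuitVec b x).1 hx
      obtain ⟨ξ, hξ⟩ := (hb.mem_tangent _ _).1 hy
      -- As `x` has the constant coordinate `p j` on the `j`-th circuit, the vector `ξ · x` is
      -- orthogonal to the circuits and so comes from some `ξ'` acting on `v`.
      obtain ⟨ξ', hξ'⟩ := ha.exists_weight_eq (fun i => b.repr y i) fun j => by
        have h1 (i : ι) : (a j i : ℂ) * b.repr y i = ∑ l, p j * (a j i * m i l) * ξ l := by
          by_cases hi : a j i = 0
          · simp [hi]
          · rw [hξ, hp, ha.sum_eq hi _ (fun j' h => by simp [h]), if_neg hi, Finset.sum_mul,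
              Finset.mul_sum]
            exact Finset.sum_congr rfl fun l _ => by ring
        simp only [h1]
        rw [Finset.sum_comm]
        refine Finset.sum_eq_zero fun l _ => ?_
        rw [← Finset.sum_mul, ← Finset.mul_sum]
        have h3 : ∑ i, (a j i : ℂ) * m i l = 0 := by exact_mod_cast ha.relation j l
        rw [h3, mul_zero, zero_mul]
      refine (hb.mem_tangent _ _).2 ⟨ξ', fun i => ?_⟩
      rw [hξ']
      by_cases hi : ∀ j, a j i = 0
      · rw [hv0 hi, hξ, hp]
        simp [hi]
      · push Not at hi
        obtain ⟨j, hj⟩ := hi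
        rw [hv1 hj, mul_one]
    · intro hx
      have key (j : κ) := repr_mul_eq_of_tangent_subset ha hb (j := j) hx fun i hi => by
        rw [hv1 hi]; exact one_ne_zero
      choose z hz using key
      refine (mem_span_circuitVec b x).2 ⟨z, fun i => ?_⟩
      by_cases hi : ∀ j, a j i = 0
      · simp only [hi, if_true, Finset.sum_const_zero]
        have hm : m i ≠ 0 := fun h0 => by
          obtain ⟨j, hj, -⟩ := ha.exists_of_weight_eq_zero h0
          exact hj (hi j)
        exact hb.repr_eq_zero_of_tangent_subset hx hm (hv0 hi)
      · push Not at hi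
        obtain ⟨j, hj⟩ := hi
        rw [ha.sum_eq hj _ (fun j' h => by simp [h]), if_neg hj, hz j i hj, hv1 hj, mul_one]
  · rw [ringKrullDim_invariants ha hb, finrank_span_eq_card (ha.linearIndependent_circuitVec b)]

end Cartan

/-! ### Dual Cartan subspaces -/

section Dual

variable {r : ℕ} {V : Type*} [AddCommGroup V] [Module ℂ V] {ι κ : Type*} [Fintype ι] [Fintype κ]
  {ρ : Representation ℂ (Fin r → ℂˣ) V} {m : ι → Fin r → ℤ} {a : κ → ι → ℕ}
  {b : Module.Basis ι ℂ V}

/-- The linear form whose coefficients are the entries of the `j`-th circuit. -/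
def circuitForm {κ : Type*} (a : κ → ι → ℕ) (b : Module.Basis ι ℂ V) (j : κ) : Module.Dual ℂ V :=
  ∑ i, (a j i : ℂ) • b.coord i

theorem circuitForm_apply {κ : Type*} {a : κ → ι → ℕ} (j : κ) (x : V) :
    circuitForm a b j x = ∑ i, a j i * b.repr x i := by
  simp [circuitForm, LinearMap.sum_apply]

theorem circuitForm_basis {κ : Type*} {a : κ → ι → ℕ} (j : κ) (i : ι) :
    circuitForm a b j (b i) = a j i := by
  classical
  rw [circuitForm_apply]
  simp [Finsupp.single_apply]

/-- The Hermitian form with an orthogonal basis `b` and lengths `α`. -/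
def diagHermitian (b : Module.Basis ι ℂ V) (α : ι → ℝ) : V →ₗ⋆[ℂ] Module.Dual ℂ V where
  toFun x := ∑ i, ((α i : ℂ) * starRingEnd ℂ (b.repr x i)) • b.coord i
  map_add' x y := by
    simp only [map_add, Finsupp.add_apply, mul_add, add_smul, Finset.sum_add_distrib]
  map_smul' s x := by
    simp only [map_smul, Finsupp.smul_apply, smul_eq_mul, map_mul, Finset.smul_sum, smul_smul]
    exact Finset.sum_congr rfl fun i _ => by ring_nf

theorem diagHermitian_apply (α : ι → ℝ) (x y : V) :
    diagHermitian b α x y = ∑ i, α i * (starRingEnd ℂ (b.repr x i) * b.repr y i) := by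
  simp [diagHermitian, LinearMap.sum_apply, mul_assoc]

theorem diagHermitian_self_re (α : ι → ℝ) (x : V) :
    (diagHermitian b α x x).re = ∑ i, α i * ‖b.repr x i‖ ^ 2 := by
  rw [diagHermitian_apply, Complex.re_sum]
  refine Finset.sum_congr rfl fun i _ => ?_
  rw [Complex.re_ofReal_mul, mul_comm (starRingEnd ℂ _), Complex.mul_conj, Complex.ofReal_re,
    Complex.normSq_eq_norm_sq]

theorem norm_character_of_norm_eq_one (n : Fin r → ℤ) (t : Fin r → ℂˣ)
    (ht : ∀ j, ‖(t j : ℂ)‖ = 1) : ‖character n t‖ = 1 := by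
  simp [character, ht]

theorem IsWeightBasis.isCompactInvariantHermitian (hb : IsWeightBasis ρ m b) (α : ι → ℝ)
    (hα : ∀ i, 0 < α i) : IsCompactInvariantHermitian ρ (diagHermitian b α) where
  conj_symm x y := by
    rw [diagHermitian_apply, diagHermitian_apply, map_sum]
    refine Finset.sum_congr rfl fun i _ => ?_
    simp only [map_mul, Complex.conj_conj, Complex.conj_ofReal]
    ring
  pos x hx := by
    rw [diagHermitian_self_re]
    obtain ⟨i, hi⟩ : ∃ i, b.repr x i ≠ 0 := by
      by_contra! h0
      exact hx (b.repr.map_eq_zero_iff.1 (Finsupp.ext h0))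
    exact Finset.sum_pos' (fun i _ => mul_nonneg (hα i).le (sq_nonneg _))
      ⟨i, Finset.mem_univ i, mul_pos (hα i) (pow_pos (norm_pos_iff.2 hi) 2)⟩
  invariant t ht x y := by
    rw [diagHermitian_apply, diagHermitian_apply]
    refine Finset.sum_congr rfl fun i _ => ?_
    rw [hb.repr_apply, hb.repr_apply, map_mul]
    have h1 : starRingEnd ℂ (character (m i) t) * character (m i) t = 1 := by
      rw [mul_comm, Complex.mul_conj, Complex.normSq_eq_norm_sq,
        norm_character_of_norm_eq_one _ _ ht]
      simp
    linear_combination (α i : ℂ) * starRingEnd ℂ (b.repr x i) * b.repr y i * h1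

/-- Take the given basis as orthogonal, with squared length `a j i` on the `j`-th circuit. For `x`
in the span of the circuit vectors, `α i * ‖xᵢ‖ ^ 2` is then a combination of circuits, so the first
variation of the length along the orbit is zero; convexity in the form `1 + s ≤ exp s` makes `x` a
global minimum. -/
theorem exists_isDualCartanPair (ha : IsCircuitSystem m a) (hb : IsWeightBasis ρ m b) :
    ∃ cd, IsDualCartanPair ρ (Submodule.span ℂ (Set.range (circuitVec a b))) cd := by
  classical
  let α : ι → ℝ := fun i => if ∀ j, a j i = 0 then 1 else ∑ j, (a j i : ℝ)
  have hα1 {j : κ} {i : ι} (hi : a j i ≠ 0) : α i = a j i := by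
    simp only [α]
    rw [if_neg fun h => hi (h j), ha.sum_eq hi _ fun j' h => by simp [h]]
  have hα (i : ι) : 0 < α i := by
    by_cases hi : ∀ j, a j i = 0
    · simp [α, hi]
    · push Not at hi
      obtain ⟨j, hj⟩ := hi
      rw [hα1 hj]
      exact_mod_cast Nat.pos_of_ne_zero hj
  refine ⟨(Submodule.span ℂ (Set.range (circuitVec a b))).map (diagHermitian b α),
    isCartanSubspace_span ha hb, diagHermitian b α, hb.isCompactInvariantHermitian α hα,
    fun x hx t => ?_, rfl⟩
  obtain ⟨p, hp⟩ := (mem_span_circuitVec b x).1 hx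
  rw [diagHermitian_self_re, diagHermitian_self_re]
  let s : ι → ℝ := fun i => Real.log ‖character (m i) t‖
  have hs (i : ι) : ‖character (m i) t‖ = Real.exp (s i) :=
    (Real.exp_log (norm_pos_iff.2 (character_ne_zero _ _))).symm
  have hrel (j : κ) : ∑ i, a j i * s i = 0 := by
    simp only [s, log_norm_character, Finset.mul_sum]
    rw [Finset.sum_comm]
    refine Finset.sum_eq_zero fun l _ => ?_
    simp only [← mul_assoc]
    rw [← Finset.sum_mul]
    have h3 : ∑ i, (a j i : ℝ) * m i l = 0 := by exact_mod_cast ha.relation j l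
    rw [h3, zero_mul]
  have hx2 (i : ι) : α i * ‖b.repr x i‖ ^ 2 = ∑ j, a j i * ‖p j‖ ^ 2 := by
    by_cases hi : ∀ j, a j i = 0
    · rw [hp]
      simp [hi]
    · push Not at hi
      obtain ⟨j, hj⟩ := hi
      rw [hp, ha.sum_eq hj _ (fun j' h => by simp [h]), ha.sum_eq hj _ (fun j' h => by simp [h]),
        if_neg hj, hα1 hj]
  have h0 : ∑ i, (2 * s i) * (α i * ‖b.repr x i‖ ^ 2) = 0 := by
    simp only [hx2, Finset.mul_sum]
    rw [Finset.sum_comm]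
    refine Finset.sum_eq_zero fun j _ => ?_
    have : ∀ i, 2 * s i * (a j i * ‖p j‖ ^ 2) = 2 * ‖p j‖ ^ 2 * (a j i * s i) := fun i => by ring
    simp only [this, ← Finset.mul_sum, hrel, mul_zero]
  calc ∑ i, α i * ‖b.repr x i‖ ^ 2
      = ∑ i, (1 + 2 * s i) * (α i * ‖b.repr x i‖ ^ 2) := by
        simp only [add_mul, one_mul, Finset.sum_add_distrib, h0, add_zero]
    _ ≤ ∑ i, α i * ‖b.repr (ρ t x) i‖ ^ 2 := by
        refine Finset.sum_le_sum fun i _ => ?_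
        rw [hb.repr_apply, norm_mul, hs, mul_pow, ← Real.exp_nat_mul]
        have h1 := Real.add_one_le_exp ((2 : ℕ) * s i)
        have h2 : 0 ≤ α i * ‖b.repr x i‖ ^ 2 := mul_nonneg (hα i).le (sq_nonneg _)
        push_cast at h1 ⊢
        nlinarith

/-- Vectors of different weights are orthogonal for an invariant Hermitian inner product. -/
theorem IsWeightBasis.hermitian_eq_zero {ι : Type*} {m : ι → Fin r → ℤ}
    {b : Module.Basis ι ℂ V} (hb : IsWeightBasis ρ m b) {h : V →ₗ⋆[ℂ] Module.Dual ℂ V}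
    (hh : IsCompactInvariantHermitian ρ h) {i i' : ι} (hne : m i ≠ m i') : h (b i) (b i') = 0 := by
  obtain ⟨l, hl⟩ := Function.ne_iff.1 hne
  -- The compact torus element with angle one radian in the coordinate `l`. If the two characters
  -- agreed on it, the nonzero integer `m i' l - m i l` would be an integral multiple of `2π`, and
  -- `π` would be rational.
  let t : Fin r → ℂˣ := torusExp (Pi.single l (((1 : ℝ) : ℂ) * Complex.I))
  have ht (j : Fin r) : ‖(t j : ℂ)‖ = 1 := by
    simp only [t, torusExp, Units.val_mk0]
    by_cases hj : j = l
    · subst hj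
      rw [Pi.single_eq_same, Complex.norm_exp_ofReal_mul_I]
    · simp [Pi.single_eq_of_ne hj]
  have hch (n : Fin r → ℤ) : character n t = Complex.exp (n l * Complex.I) := by
    rw [character_torusExp, Fintype.sum_eq_single l fun k hk => by simp [Pi.single_eq_of_ne hk],
      Pi.single_eq_same]
    simp
  have h1 := hh.invariant t ht (b i) (b i')
  rw [hb, hb, map_smul, LinearMap.map_smulₛₗ, LinearMap.smul_apply, smul_smul, smul_eq_mul, hch,
    hch, ← Complex.exp_conj, ← Complex.exp_add] at h1
  by_contra h0
  have h2 := mul_eq_right₀ h0 |>.1 h1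
  rw [Complex.exp_eq_one_iff] at h2
  obtain ⟨k, hk⟩ := h2
  have h3 : ((m i' l - m i l : ℤ) : ℂ) = ((k * (2 * Real.pi) : ℝ) : ℂ) := by
    apply mul_right_cancel₀ Complex.I_ne_zero
    simp only [map_mul, Complex.conj_I, map_intCast] at hk
    push_cast
    linear_combination hk
  have h4 : ((m i' l - m i l : ℤ) : ℝ) = k * (2 * Real.pi) := by exact_mod_cast h3
  have hk0 : k ≠ 0 := by
    rintro rfl
    rw [Int.cast_zero, zero_mul] at h4
    exact hl (sub_eq_zero.1 (by exact_mod_cast h4)).symm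
  refine irrational_pi ⟨(m i' l - m i l : ℤ) / (2 * k), ?_⟩
  have : (k : ℝ) ≠ 0 := by exact_mod_cast hk0
  push_cast at h4 ⊢
  field_simp
  linear_combination h4

/-- The dual of the Cartan subspace that is spanned by the circuit vectors is spanned by the
circuit forms. -/
theorem IsDualCartanPair.eq_span [FiniteDimensional ℂ V] (ha : IsCircuitSystem m a)
    (hb : IsWeightBasis ρ m b) {c : Submodule ℂ V} {cd : Submodule ℂ (Module.Dual ℂ V)}
    (hd : IsDualCartanPair ρ c cd) (hc : c = Submodule.span ℂ (Set.range (circuitVec a b))) :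
    cd = Submodule.span ℂ (Set.range (circuitForm a b)) := by
  classical
  have hrank : Module.finrank ℂ cd = Fintype.card κ := by
    rw [(dualEquiv hd).finrank_eq, Subspace.dual_finrank_eq, hc,
      finrank_span_eq_card (ha.linearIndependent_circuitVec b)]
  -- The duality `𝔠^∨ ≅ 𝔠*` fixes the dimension, so one inclusion suffices.
  refine Submodule.eq_of_le_of_finrank_le ?_ (hrank ▸ finrank_range_le_card _)
  obtain ⟨h, hh, hmin, hcd⟩ := hd.exists_hermitian
  suffices H : c ≤ (Submodule.span ℂ (Set.range (circuitForm a b))).comap h by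
    intro φ hφ
    obtain ⟨x, hx, rfl⟩ : φ ∈ h '' (c : Set V) := hcd ▸ hφ
    exact H hx
  conv_lhs => rw [hc]
  refine Submodule.span_le.2 ?_
  rintro _ ⟨j, rfl⟩
  change h (circuitVec a b j) ∈ Submodule.span ℂ (Set.range (circuitForm a b))
  have hmem : circuitVec a b j ∈ c := hc ▸ Submodule.subset_span ⟨j, rfl⟩
  have horth {i i' : ι} (hi : a j i ≠ 0) (hi' : a j i' ≠ 0) (hne : i ≠ i') :
      h (b i) (b i') = 0 := by
    refine hb.hermitian_eq_zero hh fun hm => hne ?_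
    exact (ha.eq_of_weight_eq_zero (ha.weight_eq_zero_of_eq hne hm) hi hi').symm
  let H : ι → ℝ := fun i => if a j i = 0 then 0 else (h (b i) (b i)).re
  have hHre (i : ι) : ((h (b i) (b i)).re : ℂ) = h (b i) (b i) :=
    Complex.conj_eq_iff_re.1 (hh.conj_symm _ _)
  -- the length of `exp(u) · e_j`
  have hlen (u : Fin r → ℝ) (s : ℝ) :
      (h (ρ (torusExp fun l => ((s * u l : ℝ) : ℂ)) (circuitVec a b j))
        (ρ (torusExp fun l => ((s * u l : ℝ) : ℂ)) (circuitVec a b j))).re =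
      ∑ i, H i * Real.exp (s * (2 * ∑ l, m i l * u l)) := by
    have hch (i : ι) : character (m i) (torusExp fun l => ((s * u l : ℝ) : ℂ)) =
        ((Real.exp (s * ∑ l, m i l * u l) : ℝ) : ℂ) := by
      rw [character_torusExp]
      push_cast
      congr 1
      rw [Finset.mul_sum]
      exact Finset.sum_congr rfl fun l _ => by ring
    simp only [circuitVec, map_sum, map_smul, hb _ _, hch]
    rw [Complex.re_sum]
    refine Finset.sum_congr rfl fun i _ => ?_
    by_cases hi : a j i = 0
    · simp [H, hi]
    · rw [LinearMap.sum_apply, Fintype.sum_eq_single i fun i' hne => ?_]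
      · simp only [H, if_neg hi, one_smul, map_smulₛₗ, LinearMap.smul_apply, smul_eq_mul,
          Complex.conj_ofReal]
        rw [← hHre i]
        have : Real.exp (s * (2 * ∑ l, m i l * u l)) =
            Real.exp (s * ∑ l, m i l * u l) * Real.exp (s * ∑ l, m i l * u l) := by
          rw [← Real.exp_add]
          congr 1; ring
        rw [this]
        norm_cast
        ring
      · by_cases hi' : a j i' = 0
        · simp [hi']
        · simp only [if_neg hi', one_smul, map_smulₛₗ, LinearMap.smul_apply,
            horth hi' hi hne, smul_zero]
  -- The length along `exp (s * u) · e_j` has its minimum at `s = 0`, and the vanishing derivative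
  -- says that the squared lengths `H` form a relation of the weights.
  have hcrit (l : Fin r) : ∑ i, H i * m i l = 0 := by
    let u : Fin r → ℝ := Pi.single l 1
    have hu (i : ι) : ∑ l, (m i l : ℝ) * u l = m i l := by
      rw [Fintype.sum_eq_single l fun k hk => by simp [u, Pi.single_eq_of_ne hk]]
      simp [u]
    have hder : HasDerivAt (fun s : ℝ => ∑ i, H i * Real.exp (s * (2 * ∑ l, m i l * u l)))
        (∑ i, H i * (2 * m i l)) 0 := by
      refine HasDerivAt.fun_sum fun i _ => ?_
      rw [hu]
      have := ((hasDerivAt_id (0 : ℝ)).mul_const (2 * (m i l : ℝ))).exp.const_mul (H i)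
      simpa using this
    have hloc : IsLocalMin (fun s : ℝ => ∑ i, H i * Real.exp (s * (2 * ∑ l, m i l * u l))) 0 := by
      refine Filter.Eventually.of_forall fun s => ?_
      simp only [← hlen u]
      have h1 : (torusExp fun l => (((0 : ℝ) * u l : ℝ) : ℂ)) = 1 := by
        ext k
        simp [torusExp]
      rw [h1, map_one, Module.End.one_apply]
      exact hmin _ hmem _
    have h0 := hloc.hasDerivAt_eq_zero hder
    have h1 : ∑ i, H i * (2 * m i l) = 2 * ∑ i, H i * m i l := by
      rw [Finset.mul_sum]
      exact Finset.sum_congr rfl fun i _ => by ring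
    linarith
  -- Different vectors of weight zero need not be orthogonal, so the coefficients of the form agree
  -- with `H` only after multiplication by `m i l`. This suffices for them to be a relation.
  have hφ (i : ι) (l : Fin r) : h (circuitVec a b j) (b i) * m i l = H i * m i l := by
    rw [circuitVec, map_sum, LinearMap.sum_apply]
    by_cases hi : a j i = 0
    · by_cases hm : m i = 0
      · simp [hm]
      rw [Finset.sum_eq_zero fun i' _ => ?_]
      · simp [H, hi]
      · by_cases hi' : a j i' = 0
        · simp [hi']
        · have hne : i' ≠ i := by
            rintro rfl
            exact hi' hi
          have := hb.hermitian_eq_zero hh (i := i') (i' := i) fun h0 =>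
            hm (h0 ▸ ha.weight_eq_zero_of_eq hne h0)
          simp [hi', this]
    · rw [Fintype.sum_eq_single i fun i' hne => ?_]
      · simp [H, hi, hHre]
      · by_cases hi' : a j i' = 0
        · simp [hi']
        · simp [hi', horth hi' hi hne]
  obtain ⟨z, hz⟩ := ha.complex_span (fun i => h (circuitVec a b j) (b i)) fun l => by
    simp only [hφ]
    exact_mod_cast hcrit l
  have hfin : h (circuitVec a b j) = ∑ j', z j' • circuitForm a b j' := by
    refine b.ext fun i => ?_
    rw [hz]
    simp [LinearMap.sum_apply, circuitForm_basis]
  rw [hfin]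
  exact Submodule.sum_mem _ fun j' _ => Submodule.smul_mem _ _ (Submodule.subset_span ⟨j', rfl⟩)

end Dual

/-! ### Invariant functions on the cotangent representation -/

section CotangentCoordinates

variable {r : ℕ} {V : Type*} [AddCommGroup V] [Module ℂ V] {ι κ : Type*} [Fintype ι]
  {ρ : Representation ℂ (Fin r → ℂˣ) V} {m : ι → Fin r → ℤ}

/-- The linear coordinates on `V`, as functions on `V ⊕ V*`. -/
def xForm (b : Module.Basis ι ℂ V) (i : ι) : Module.Dual ℂ (V × Module.Dual ℂ V) :=
  (b.coord i).comp (LinearMap.fst ℂ V (Module.Dual ℂ V))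

/-- The linear coordinates on `V*`, as functions on `V ⊕ V*`. -/
def yForm (b : Module.Basis ι ℂ V) (i : ι) : Module.Dual ℂ (V × Module.Dual ℂ V) :=
  (Module.Dual.eval ℂ V (b i)).comp (LinearMap.snd ℂ V (Module.Dual ℂ V))

@[simp] theorem xForm_apply {ι : Type*} (b : Module.Basis ι ℂ V) (i : ι) (p : V × Module.Dual ℂ V) :
    xForm b i p = b.repr p.1 i := rfl

@[simp] theorem yForm_apply {ι : Type*} (b : Module.Basis ι ℂ V) (i : ι) (p : V × Module.Dual ℂ V) :
    yForm b i p = p.2 (b i) := rfl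

open Classical in
/-- The basis of `V ⊕ V*` that consists of a basis of `V` and its dual basis. -/
def cotangentBasis (b : Module.Basis ι ℂ V) : Module.Basis (ι ⊕ ι) ℂ (V × Module.Dual ℂ V) :=
  b.prod b.dualBasis

theorem coord_cotangentBasis_inl (b : Module.Basis ι ℂ V) (i : ι) :
    (cotangentBasis b).coord (Sum.inl i) = xForm b i := by
  ext p <;> simp [cotangentBasis]

theorem coord_cotangentBasis_inr (b : Module.Basis ι ℂ V) (i : ι) :
    (cotangentBasis b).coord (Sum.inr i) = yForm b i := by
  classical
  refine LinearMap.ext fun p => ?_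
  simp [cotangentBasis]

theorem mono_cotangentBasis (b : Module.Basis ι ℂ V) (e : ι ⊕ ι → ℕ) :
    mono (cotangentBasis b) e = (∏ i, linPoly (xForm b i) ^ e (Sum.inl i)) *
      ∏ i, linPoly (yForm b i) ^ e (Sum.inr i) := by
  rw [mono, Fintype.prod_sum_type]
  simp only [coord_cotangentBasis_inl, coord_cotangentBasis_inr]

theorem IsWeightBasis.cotangent {b : Module.Basis ι ℂ V} (hb : IsWeightBasis ρ m b) :
    IsWeightBasis (cotangent ρ) (Sum.elim m (-m)) (cotangentBasis b) := by
  classical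
  rintro t (i | i)
  · simp [cotangentBasis, hb t i]
  · have h1 : ρ.dual t (b.dualBasis i) = character (m i) t⁻¹ • b.dualBasis i := by
      refine b.ext fun k => ?_
      rw [Representation.dual_apply, Module.Dual.transpose_apply, LinearMap.comp_apply, hb]
      by_cases hk : k = i
      · subst hk; simp
      · simp [hk]
    have h2 : cotangentBasis b (Sum.inr i) = (0, b.dualBasis i) := by
      rw [cotangentBasis]
      exact Prod.ext (b.prod_apply_inr_fst _ i) (b.prod_apply_inr_snd _ i)
    rw [Sum.elim_inr, Pi.neg_apply, character_neg, h2]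
    exact Prod.ext (by simp) h1

theorem invariant_iff_of_mono (e : ι ⊕ ι → ℕ) :
    character (∑ s, e s • (Sum.elim m (-m) : ι ⊕ ι → Fin r → ℤ) s) = 1 ↔
      ∀ l, ∑ i, (e (Sum.inl i) : ℤ) * m i l = ∑ i, (e (Sum.inr i) : ℤ) * m i l := by
  rw [← character_zero, character_injective.eq_iff, funext_iff]
  refine forall_congr' fun l => ?_
  rw [Fintype.sum_sum_type, ← sub_eq_zero (b := ∑ i, _)]
  simp [Finset.sum_apply, sub_eq_add_neg]

theorem IsWeightBasis.sum_mem_momentIdeal {b : Module.Basis ι ℂ V} (hb : IsWeightBasis ρ m b)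
    (ξ : Fin r → ℂ) :
    ∑ i, (∑ l, m i l * ξ l) • (linPoly (xForm b i) * linPoly (yForm b i)) ∈ momentIdeal ρ := by
  refine Ideal.subset_span ⟨ξ, fun p => ?_⟩
  rw [hb.moment_eq]
  change evalAt p _ = _
  simp

end CotangentCoordinates

/-! ### Generators of the invariants modulo the moment ideal. -/

section Generators

variable {r : ℕ} {V : Type*} [AddCommGroup V] [Module ℂ V] {ι κ : Type*} [Fintype ι]
  {ρ : Representation ℂ (Fin r → ℂˣ) V} {m : ι → Fin r → ℤ} {a : κ → ι → ℕ}

/-- The size of a circuit. -/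
def circuitSize (a : κ → ι → ℕ) (j : κ) : ℕ := ∑ i, a j i

/-- The quadratic invariant `N⁻¹ ∑ xᵢ yᵢ` of a circuit. -/
def sPoly (a : κ → ι → ℕ) (b : Module.Basis ι ℂ V) (j : κ) : Poly (V × Module.Dual ℂ V) :=
  ∑ i, (if a j i = 0 then (0 : ℂ) else (circuitSize a j : ℂ)⁻¹) •
    (linPoly (xForm b i) * linPoly (yForm b i))

/-- The invariant `∏ xᵢ ^ aᵢ` of a circuit `a`. -/
def uPoly (a : κ → ι → ℕ) (b : Module.Basis ι ℂ V) (j : κ) : Poly (V × Module.Dual ℂ V) :=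
  ∏ i, linPoly (xForm b i) ^ a j i

/-- The invariant `∏ (yᵢ / aᵢ) ^ aᵢ` of a circuit `a`. -/
def udPoly (a : κ → ι → ℕ) (b : Module.Basis ι ℂ V) (j : κ) : Poly (V × Module.Dual ℂ V) :=
  ∏ i, linPoly ((a j i : ℂ)⁻¹ • yForm b i) ^ a j i

variable [Fintype κ]

/-- The monomials in the invariants of the circuits. -/
def circuitMono (a : κ → ι → ℕ) (b : Module.Basis ι ℂ V) (d z z' : κ → ℕ) :
    Poly (V × Module.Dual ℂ V) :=
  (∏ j, sPoly a b j ^ d j) * (∏ j, uPoly a b j ^ z j) * ∏ j, udPoly a b j ^ z' j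

/-- The invariant function that restricts to the monomial with exponent `e` on the sum of
two dual Cartan subspaces. -/
def liftMono (a : κ → ι → ℕ) (b : Module.Basis ι ℂ V) (e : κ ⊕ κ → ℕ) :
    Poly (V × Module.Dual ℂ V) :=
  circuitMono a b (fun j => min (e (Sum.inl j)) (e (Sum.inr j)))
    (fun j => (e (Sum.inl j) - e (Sum.inr j)) / circuitSize a j)
    (fun j => (e (Sum.inr j) - e (Sum.inl j)) / circuitSize a j)

/-- The exponents of the invariant monomials on the sum of two dual Cartan subspaces. -/
def invExponents (a : κ → ι → ℕ) : Set (κ ⊕ κ → ℕ) :=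
  {e | ∀ j, circuitSize a j ∣ e (Sum.inl j) - e (Sum.inr j) ∧
    circuitSize a j ∣ e (Sum.inr j) - e (Sum.inl j)}

variable {b : Module.Basis ι ℂ V} (ha : IsCircuitSystem m a) (hb : IsWeightBasis ρ m b)

include ha

theorem IsCircuitSystem.circuitSize_pos (j : κ) : 0 < circuitSize a j := by
  obtain ⟨i, hi⟩ := ha.nonzero j
  refine Nat.pos_of_ne_zero fun h => hi ?_
  exact (Finset.sum_eq_zero_iff.1 h) i (Finset.mem_univ i)

/-- The exponents `d + N z` and `d + N z'` have minimum `d` and truncated differences `N z` and `N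
z'`, because `z j` or `z' j` is zero. -/
theorem circuitMono_mem_liftMono (d z z' : κ → ℕ) (hz : ∀ j, z j = 0 ∨ z' j = 0) :
    circuitMono a b d z z' ∈ liftMono a b '' invExponents a := by
  refine ⟨Sum.elim (fun j => d j + circuitSize a j * z j)
    (fun j => d j + circuitSize a j * z' j), fun j => ?_, ?_⟩
  · simp only [Sum.elim_inl, Sum.elim_inr]
    rcases hz j with h | h <;> simp [h]
  · unfold liftMono
    congr 1 <;> funext j <;> have hN := ha.circuitSize_pos j <;>
      rcases hz j with h | h <;> simp [h, hN]

include hb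

/-- Every tuple orthogonal to the circuits consists of the values `m i (ξ)` for some `ξ`, so this
combination of the `xᵢ yᵢ` is a component of the moment map. -/
theorem sum_mem_momentIdeal (η : ι → ℂ) (hη : ∀ j, ∑ i, a j i * η i = 0) :
    ∑ i, η i • (linPoly (xForm b i) * linPoly (yForm b i)) ∈ momentIdeal ρ := by
  obtain ⟨ξ, hξ⟩ := ha.exists_weight_eq η hη
  simpa only [hξ] using hb.sum_mem_momentIdeal ξ

theorem mul_mem_momentIdeal (i : ι) (hi : ∀ j, a j i = 0) :
    linPoly (xForm b i) * linPoly (yForm b i) ∈ momentIdeal ρ := by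
  classical
  have h := sum_mem_momentIdeal ha hb (Pi.single i 1) fun j => by
    rw [Fintype.sum_eq_single i fun k hk => by simp [Pi.single_eq_of_ne hk]]
    simp [hi]
  rw [Fintype.sum_eq_single i fun k hk => by simp [Pi.single_eq_of_ne hk]] at h
  simpa using h

/-- Apply `sum_mem_momentIdeal` to the `i`-th coordinate vector minus `a j i / N_j` times the
indicator of the `j`-th circuit. Pairing with that circuit gives `a j i - (a j i / N_j) * N_j = 0`.
-/
theorem mul_sub_mem_momentIdeal {i : ι} {j : κ} (hi : a j i ≠ 0) :
    linPoly (xForm b i) * linPoly (yForm b i) - (a j i : ℂ) • sPoly a b j ∈ momentIdeal ρ := by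
  classical
  have hN : (circuitSize a j : ℂ) ≠ 0 := by exact_mod_cast (ha.circuitSize_pos j).ne'
  have h := sum_mem_momentIdeal ha hb (fun k => (Pi.single i 1 : ι → ℂ) k -
    a j i * (if a j k = 0 then (0 : ℂ) else (circuitSize a j : ℂ)⁻¹)) fun j' => by
      simp only [mul_sub, Finset.sum_sub_distrib]
      rw [Fintype.sum_eq_single i fun k hk => by simp [Pi.single_eq_of_ne hk], Pi.single_eq_same,
        mul_one, sub_eq_zero]
      by_cases hj : j' = j
      · subst hj
        have h1 : ∀ k, (a j' k : ℂ) * (a j' i * if a j' k = 0 then (0 : ℂ) else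
            (circuitSize a j' : ℂ)⁻¹) = (a j' i * (circuitSize a j' : ℂ)⁻¹) * a j' k := by
          intro k
          split_ifs with hk
          · simp [hk]
          · ring
        simp only [h1]
        rw [← Finset.mul_sum, ← Nat.cast_sum]
        change _ = _ * ((circuitSize a j' : ℕ) : ℂ)
        field_simp
      · rw [ha.eq_zero_of_ne hi hj, Finset.sum_eq_zero]
        · simp
        · intro k _
          by_cases hk : a j k = 0
          · simp [hk]
          · simp [ha.eq_zero_of_ne hk hj]
  simp only [sub_smul, Finset.sum_sub_distrib, mul_smul, ← Finset.smul_sum] at h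
  rwa [Fintype.sum_eq_single i fun k hk => by simp [Pi.single_eq_of_ne hk], Pi.single_eq_same,
    one_smul] at h

/-- Modulo the moment ideal, a monomial in the `xᵢ yᵢ` is a multiple of a monomial in the quadratic
invariants of the circuits. -/
theorem exists_prod_sub_mem_momentIdeal (d : ι → ℕ) : ∃ (k : ℂ) (e : κ → ℕ),
    (∏ i, (linPoly (xForm b i) * linPoly (yForm b i)) ^ d i) - k • ∏ j, sPoly a b j ^ e j ∈
      momentIdeal ρ := by
  classical
  let π := Ideal.Quotient.mkₐ ℂ (momentIdeal ρ)
  -- Being a multiple of a monomial in the `s_j` is preserved by products, so only single factors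
  -- `xᵢ yᵢ` need to be treated. The scalar is `0` if `i` belongs to no circuit.
  let P : NullFibreRing ρ → Prop := fun q => ∃ (k : ℂ) (e : κ → ℕ), q = π (k • ∏ j, sPoly a b j ^ e j)
  have hone : P 1 := ⟨1, 0, by simp⟩
  have hmul (q q' : NullFibreRing ρ) (h : P q) (h' : P q') : P (q * q') := by
    obtain ⟨k, e, rfl⟩ := h
    obtain ⟨k', e', rfl⟩ := h'
    refine ⟨k * k', e + e', ?_⟩
    rw [← map_mul, smul_mul_smul_comm]
    simp only [Pi.add_apply, pow_add, Finset.prod_mul_distrib]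
  have hpow (q : NullFibreRing ρ) (h : P q) (n : ℕ) : P (q ^ n) := by
    induction n with
    | zero => rwa [pow_zero]
    | succ n ih => rw [pow_succ]; exact hmul _ _ ih h
  suffices h : P (π (∏ i, (linPoly (xForm b i) * linPoly (yForm b i)) ^ d i)) by
    obtain ⟨k, e, h⟩ := h
    exact ⟨k, e, Ideal.Quotient.eq.1 h⟩
  rw [map_prod]
  refine Finset.prod_induction _ P hmul hone fun i _ => ?_
  rw [map_pow]
  refine hpow _ ?_ _
  by_cases hi : ∀ j, a j i = 0
  · refine ⟨0, 0, ?_⟩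
    rw [zero_smul]
    exact Ideal.Quotient.eq.2 (by rw [sub_zero]; exact mul_mem_momentIdeal ha hb i hi)
  · push Not at hi
    obtain ⟨j, hj⟩ := hi
    refine ⟨a j i, Pi.single j 1, ?_⟩
    rw [Fintype.prod_eq_single j fun k hk => by simp [Pi.single_eq_of_ne hk], Pi.single_eq_same,
      pow_one]
    exact Ideal.Quotient.eq.2 (mul_sub_mem_momentIdeal ha hb hj)

/-- Modulo the moment ideal, the invariants of `V ⊕ V*` are spanned by the lifts of the invariant
monomials on the sum of two dual Cartan subspaces. -/
theorem mem_span_sup_momentIdeal (f : Poly (V × Module.Dual ℂ V))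
    (hf : f ∈ Invariants (cotangent ρ)) :
    f ∈ Submodule.span ℂ (liftMono a b '' invExponents a) ⊔ (momentIdeal ρ).restrictScalars ℂ := by
  classical
  have h1 := mem_span_of_invariant (fun t x => cotangent ρ t x) (mono (cotangentBasis b)) _
    (fun e t p => evalAt_mono_apply hb.cotangent e t p) f
    (span_mono (cotangentBasis b) ▸ Submodule.mem_top) hf
  refine Submodule.span_le.2 ?_ h1
  rintro _ ⟨e, he, rfl⟩
  have he' := (invariant_iff_of_mono e).1 he
  -- Invariance says that the `x`-exponents and the `y`-exponents have the same weight, so the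
  -- truncated differences in both directions are non-negative relations, hence sums of circuits.
  obtain ⟨z, hz⟩ := ha.span _ (ha.posPart _ _ he')
  obtain ⟨z', hz'⟩ := ha.span _ (ha.posPart _ _ fun l => (he' l).symm)
  have hzz (j : κ) : z j = 0 ∨ z' j = 0 := by
    by_contra! h
    obtain ⟨i, hi⟩ := ha.nonzero j
    have e1 := hz i
    have e2 := hz' i
    rw [ha.sum_eq hi _ (fun j' h => by simp [h])] at e1 e2
    have p1 := Nat.mul_pos (Nat.pos_of_ne_zero h.1) (Nat.pos_of_ne_zero hi)
    have p2 := Nat.mul_pos (Nat.pos_of_ne_zero h.2) (Nat.pos_of_ne_zero hi)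
    omega
  obtain ⟨k, d, hk⟩ := exists_prod_sub_mem_momentIdeal ha hb
    (fun i => min (e (Sum.inl i)) (e (Sum.inr i)))
  -- The scalar that compensates for the factors `1 / a j i` in `udPoly`.
  let A : ℂ := ∏ j, (∏ i, (a j i : ℂ) ^ a j i) ^ z' j
  have hpow (w : κ → ℕ) (F : ι → Poly (V × Module.Dual ℂ V)) :
      ∏ i, F i ^ (∑ j, w j * a j i) = ∏ j, (∏ i, F i ^ a j i) ^ w j := by
    simp only [← Finset.prod_pow, ← pow_mul]
    rw [Finset.prod_comm]
    refine Finset.prod_congr rfl fun i _ => ?_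
    rw [← Finset.prod_pow_eq_pow_sum]
    exact Finset.prod_congr rfl fun j _ => by rw [mul_comm]
  have hu : ∏ i, linPoly (xForm b i) ^ (e (Sum.inl i) - e (Sum.inr i)) =
      ∏ j, uPoly a b j ^ z j := by
    simp only [hz]
    exact hpow z _
  have hud : ∏ i, linPoly (yForm b i) ^ (e (Sum.inr i) - e (Sum.inl i)) =
      A • ∏ j, udPoly a b j ^ z' j := by
    simp only [hz']
    rw [hpow z']
    have (j : κ) : ∏ i, linPoly (yForm b i) ^ a j i =
        (∏ i, (a j i : ℂ) ^ a j i) • udPoly a b j := by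
      rw [udPoly, ← Finset.prod_smul]
      refine Finset.prod_congr rfl fun i _ => ?_
      rw [← smul_pow]
      by_cases hi : a j i = 0
      · simp [hi]
      · congr 1
        refine poly_ext fun p => ?_
        have : (a j i : ℂ) ≠ 0 := by exact_mod_cast hi
        simp [this]
    simp only [this, smul_pow]
    rw [Finset.prod_smul]
  -- The common part of the exponents is collected in powers of `xᵢ yᵢ`, which the moment ideal
  -- controls; what remains involves only one of `xᵢ`, `yᵢ`.
  have hmin (x y : Poly (V × Module.Dual ℂ V)) (p q : ℕ) :
      x ^ p * y ^ q = (x * y) ^ min p q * (x ^ (p - q) * y ^ (q - p)) := by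
    rcases le_total p q with h | h <;> obtain ⟨n, rfl⟩ := Nat.exists_eq_add_of_le h <;>
      simp <;> ring
  have hsplit : mono (cotangentBasis b) e =
      (∏ i, (linPoly (xForm b i) * linPoly (yForm b i)) ^ min (e (Sum.inl i)) (e (Sum.inr i))) *
        ((∏ j, uPoly a b j ^ z j) * (A • ∏ j, udPoly a b j ^ z' j)) := by
    rw [← hu, ← hud, mono_cotangentBasis, ← Finset.prod_mul_distrib, ← Finset.prod_mul_distrib,
      ← Finset.prod_mul_distrib]
    refine Finset.prod_congr rfl fun i _ => ?_
    exact hmin _ _ _ _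
  have hmem := (momentIdeal ρ).mul_mem_right
    ((∏ j, uPoly a b j ^ z j) * (A • ∏ j, udPoly a b j ^ z' j)) hk
  rw [sub_mul, ← hsplit] at hmem
  have hG : (k • ∏ j, sPoly a b j ^ d j) *
      ((∏ j, uPoly a b j ^ z j) * (A • ∏ j, udPoly a b j ^ z' j)) =
        (k * A) • circuitMono a b d z z' := by
    rw [circuitMono, mul_smul_comm, smul_mul_smul_comm, mul_assoc]
  rw [hG] at hmem
  refine Submodule.mem_sup.2 ⟨_, Submodule.smul_mem _ (k * A) (Submodule.subset_span
    (circuitMono_mem_liftMono ha (b := b) d z z' hzz)), _, hmem, add_sub_cancel _ _⟩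

theorem liftMono_mem_invariants (e : κ ⊕ κ → ℕ) : liftMono a b e ∈ Invariants (cotangent ρ) := by
  have hx (t : Fin r → ℂˣ) (p : V × Module.Dual ℂ V) (i : ι) :
      xForm b i (cotangent ρ t p) = character (m i) t * xForm b i p := by
    simpa [coord_cotangentBasis_inl, ← coord_cotangentBasis_inl] using
      hb.cotangent.repr_apply t p (Sum.inl i)
  have hy (t : Fin r → ℂˣ) (p : V × Module.Dual ℂ V) (i : ι) :
      yForm b i (cotangent ρ t p) = character (-m i) t * yForm b i p := by
    have := hb.cotangent.repr_apply t p (Sum.inr i)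
    rw [← Module.Basis.coord_apply, ← Module.Basis.coord_apply, coord_cotangentBasis_inr] at this
    exact this
  have hinv (f : Poly (V × Module.Dual ℂ V))
      (h : ∀ t p, evalAt (cotangent ρ t p) f = evalAt p f) : f ∈ Invariants (cotangent ρ) := h
  have hs (j : κ) : sPoly a b j ∈ Invariants (cotangent ρ) := by
    refine hinv _ fun t p => ?_
    simp only [sPoly, map_sum, map_smul, map_mul, evalAt_linPoly, hx, hy]
    refine Finset.sum_congr rfl fun i _ => ?_
    have : character (m i) t * character (-m i) t = 1 := by
      rw [← character_add, add_neg_cancel, character_zero, MonoidHom.one_apply]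
    congr 1
    linear_combination (xForm b i p * yForm b i p) * this
  have hu (j : κ) : uPoly a b j ∈ Invariants (cotangent ρ) := by
    refine hinv _ fun t p => ?_
    simp only [uPoly, map_prod, map_pow, evalAt_linPoly, hx, mul_pow, Finset.prod_mul_distrib]
    simp only [← character_nsmul, ← character_sum]
    rw [(sum_nsmul_eq_zero _).2 (ha.relation j), character_zero, MonoidHom.one_apply, one_mul]
  have hud (j : κ) : udPoly a b j ∈ Invariants (cotangent ρ) := by
    refine hinv _ fun t p => ?_
    simp only [udPoly, map_prod, map_pow, evalAt_linPoly, LinearMap.smul_apply, smul_eq_mul, hy,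
      mul_left_comm _ (character _ t)]
    simp only [mul_pow _ _ (a j _), Finset.prod_mul_distrib]
    simp only [← character_nsmul, ← character_sum, smul_neg, Finset.sum_neg_distrib]
    rw [(sum_nsmul_eq_zero _).2 (ha.relation j), neg_zero, character_zero, MonoidHom.one_apply,
      one_mul]
  refine mul_mem (mul_mem ?_ ?_) ?_ <;> refine Subalgebra.prod_mem _ fun j _ => pow_mem ?_ _
  · exact hs j
  · exact hu j
  · exact hud j

end Generators

/-! ### Restriction to the sum of two dual Cartan subspaces -/

section Restriction

variable {r : ℕ} {V : Type*} [AddCommGroup V] [Module ℂ V] {ι κ : Type*}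
  [Fintype ι] [Fintype κ] {ρ : Representation ℂ (Fin r → ℂˣ) V} {m : ι → Fin r → ℤ}
  {a : κ → ι → ℕ} {b : Module.Basis ι ℂ V}

/-- The span of the circuit vectors. -/
abbrev circuitSpan (a : κ → ι → ℕ) (b : Module.Basis ι ℂ V) : Submodule ℂ V :=
  Submodule.span ℂ (Set.range (circuitVec a b))

/-- The span of the circuit forms. -/
abbrev formSpan (a : κ → ι → ℕ) (b : Module.Basis ι ℂ V) : Submodule ℂ (Module.Dual ℂ V) :=
  Submodule.span ℂ (Set.range (circuitForm a b))

theorem linearIndependent_circuitForm (ha : IsCircuitSystem m a) (b : Module.Basis ι ℂ V) :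
    LinearIndependent ℂ (circuitForm a b) := by
  rw [Fintype.linearIndependent_iff]
  intro q hq j
  obtain ⟨i, hi⟩ := ha.nonzero j
  have h := LinearMap.congr_fun hq (b i)
  simp only [LinearMap.sum_apply, LinearMap.smul_apply, circuitForm_basis, smul_eq_mul,
    LinearMap.zero_apply] at h
  rw [ha.sum_eq hi _ (fun j' h => by simp [h])] at h
  exact (mul_eq_zero.1 h).resolve_right (by exact_mod_cast hi)

/-- The basis of `𝔠 ⊕ 𝔠^∨` that consists of the circuit vectors and the circuit forms. -/
def cartanBasis (ha : IsCircuitSystem m a) (b : Module.Basis ι ℂ V) :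
    Module.Basis (κ ⊕ κ) ℂ (circuitSpan a b × formSpan a b) :=
  (Module.Basis.span (ha.linearIndependent_circuitVec b)).prod
    (Module.Basis.span (linearIndependent_circuitForm ha b))

variable (ha : IsCircuitSystem m a)

theorem fst_eq_sum (p : circuitSpan a b × formSpan a b) :
    p.1.1 = ∑ j, (cartanBasis ha b).repr p (Sum.inl j) • circuitVec a b j := by
  have h := congrArg Subtype.val
    ((Module.Basis.span (ha.linearIndependent_circuitVec b)).sum_repr p.1)
  rw [← h]
  simp [cartanBasis, Module.Basis.span_apply]

theorem snd_eq_sum (p : circuitSpan a b × formSpan a b) :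
    p.2.1 = ∑ j, (cartanBasis ha b).repr p (Sum.inr j) • circuitForm a b j := by
  have h := congrArg Subtype.val
    ((Module.Basis.span (linearIndependent_circuitForm ha b)).sum_repr p.2)
  rw [← h]
  simp [cartanBasis, Module.Basis.span_apply]

theorem xForm_cartanIncl (p : circuitSpan a b × formSpan a b) {i : ι} {j : κ} (hi : a j i ≠ 0) :
    xForm b i (cartanIncl _ _ p) = (cartanBasis ha b).repr p (Sum.inl j) := by
  change b.repr p.1.1 i = _
  rw [fst_eq_sum ha p, ha.repr_sum_circuitVec_of_ne b _ hi]

theorem xForm_cartanIncl_eq_zero (p : circuitSpan a b × formSpan a b) {i : ι}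
    (hi : ∀ j, a j i = 0) : xForm b i (cartanIncl _ _ p) = 0 := by
  obtain ⟨q, hq⟩ := (mem_span_circuitVec b p.1.1).1 p.1.2
  change b.repr p.1.1 i = _
  rw [hq]
  simp [hi]

theorem yForm_cartanIncl (p : circuitSpan a b × formSpan a b) {i : ι} {j : κ} (hi : a j i ≠ 0) :
    yForm b i (cartanIncl _ _ p) = a j i * (cartanBasis ha b).repr p (Sum.inr j) := by
  change p.2.1 (b i) = _
  rw [snd_eq_sum ha p, LinearMap.sum_apply]
  simp only [LinearMap.smul_apply, circuitForm_basis, smul_eq_mul]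
  rw [ha.sum_eq hi _ (fun j' h => by simp [h]), mul_comm]

include ha

/-- On `𝔠 ⊕ 𝔠^∨` each `xᵢ yᵢ` of the circuit equals `a j i * p_j * q_j`, and the entries `a j i` add
up to the normalising factor `N_j`. -/
theorem evalAt_sPoly (p : circuitSpan a b × formSpan a b) (j : κ) :
    evalAt (cartanIncl _ _ p) (sPoly a b j) =
      (cartanBasis ha b).repr p (Sum.inl j) * (cartanBasis ha b).repr p (Sum.inr j) := by
  have hN : (circuitSize a j : ℂ) ≠ 0 := by exact_mod_cast (ha.circuitSize_pos j).ne'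
  have h (i : ι) : (if a j i = 0 then (0 : ℂ) else (circuitSize a j : ℂ)⁻¹) *
      (xForm b i (cartanIncl _ _ p) * yForm b i (cartanIncl _ _ p)) =
      (circuitSize a j : ℂ)⁻¹ * ((cartanBasis ha b).repr p (Sum.inl j) *
        (cartanBasis ha b).repr p (Sum.inr j)) * a j i := by
    split_ifs with hi
    · simp [hi]
    · rw [xForm_cartanIncl ha p hi, yForm_cartanIncl ha p hi]
      ring
  simp only [sPoly, map_sum, map_smul, map_mul, evalAt_linPoly, smul_eq_mul, h]
  rw [← Finset.mul_sum, ← Nat.cast_sum]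
  change _ * ((circuitSize a j : ℕ) : ℂ) = _
  field_simp

theorem evalAt_uPoly (p : circuitSpan a b × formSpan a b) (j : κ) :
    evalAt (cartanIncl _ _ p) (uPoly a b j) =
      (cartanBasis ha b).repr p (Sum.inl j) ^ circuitSize a j := by
  simp only [uPoly, map_prod, map_pow, evalAt_linPoly, circuitSize, ← Finset.prod_pow_eq_pow_sum]
  refine Finset.prod_congr rfl fun i _ => ?_
  by_cases hi : a j i = 0
  · simp [hi]
  · rw [xForm_cartanIncl ha p hi]

theorem evalAt_udPoly (p : circuitSpan a b × formSpan a b) (j : κ) :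
    evalAt (cartanIncl _ _ p) (udPoly a b j) =
      (cartanBasis ha b).repr p (Sum.inr j) ^ circuitSize a j := by
  simp only [udPoly, map_prod, map_pow, evalAt_linPoly, circuitSize, ← Finset.prod_pow_eq_pow_sum]
  refine Finset.prod_congr rfl fun i _ => ?_
  by_cases hi : a j i = 0
  · simp [hi]
  · have : (a j i : ℂ) ≠ 0 := by exact_mod_cast hi
    rw [LinearMap.smul_apply, yForm_cartanIncl ha p hi, smul_eq_mul, inv_mul_cancel_left₀ this]

/-- Divisibility makes the quotients by `N_j` exact, and a minimum plus the truncated difference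
gives back each exponent. -/
theorem pullback_liftMono {e : κ ⊕ κ → ℕ} (he : e ∈ invExponents a) :
    pullback (cartanIncl _ _) (liftMono a b e) = mono (cartanBasis ha b) e := by
  refine poly_ext fun p => ?_
  change evalAt (cartanIncl _ _ p) (liftMono a b e) = _
  simp only [liftMono, circuitMono, map_mul, map_prod, map_pow, evalAt_sPoly ha, evalAt_uPoly ha,
    evalAt_udPoly ha, evalAt_mono]
  rw [Fintype.prod_sum_type, ← Finset.prod_mul_distrib, ← Finset.prod_mul_distrib,
    ← Finset.prod_mul_distrib]
  refine Finset.prod_congr rfl fun j _ => ?_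
  rw [← pow_mul, ← pow_mul, Nat.mul_div_cancel' (he j).1, Nat.mul_div_cancel' (he j).2]
  rcases le_total (e (Sum.inl j)) (e (Sum.inr j)) with h | h <;>
    obtain ⟨n, hn⟩ := Nat.exists_eq_add_of_le h <;> simp [hn] <;> ring

/-- Restricted to `𝔠 ⊕ 𝔠^∨`, a component of the moment map becomes `∑ p_j q_j ∑ a j i * m i (ξ)`,
and the inner sums vanish as circuits are relations. -/
theorem momentIdeal_le_ker (hb : IsWeightBasis ρ m b) (f : Poly (V × Module.Dual ℂ V))
    (hf : f ∈ momentIdeal ρ) : pullback (cartanIncl (circuitSpan a b) (formSpan a b)) f = 0 := by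
  suffices H : momentIdeal ρ ≤
      RingHom.ker (pullback (cartanIncl (circuitSpan a b) (formSpan a b))) from H hf
  refine Ideal.span_le.2 ?_
  rintro f ⟨ξ, hξ⟩
  refine poly_ext fun p => ?_
  change f.1 (cartanIncl _ _ p) = 0
  rw [hξ, hb.moment_eq]
  have h (i : ι) : (∑ l, (m i l : ℂ) * ξ l) * (b.repr (cartanIncl _ _ p).1 i *
      (cartanIncl _ _ p).2 (b i)) = ∑ j, ((cartanBasis ha b).repr p (Sum.inl j) *
        (cartanBasis ha b).repr p (Sum.inr j)) * (a j i * ∑ l, m i l * ξ l) := by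
    rw [← xForm_apply, ← yForm_apply]
    by_cases hi : ∀ j, a j i = 0
    · rw [xForm_cartanIncl_eq_zero p hi]
      simp [hi]
    · push Not at hi
      obtain ⟨j, hj⟩ := hi
      rw [ha.sum_eq hj _ (fun j' h => by simp [h]), xForm_cartanIncl ha p hj,
        yForm_cartanIncl ha p hj]
      ring
  simp only [h]
  rw [Finset.sum_comm]
  refine Finset.sum_eq_zero fun j _ => ?_
  rw [← Finset.mul_sum]
  simp only [Finset.mul_sum]
  rw [Finset.sum_comm]
  refine Finset.sum_eq_zero fun l _ => ?_
  rw [← Finset.mul_sum]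
  simp only [← mul_assoc]
  have h3 : ∑ i, (a j i : ℂ) * m i l = 0 := by exact_mod_cast ha.relation j l
  rw [← Finset.sum_mul, h3, zero_mul, mul_zero]

/-- An element of the normaliser acts on every circuit by a scalar. -/
theorem exists_scalar_of_mem_normalizer (hb : IsWeightBasis ρ m b) {t : Fin r → ℂˣ}
    (ht : t ∈ normalizer ρ (circuitSpan a b)) (j : κ) :
    ∃ ζ : ℂ, ∀ i, a j i ≠ 0 → character (m i) t = ζ := by
  have h1 : ρ t (circuitVec a b j) ∈ circuitSpan a b :=
    normalizer_apply_mem ρ _ ⟨t, ht⟩ _ (Submodule.subset_span ⟨j, rfl⟩)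
  obtain ⟨p, hp⟩ := (mem_span_circuitVec b _).1 h1
  refine ⟨p j, fun i hi => ?_⟩
  have h2 := hp i
  rwa [hb.repr_apply, repr_circuitVec, if_neg hi, mul_one,
    ha.sum_eq hi _ (fun j' h => by simp [h]), if_neg hi] at h2

/-- All weights of one circuit take the same value on the normaliser, so any index `i` of the
circuit can be used to name the scalar. -/
theorem dual_apply_circuitForm (hb : IsWeightBasis ρ m b) {t : Fin r → ℂˣ}
    (ht : t ∈ normalizer ρ (circuitSpan a b)) {j : κ} {i : ι} (hi : a j i ≠ 0) :
    ρ.dual t (circuitForm a b j) = character (-m i) t • circuitForm a b j := by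
  obtain ⟨ζ, hζ⟩ := exists_scalar_of_mem_normalizer ha hb (inv_mem ht) j
  refine b.ext fun k => ?_
  rw [Representation.dual_apply, Module.Dual.transpose_apply, LinearMap.comp_apply, hb, map_smul,
    LinearMap.smul_apply, circuitForm_basis, smul_eq_mul, smul_eq_mul, character_neg]
  by_cases hk : a j k = 0
  · simp [hk]
  · rw [hζ i hi, hζ k hk]

theorem dual_apply_mem_formSpan (hb : IsWeightBasis ρ m b) {t : Fin r → ℂˣ}
    (ht : t ∈ normalizer ρ (circuitSpan a b)) (y : Module.Dual ℂ V) (hy : y ∈ formSpan a b) :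
    ρ.dual t y ∈ formSpan a b := by
  suffices H : formSpan a b ≤ (formSpan a b).comap (ρ.dual t) from H hy
  refine Submodule.span_le.2 ?_
  rintro _ ⟨j, rfl⟩
  obtain ⟨i, hi⟩ := ha.nonzero j
  change ρ.dual t (circuitForm a b j) ∈ formSpan a b
  rw [dual_apply_circuitForm ha hb ht hi]
  exact Submodule.smul_mem _ _ (Submodule.subset_span ⟨j, rfl⟩)

/-- The kernel of the restriction consists of the invariant functions in the moment ideal. -/
theorem pullback_cartanIncl_eq_zero_iff (hb : IsWeightBasis ρ m b)
    (f : Poly (V × Module.Dual ℂ V)) (hf : f ∈ Invariants (cotangent ρ)) :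
    pullback (cartanIncl (circuitSpan a b) (formSpan a b)) f = 0 ↔ f ∈ momentIdeal ρ := by
  refine ⟨fun h => ?_, fun h => momentIdeal_le_ker ha hb _ h⟩
  obtain ⟨g, hg, k, hk, hgk⟩ := Submodule.mem_sup.1 (mem_span_sup_momentIdeal ha hb f hf)
  have h1 : pullback (cartanIncl (circuitSpan a b) (formSpan a b)) g = 0 := by
    rwa [← hgk, map_add, momentIdeal_le_ker ha hb k hk, add_zero] at h
  -- The chosen lifts restrict to distinct monomials on `𝔠 ⊕ 𝔠^∨`, so all coefficients of `g`
  -- vanish.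
  have h3 : g = 0 := by
    obtain ⟨l, hl, rfl⟩ := (Finsupp.mem_span_image_iff_linearCombination ℂ).1 hg
    have h4 : Finsupp.linearCombination ℂ (mono (cartanBasis ha b)) l = 0 := by
      rw [← h1, Finsupp.linearCombination_apply, Finsupp.linearCombination_apply, Finsupp.sum,
        Finsupp.sum, map_sum]
      refine Finset.sum_congr rfl fun e he => ?_
      rw [map_smul, pullback_liftMono ha (hl he)]
    rw [linearIndependent_iff.1 (linearIndependent_mono _) l h4, map_zero]
  rw [← hgk, h3, zero_add]
  exact hk

variable [FiniteDimensional ℂ V]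

/-- The action on `𝔠^∨` is defined through `𝔠*`. It agrees with the torus action on `V*` since the
normaliser preserves the span of the circuit forms and the pairing with `𝔠` is faithful there. -/
theorem cartanIncl_orbifoldRep (hb : IsWeightBasis ρ m b)
    (hd : IsDualCartanPair ρ (circuitSpan a b) (formSpan a b))
    (t : normalizer ρ (circuitSpan a b)) (p : circuitSpan a b × formSpan a b) :
    cartanIncl _ _ (orbifoldRep hd (QuotientGroup.mk t) p) = cotangent ρ t.1 (cartanIncl _ _ p) := by
  refine Prod.ext rfl ?_
  change ((weylDualRep hd (QuotientGroup.mk t) p.2 : formSpan a b) : Module.Dual ℂ V) =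
    ρ.dual t.1 p.2.1
  have h : weylDualRep hd (QuotientGroup.mk t) p.2 =
      ⟨ρ.dual t.1 p.2.1, dual_apply_mem_formSpan ha hb t.2 _ p.2.2⟩ := by
    apply (dualEquiv hd).injective
    refine LinearMap.ext fun x => ?_
    change dualEquiv hd ((dualEquiv hd).symm _) x = _
    rw [LinearEquiv.apply_symm_apply]
    rfl
  rw [h]

/-- The restriction of invariant functions to `𝔠 ⊕ 𝔠^∨`. -/
def restriction (hb : IsWeightBasis ρ m b)
    (hd : IsDualCartanPair ρ (circuitSpan a b) (formSpan a b)) :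
    Invariants (cotangent ρ) →ₐ[ℂ] Orbifold hd :=
  ((pullback (cartanIncl (circuitSpan a b) (formSpan a b))).comp
    (Invariants (cotangent ρ)).val).codRestrict (Orbifold hd) fun f w p => by
      obtain ⟨t, rfl⟩ := QuotientGroup.mk_surjective w
      change f.1.1 (cartanIncl _ _ _) = f.1.1 (cartanIncl _ _ p)
      rw [cartanIncl_orbifoldRep ha hb hd, f.2]

theorem restriction_eq_iff (hb : IsWeightBasis ρ m b)
    (hd : IsDualCartanPair ρ (circuitSpan a b) (formSpan a b)) (f g : Invariants (cotangent ρ)) :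
    restriction ha hb hd f = restriction ha hb hd g ↔ f.1 - g.1 ∈ momentIdeal ρ := by
  rw [← pullback_cartanIncl_eq_zero_iff ha hb (f.1 - g.1) fun t p =>
    congrArg₂ (· - ·) (f.2 t p) (g.2 t p), map_sub, sub_eq_zero]
  exact Subtype.ext_iff

theorem repr_orbifoldRep (hb : IsWeightBasis ρ m b)
    (hd : IsDualCartanPair ρ (circuitSpan a b) (formSpan a b)) (f : κ → ι)
    (hf : ∀ j, a j (f j) ≠ 0) (t : normalizer ρ (circuitSpan a b))
    (p : circuitSpan a b × formSpan a b) (s : κ ⊕ κ) :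
    (cartanBasis ha b).repr (orbifoldRep hd (QuotientGroup.mk t) p) s =
      character (Sum.elim (fun j => m (f j)) (fun j => -m (f j)) s) t.1 *
        (cartanBasis ha b).repr p s := by
  rcases s with j | j
  · rw [← xForm_cartanIncl ha _ (hf j), cartanIncl_orbifoldRep ha hb, xForm_apply,
      ← xForm_cartanIncl ha _ (hf j)]
    exact hb.repr_apply t.1 _ _
  · have h0 : (a j (f j) : ℂ) ≠ 0 := by exact_mod_cast hf j
    apply mul_left_cancel₀ h0
    rw [← yForm_cartanIncl ha _ (hf j), cartanIncl_orbifoldRep ha hb, mul_left_comm,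
      ← yForm_cartanIncl ha _ (hf j), yForm_apply, yForm_apply]
    change (cartanIncl _ _ p).2 (ρ t.1⁻¹ (b (f j))) = _
    rw [hb, map_smul, smul_eq_mul, Sum.elim_inr, character_neg]

/-- The Weyl group contains the product of the groups of roots of unity of order the sizes of the
circuits. -/
theorem exists_mem_normalizer [DecidableEq κ] (hb : IsWeightBasis ρ m b) (j : κ) :
    ∃ t ∈ normalizer ρ (circuitSpan a b), ∀ j' i, a j' i ≠ 0 → character (m i) t =
      if j' = j then Complex.exp (2 * Real.pi * Complex.I / circuitSize a j) else 1 := by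
  have hN : (circuitSize a j : ℂ) ≠ 0 := by exact_mod_cast (ha.circuitSize_pos j).ne'
  set ω := Complex.exp (2 * Real.pi * Complex.I / circuitSize a j) with hω
  have hωN : ω ^ circuitSize a j = 1 := by
    rw [hω, ← Complex.exp_nat_mul, mul_div_cancel₀ _ hN, Complex.exp_two_pi_mul_I]
  -- The values `ω` on the `j`-th circuit and `1` elsewhere satisfy the circuit equations, because
  -- `ω ^ N_j = 1`.
  obtain ⟨t, ht⟩ := ha.exists_character_eq (fun i => if a j i = 0 then 1 else ω)
    (fun i => by split_ifs <;> simp [hω]) (fun j' => by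
      by_cases hj : j' = j
      · subst hj
        rw [← hωN, circuitSize, ← Finset.prod_pow_eq_pow_sum]
        exact Finset.prod_congr rfl fun i _ => by split_ifs with h <;> simp [h]
      · refine Finset.prod_eq_one fun i _ => ?_
        by_cases hi : a j' i = 0
        · simp [hi]
        · simp [ha.eq_zero_of_ne hi (Ne.symm hj)])
  have hch (j' : κ) (i : ι) (hi : a j' i ≠ 0) :
      character (m i) t = if j' = j then ω else 1 := by
    rw [ht]
    by_cases hj : j' = j
    · subst hj; simp [hi]
    · simp [hj, ha.eq_zero_of_ne hi (Ne.symm hj)]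
  refine ⟨t, ?_, hch⟩
  have hle : (circuitSpan a b).map (ρ t) ≤ circuitSpan a b := by
    rw [Submodule.map_span_le]
    rintro _ ⟨j', rfl⟩
    have : ρ t (circuitVec a b j') = (if j' = j then ω else 1) • circuitVec a b j' := by
      refine b.repr.injective (Finsupp.ext fun k => ?_)
      rw [hb.repr_apply, map_smul, Finsupp.smul_apply, repr_circuitVec, smul_eq_mul]
      by_cases hk : a j' k = 0
      · simp [hk]
      · rw [hch j' k hk]
    rw [this]
    exact Submodule.smul_mem _ _ (Submodule.subset_span ⟨j', rfl⟩)
  refine Submodule.eq_of_le_of_finrank_eq hle ?_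
  have h (z : V) : ρ t⁻¹ (ρ t z) = z := by
    rw [← Module.End.mul_apply, ← map_mul]; simp
  exact (Submodule.equivMapOfInjective (ρ t) (fun x y hxy => by rw [← h x, ← h y, hxy])
    (circuitSpan a b)).finrank_eq.symm

/-- The invariants of `W` are spanned by invariant monomials. Testing these with the root of unity
acting on the `j`-th coordinates forces `N_j` to divide the difference of the exponents of `p_j` and
`q_j`, and such monomials have explicit lifts. -/
theorem restriction_surjective (hb : IsWeightBasis ρ m b)
    (hd : IsDualCartanPair ρ (circuitSpan a b) (formSpan a b)) :
    Function.Surjective (restriction ha hb hd) := by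
  classical
  rintro ⟨F, hF⟩
  choose f hf using ha.nonzero
  let χ : (κ ⊕ κ → ℕ) → normalizer ρ (circuitSpan a b) →* ℂ := fun e =>
    (character (∑ s, e s • (Sum.elim (fun j => m (f j)) (fun j => -m (f j)) s))).comp
      (normalizer ρ (circuitSpan a b)).subtype
  have h1 := mem_span_of_invariant (fun t p => orbifoldRep hd (QuotientGroup.mk t) p)
    (mono (cartanBasis ha b)) χ (fun e t p => by
      rw [evalAt_mono, evalAt_mono]
      change _ = character _ t.1 * _
      rw [character_sum, ← Finset.prod_mul_distrib]
      refine Finset.prod_congr rfl fun s _ => ?_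
      rw [repr_orbifoldRep ha hb hd f hf, mul_pow, character_nsmul]) F
    (span_mono (cartanBasis ha b) ▸ Submodule.mem_top) fun t p => hF _ p
  suffices H : F ∈ ((restriction ha hb hd).range.map (Orbifold hd).val).toSubmodule by
    obtain ⟨g, ⟨P, rfl⟩, hP⟩ := H
    exact ⟨P, Subtype.ext hP⟩
  refine Submodule.span_le.2 ?_ h1
  rintro _ ⟨e, he, rfl⟩
  have heN : e ∈ invExponents a := by
    intro j
    obtain ⟨t, htn, ht⟩ := exists_mem_normalizer ha hb j
    have hN : (circuitSize a j : ℂ) ≠ 0 := by exact_mod_cast (ha.circuitSize_pos j).ne'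
    have h2 : χ e ⟨t, htn⟩ = 1 := by
      have : χ e = 1 := he
      rw [this, MonoidHom.one_apply]
    change character _ t = 1 at h2
    rw [Fintype.sum_sum_type, character_add, character_sum, character_sum] at h2
    simp only [Sum.elim_inl, Sum.elim_inr, character_nsmul, character_neg] at h2
    have hinv (n : Fin r → ℤ) : character n t⁻¹ = (character n t)⁻¹ := by
      refine eq_inv_of_mul_eq_one_left ?_
      rw [← map_mul, inv_mul_cancel, map_one]
    simp only [hinv, ht _ _ (hf _)] at h2
    rw [Fintype.prod_eq_single j fun k hk => by simp [hk],
      Fintype.prod_eq_single j fun k hk => by simp [hk]] at h2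
    simp only [if_true] at h2
    -- Only the `j`-th coordinates are moved: `p_j` is multiplied by the root of unity and `q_j` by
    -- its inverse, so the difference of their exponents is a multiple of `N_j`.
    rw [← Complex.exp_neg, ← Complex.exp_nat_mul, ← Complex.exp_nat_mul, ← Complex.exp_add,
      Complex.exp_eq_one_iff] at h2
    obtain ⟨n, hn⟩ := h2
    have h3 : ((e (Sum.inl j) : ℂ) - e (Sum.inr j)) = n * circuitSize a j := by
      apply mul_right_cancel₀ Complex.two_pi_I_ne_zero
      field_simp at hn
      linear_combination (2 * Real.pi * Complex.I) * hn
    have h4 : (e (Sum.inl j) : ℤ) - e (Sum.inr j) = n * circuitSize a j := by exact_mod_cast h3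
    constructor
    · rcases le_total (e (Sum.inl j)) (e (Sum.inr j)) with h | h
      · rw [Nat.sub_eq_zero_of_le h]; exact dvd_zero _
      · zify [h]
        exact ⟨n, by rw [h4, mul_comm]⟩
    · rcases le_total (e (Sum.inl j)) (e (Sum.inr j)) with h | h
      · zify [h]
        exact ⟨-n, by linear_combination -h4⟩
      · rw [Nat.sub_eq_zero_of_le h]; exact dvd_zero _
  exact ⟨restriction ha hb hd ⟨liftMono a b e, liftMono_mem_invariants ha hb e⟩, ⟨_, rfl⟩,
    pullback_liftMono ha heN⟩

end Restriction

/-! ### Compatibility with the Poisson brackets -/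

section Differential

variable {M : Type*} [AddCommGroup M] [Module ℂ M]

/-- The differential at a point, as a linear map. -/
def differentialAt (p : M) : Poly M →ₗ[ℂ] Module.Dual ℂ M where
  toFun f := differential f p
  map_add' f g := differential_add f g p
  map_smul' c f := by
    rw [Algebra.smul_def, differential_mul, differential_algebraMap, smul_zero, add_zero]
    rfl

theorem differentialAt_apply (p : M) (f : Poly M) : differentialAt p f = differential f p := rfl

theorem differential_mul' (p : M) (f g : Poly M) :
    differential (f * g) p = evalAt p f • differential g p + evalAt p g • differential f p :=
  differential_mul f g p

theorem differential_linPoly (φ : Module.Dual ℂ M) (p : M) : differential (linPoly φ) p = φ :=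
  differential_linear φ p

theorem differential_pow (f : Poly M) (p : M) (n : ℕ) :
    differential (f ^ n) p = ((n : ℂ) * evalAt p f ^ (n - 1)) • differential f p := by
  induction n with
  | zero =>
    rw [pow_zero, Nat.cast_zero, zero_mul, zero_smul, ← map_one (algebraMap ℂ (Poly M)),
      differential_algebraMap]
  | succ n ih =>
    rw [pow_succ, differential_mul', ih, map_pow, smul_smul, ← add_smul]
    congr 1
    rcases n with _ | n
    · simp
    · simp only [Nat.add_sub_cancel]
      push_cast
      ring

/-- The differential of a product of powers of linear forms, at a point where these linear forms
have the same value. -/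
theorem differential_prod_pow {σ : Type*} (s : Finset σ) (φ : σ → Module.Dual ℂ M) (n : σ → ℕ)
    (p : M) (c : ℂ) (h : ∀ i, n i ≠ 0 → φ i p = c) :
    differential (∏ i ∈ s, linPoly (φ i) ^ n i) p =
      c ^ (∑ i ∈ s, n i - 1) • ∑ i ∈ s, (n i : ℂ) • φ i := by
  classical
  induction s using Finset.induction_on with
  | empty =>
    rw [Finset.prod_empty, Finset.sum_empty, Finset.sum_empty, smul_zero,
      ← map_one (algebraMap ℂ (Poly M)), differential_algebraMap]
  | insert i s hi ih =>
    have hev : evalAt p (∏ i ∈ s, linPoly (φ i) ^ n i) = c ^ ∑ i ∈ s, n i := by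
      rw [map_prod, ← Finset.prod_pow_eq_pow_sum]
      refine Finset.prod_congr rfl fun k _ => ?_
      by_cases hk : n k = 0
      · simp [hk]
      · rw [map_pow, evalAt_linPoly, h k hk]
    rw [Finset.prod_insert hi, Finset.sum_insert hi, Finset.sum_insert hi, differential_mul', ih,
      hev, differential_pow, differential_linPoly, map_pow, evalAt_linPoly]
    by_cases hn : n i = 0
    · simp [hn]
    · rw [h i hn, smul_add, smul_smul, smul_smul, smul_smul, add_comm]
      by_cases hs : ∑ i ∈ s, n i = 0
      · have h0 : ∑ i ∈ s, (n i : ℂ) • φ i = 0 :=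
          Finset.sum_eq_zero fun k hk => by simp [Finset.sum_eq_zero_iff.1 hs k hk]
        rw [h0, hs]
        simp [mul_comm]
      · have e1 : n i + ∑ i ∈ s, n i - 1 = ∑ i ∈ s, n i + (n i - 1) := by omega
        have e2 : n i + ∑ i ∈ s, n i - 1 = n i + (∑ i ∈ s, n i - 1) := by omega
        congr 2
        · rw [e1, pow_add]; ring
        · rw [e2, pow_add]

end Differential

/-- Both targets are the quotient of `A` by the same congruence. It is applied to the class map onto
the reduction and to the restriction to `𝔠 ⊕ 𝔠^∨`. -/
theorem exists_algEquiv_of_surjective {A B C : Type*} [Semiring A] [Semiring B] [Semiring C]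
    [Algebra ℂ A] [Algebra ℂ B] [Algebra ℂ C] (f : A →ₐ[ℂ] B) (g : A →ₐ[ℂ] C)
    (hf : Function.Surjective f) (hg : Function.Surjective g) (h : ∀ x y, f x = f y ↔ g x = g y) :
    ∃ e : B ≃ₐ[ℂ] C, ∀ x, e (f x) = g x := by
  let s := Function.surjInv hf
  have hs (x : A) : g (s (f x)) = g x := (h _ _).1 (Function.surjInv_eq hf _)
  let φ : B →ₐ[ℂ] C :=
    { toFun := fun y => g (s y)
      map_one' := by rw [← map_one f, hs, map_one]
      map_zero' := by rw [← map_zero f, hs, map_zero]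
      map_mul' := fun y y' => by
        obtain ⟨x, rfl⟩ := hf y
        obtain ⟨x', rfl⟩ := hf y'
        rw [← map_mul, hs, hs, hs, map_mul]
      map_add' := fun y y' => by
        obtain ⟨x, rfl⟩ := hf y
        obtain ⟨x', rfl⟩ := hf y'
        rw [← map_add, hs, hs, hs, map_add]
      commutes' := fun c => by rw [← f.commutes, hs, g.commutes] }
  refine ⟨AlgEquiv.ofBijective φ ⟨fun y y' hy => ?_, fun z => ?_⟩, hs⟩
  · obtain ⟨x, rfl⟩ := hf y
    obtain ⟨x', rfl⟩ := hf y'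
    change g (s (f x)) = g (s (f x')) at hy
    rwa [hs, hs, ← h] at hy
  · obtain ⟨x, rfl⟩ := hg z
    exact ⟨f x, hs x⟩

/-! ### Tangential functions and the Poisson isomorphism. -/

section Poisson

variable {r : ℕ} {V : Type*} [AddCommGroup V] [Module ℂ V] {ι κ : Type*}
  [Fintype ι] [Fintype κ] {ρ : Representation ℂ (Fin r → ℂˣ) V} {m : ι → Fin r → ℤ}
  {a : κ → ι → ℕ} {b : Module.Basis ι ℂ V}

/-- The functions on `V ⊕ V*` whose Hamiltonian vectors at points of `𝔠 ⊕ 𝔠^∨` belong to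
`𝔠 ⊕ 𝔠^∨`. -/
def tangentialFunctions (c : Submodule ℂ V) (cd : Submodule ℂ (Module.Dual ℂ V)) :
    Subalgebra ℂ (Poly (V × Module.Dual ℂ V)) where
  carrier := {f | ∀ p, differential f (cartanIncl c cd p) ∈
    LinearMap.range (LinearMap.comp (sympForm V) (cartanIncl c cd))}
  mul_mem' hf hg p := by
    rw [differential_mul]
    exact add_mem (Submodule.smul_mem _ _ (hg p)) (Submodule.smul_mem _ _ (hf p))
  add_mem' hf hg p := by
    rw [differential_add]
    exact add_mem (hf p) (hg p)
  algebraMap_mem' c p := by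
    rw [differential_algebraMap]
    exact zero_mem _

/-- Tangential functions form an algebra, so `s_j`, `u_j`, `u_j^∨` suffice. At a point of `𝔠 ⊕ 𝔠^∨`
the `xᵢ` of a circuit have the common value `p_j` and the `yᵢ / a j i` the common value `q_j`, so
the differentials are combinations of the circuit form and the circuit vector. -/
theorem liftMono_mem_tangentialFunctions (ha : IsCircuitSystem m a) (e : κ ⊕ κ → ℕ) :
    liftMono a b e ∈ tangentialFunctions (circuitSpan a b) (formSpan a b) := by
  have hs (j : κ) : sPoly a b j ∈ tangentialFunctions (circuitSpan a b) (formSpan a b) := by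
    intro p
    let P := (cartanBasis ha b).repr p (Sum.inl j)
    let Q := (cartanBasis ha b).repr p (Sum.inr j)
    -- The Hamiltonian vector of `s_j` is `N_j⁻¹ (P e_j, -Q f_j)`.
    refine ⟨(((circuitSize a j : ℂ)⁻¹ * P) • ⟨circuitVec a b j, Submodule.subset_span ⟨j, rfl⟩⟩,
      (-((circuitSize a j : ℂ)⁻¹ * Q)) • ⟨circuitForm a b j, Submodule.subset_span ⟨j, rfl⟩⟩), ?_⟩
    refine LinearMap.ext fun v => ?_
    rw [← differentialAt_apply, sPoly]
    simp only [map_sum, map_smul, differentialAt_apply, differential_mul', differential_linPoly,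
      evalAt_linPoly]
    change v.2 (((circuitSize a j : ℂ)⁻¹ * P) • circuitVec a b j) -
      (-((circuitSize a j : ℂ)⁻¹ * Q)) * circuitForm a b j v.1 = _
    simp only [LinearMap.sum_apply, LinearMap.smul_apply, LinearMap.add_apply, smul_eq_mul,
      circuitForm_apply, circuitVec, map_smul, map_sum, Finset.mul_sum,
      ← Finset.sum_sub_distrib]
    refine Finset.sum_congr rfl fun i _ => ?_
    by_cases hi : a j i = 0
    · simp [hi]
    · rw [if_neg hi, if_neg hi, xForm_cartanIncl ha p hi, yForm_cartanIncl ha p hi, xForm_apply,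
        yForm_apply]
      ring
  have hu (j : κ) : uPoly a b j ∈ tangentialFunctions (circuitSpan a b) (formSpan a b) := by
    intro p
    rw [uPoly, differential_prod_pow _ _ _ _ _ fun i hi => xForm_cartanIncl ha p hi]
    -- Up to a power of `p_j` the differential of `u_j` is the circuit form on `V`; the sign is that
    -- of the second term of the symplectic form.
    refine Submodule.smul_mem _ _ ⟨(0, -⟨circuitForm a b j, Submodule.subset_span ⟨j, rfl⟩⟩), ?_⟩
    refine LinearMap.ext fun v => ?_
    change v.2 0 - -(circuitForm a b j v.1) = _
    simp [LinearMap.sum_apply, circuitForm_apply]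
  have hud (j : κ) : udPoly a b j ∈ tangentialFunctions (circuitSpan a b) (formSpan a b) := by
    intro p
    rw [udPoly, differential_prod_pow _ _ _ _ ((cartanBasis ha b).repr p (Sum.inr j)) fun i hi => by
      have : (a j i : ℂ) ≠ 0 := by exact_mod_cast hi
      rw [LinearMap.smul_apply, yForm_cartanIncl ha p hi, smul_eq_mul, inv_mul_cancel_left₀ this]]
    -- The exponents `a j i` cancel the factors `1 / a j i`, so the differential of `u_j^∨` is
    -- evaluation at the circuit vector, up to a power of `q_j`.
    refine Submodule.smul_mem _ _ ⟨(⟨circuitVec a b j, Submodule.subset_span ⟨j, rfl⟩⟩, 0), ?_⟩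
    refine LinearMap.ext fun v => ?_
    change v.2 (circuitVec a b j) - 0 = _
    rw [sub_zero, circuitVec, map_sum, LinearMap.sum_apply]
    refine Finset.sum_congr rfl fun i _ => ?_
    by_cases hi : a j i = 0
    · simp [hi]
    · have : (a j i : ℂ) ≠ 0 := by exact_mod_cast hi
      simp [hi, this]
  refine mul_mem (mul_mem ?_ ?_) ?_ <;> refine Subalgebra.prod_mem _ fun j _ => pow_mem ?_ _
  · exact hs j
  · exact hu j
  · exact hud j

/-- Every element of the symplectic reduction is the class of a tangential invariant function. -/
theorem exists_tangential_lift (ha : IsCircuitSystem m a) (hb : IsWeightBasis ρ m b)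
    (hρ : IsRational ρ) (q : Reduction ρ) : ∃ f : Invariants (cotangent ρ),
      f.1 ∈ tangentialFunctions (circuitSpan a b) (formSpan a b) ∧ toReduction ρ f = q := by
  obtain ⟨f, rfl⟩ := toReduction_surjective hρ q
  obtain ⟨g, hg, k, hk, hgk⟩ := Submodule.mem_sup.1 (mem_span_sup_momentIdeal ha hb f.1 f.2)
  have hinv : g ∈ Invariants (cotangent ρ) := by
    suffices H : Submodule.span ℂ (liftMono a b '' invExponents a) ≤
        Subalgebra.toSubmodule (Invariants (cotangent ρ)) from H hg
    refine Submodule.span_le.2 ?_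
    rintro _ ⟨e, -, rfl⟩
    exact liftMono_mem_invariants ha hb e
  have htan : g ∈ tangentialFunctions (circuitSpan a b) (formSpan a b) := by
    suffices H : Submodule.span ℂ (liftMono a b '' invExponents a) ≤
        Subalgebra.toSubmodule (tangentialFunctions (circuitSpan a b) (formSpan a b)) from H hg
    refine Submodule.span_le.2 ?_
    rintro _ ⟨e, -, rfl⟩
    exact liftMono_mem_tangentialFunctions ha e
  refine ⟨⟨g, hinv⟩, htan, Subtype.ext (Ideal.Quotient.eq.2 ?_)⟩
  change g - f.1 ∈ momentIdeal ρ
  rw [← hgk, sub_add_cancel_left, neg_mem_iff]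
  exact hk

theorem toReduction_eq_iff (f g : Invariants (cotangent ρ)) :
    toReduction ρ f = toReduction ρ g ↔ f.1 - g.1 ∈ momentIdeal ρ := by
  rw [← Ideal.Quotient.eq]
  exact ⟨fun h => congrArg Subtype.val h, fun h => Subtype.ext h⟩

variable [FiniteDimensional ℂ V]

/-- Restriction to `𝔠 ⊕ 𝔠^∨` is compatible with the Poisson brackets of tangential functions. -/
theorem bracket_cartanIncl {c : Submodule ℂ V} {cd : Submodule ℂ (Module.Dual ℂ V)}
    (hd : IsDualCartanPair ρ c cd) (f g : Poly (V × Module.Dual ℂ V))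
    (hf : f ∈ tangentialFunctions c cd) (hg : g ∈ tangentialFunctions c cd) :
    pullback (cartanIncl c cd) (bracket (sympForm V) sympForm_nondegenerate f g) =
      bracket (cartanForm c cd) (cartanForm_nondegenerate hd) (pullback (cartanIncl c cd) f)
        (pullback (cartanIncl c cd) g) := by
  have key (f : Poly (V × Module.Dual ℂ V)) (hf : f ∈ tangentialFunctions c cd) (p : c × cd) :
      hamiltonian (sympForm V) sympForm_nondegenerate f (cartanIncl c cd p) =
        cartanIncl c cd (hamiltonian (cartanForm c cd) (cartanForm_nondegenerate hd)
          (pullback (cartanIncl c cd) f) p) := by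
    -- The form on `𝔠 ⊕ 𝔠^∨` is the restricted one, so the tangent vector `u` solves the Hamiltonian
    -- equation for `f` on `V ⊕ V*` and for its restriction.
    obtain ⟨u, hu⟩ := hf p
    have h1 : hamiltonian (sympForm V) sympForm_nondegenerate f (cartanIncl c cd p) =
        cartanIncl c cd u := by
      rw [hamiltonian, LinearEquiv.symm_apply_eq, ← hu]
      rfl
    have h2 : hamiltonian (cartanForm c cd) (cartanForm_nondegenerate hd)
        (pullback (cartanIncl c cd) f) p = u := by
      rw [hamiltonian, LinearEquiv.symm_apply_eq, differential_pullback, ← hu]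
      rfl
    rw [h1, h2]
  refine poly_ext fun p => ?_
  change sympForm V _ _ = cartanForm c cd _ _
  rw [key f hf, key g hg]
  rfl

/-- The restriction of invariant functions induces an isomorphism of Poisson algebras. -/
theorem exists_reduction_equiv (ha : IsCircuitSystem m a) (hb : IsWeightBasis ρ m b)
    (hρ : IsRational ρ) (hd : IsDualCartanPair ρ (circuitSpan a b) (formSpan a b)) :
    ∃ e : Reduction ρ ≃ₐ[ℂ] Orbifold hd,
      (∀ x y, e (reductionBracket hρ x y) = orbifoldBracket hd (e x) (e y)) ∧
      ∀ (f : Invariants (cotangent ρ)) (p : circuitSpan a b × formSpan a b),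
        (e (toReduction ρ f)).1.1 p = f.1.1 (cartanIncl _ _ p) := by
  obtain ⟨e, he⟩ := exists_algEquiv_of_surjective (toReduction ρ) (restriction ha hb hd)
    (toReduction_surjective hρ) (restriction_surjective ha hb hd) fun f g => by
      rw [toReduction_eq_iff, restriction_eq_iff]
  refine ⟨e, fun x y => ?_, fun f p => by rw [he]; rfl⟩
  -- The bracket of the reduction does not depend on the lifts, so tangential lifts may be used.
  obtain ⟨f, hf, rfl⟩ := exists_tangential_lift ha hb hρ x
  obtain ⟨g, hg, rfl⟩ := exists_tangential_lift ha hb hρ y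
  rw [reductionBracket_apply, he, he, he]
  exact Subtype.ext (bracket_cartanIncl hd f.1 g.1 hf hg)

end Poisson

end TorusReduction

end

theorem mainTheorem3 {r : ℕ} {V : Type*} [AddCommGroup V] [Module ℂ V] [FiniteDimensional ℂ V]
    (ρ : Representation ℂ (Fin r → ℂˣ) V) (hρ : IsRational ρ) (hvis : IsVisibleRep ρ) :
    IsPolar ρ ∧
    ∀ c : Submodule ℂ V, IsCartanSubspace ρ c →
      (∃ cd : Submodule ℂ (Module.Dual ℂ V), IsDualCartanPair ρ c cd) ∧
      ∀ (cd : Submodule ℂ (Module.Dual ℂ V)) (hd : IsDualCartanPair ρ c cd),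
        ∃ e : Reduction ρ ≃ₐ[ℂ] Orbifold hd,
          (∀ a b, e (reductionBracket hρ a b) = orbifoldBracket hd (e a) (e b)) ∧
          ∀ (f : Invariants (cotangent ρ)) (p : c × cd),
            (e (toReduction ρ f)).1.1 p = f.1.1 (cartanIncl c cd p) := by
  obtain ⟨n, m, b₀, hb₀⟩ := exists_isWeightBasis hρ
  obtain ⟨κ, _, a, ha⟩ := hb₀.exists_isCircuitSystem hvis
  refine ⟨⟨_, isCartanSubspace_span ha hb₀⟩, fun c hc => ?_⟩
  -- The weight basis is adapted to the given Cartan subspace; the weights and their circuits stay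
  -- the same.
  obtain ⟨b, hb, rfl⟩ := IsCartanSubspace.exists_isWeightBasis ha hb₀ hc
  refine ⟨exists_isDualCartanPair ha hb, fun cd hd => ?_⟩
  -- Whatever Hermitian form is used, the dual subspace is the span of the circuit forms.
  obtain rfl := hd.eq_span ha hb rfl
  exact exists_reduction_equiv ha hb hρ hd
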